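/- **Setting.** Let $\mathcal S\subseteq\mathbb R^{d_1}$, $\mathcal A\subseteq\mathbb R^{d_2}$ be the state and action spaces of a Markov decision process with transition kernel $P(\cdot\mid s,a)$, reward distribution $R(\cdot\mid s,a)$ and discount factor $\gamma\in(0,1)$; let $\pi(\cdot\mid s)$ be a policy and $\mathcal D$ a stationary distribution of state-action pairs under $\pi$. Write $x=(s,a)\in\mathcal X=\mathcal S\times\mathcal A\subseteq\mathbb R^{d}$, $d=d_1+d_2$, and let $\tilde{\mathcal D}$ be the law of $(x,r,x')$ with $x=(s,a)\sim\mathcal D$, $r\sim R(\cdot\mid s,a)$, $x'=(s',a')$, $s'\sim P(\cdot\mid s,a)$, $a'\sim\pi(\cdot\mid s')$ ($r$ and $x'$ being independent given $x$). Let $\alpha,\eta>0$ and let $\sigma:\mathbb R^d\times\mathbb R^D\to\mathbb R$ be an activation function, measurable in $x\in\mathcal X$ and twice differentiable in $\theta$. Assume that $\|x\|\le1$ for all $x\in\mathcal X$, that $|r|\le B_r$ almost surely under $R(\cdot\mid x)$ for all $x\in\mathcal X$, and that for all $x\in\mathcal X$, $\theta\in\mathbb R^D$ $$|\sigma(x;\theta)|\le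 B_0,\qquad \|\nabla_\theta\sigma(x;\theta)\|\le B_1\|x\|,\qquad \|\nabla^2_{\theta\theta}\sigma(x;\theta)\|_{\mathrm F}\le B_2\|x\|^2 .$$ *TD dynamics.* For $m\ge1$ and $\theta^{(m)}=(\theta_1,\dots,\theta_m)\in(\mathbb R^D)^m$ put $\hat Q(x;\theta^{(m)})=\frac{\alpha}{m}\sum_{i=1}^m\sigma(x;\theta_i)$. Let $\theta_1(0),\dots,\theta_m(0)$ be i.i.d. with law $\rho_0\in\mathscr P(\mathbb R^D)$, let $(x_k,r_k,x_k')$, $k\in\mathbb N$, be i.i.d. with law $\tilde{\mathcal D}$ and independent of the initialization, and, for a stepsize $\epsilon>0$, let $$\theta_i(k+1)=\theta_i(k)-\eta\epsilon\alpha\bigl(\hat Q(x_k;\theta^{(m)}(k))-r_k-\gamma\hat Q(x_k';\theta^{(m)}(k))\bigr)\nabla_\theta\sigma(x_k;\theta_i(k)),\qquad i=1,\dots,m .$$ Let $\hat\rho_k=m^{-1}\sum_{i=1}^m\delta_{\theta_i(k)}$. *PDE.* For $\rho\in\mathscr P(\mathbb R^D)$ put $Q(x;\rho)=\alpha\int\sigma(x;\theta)\,d\rho(\theta)$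 and $$g(\theta;\rho)=-\alpha\,\mathbb E_{(x,r,x')\sim\tilde{\mathcal D}}\bigl[(Q(x;\rho)-r-\gamma Q(x';\rho))\nabla_\theta\sigma(x;\theta)\bigr].$$ Let $T>0$ and let $(\rho_t)_{t\in[0,T]}$ be a weakly continuous curve in $\mathscr P(\mathbb R^D)$, with value $\rho_0$ at $t=0$, solving $\partial_t\rho_t=-\eta\,\mathrm{div}(\rho_t\,g(\cdot;\rho_t))$ in the sense of distributions, i.e. $\int\varphi\,d\rho_t=\int\varphi\,d\rho_0+\eta\int_0^t\!\int\langle\nabla\varphi,g(\cdot;\rho_s)\rangle\,d\rho_s\,ds$ for all $t\in[0,T]$ and $\varphi\in C_c^\infty(\mathbb R^D)$. **Proposition.** There is a constant $B>0$ depending only on $\alpha,\eta,\gamma,B_r,B_0,B_1,B_2$ such that the following holds in every such setting. Let $f:\mathbb R^D\to\mathbb R$ satisfy $\|f\|_\infty\le1$ and $\mathrm{Lip}(f)\le1$, and let $m\ge1$, $\epsilon>0$ and $\delta\in(0,1)$ with $m/\delta\ge2$. Then, with probability at least $1-\delta$, $$\sup_{\substack{k\le T/\epsilon\\ k\in\mathbb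 N}}\Bigl|\int f\,d\rho_{k\epsilon}-\int f\,d\hat\rho_k\Bigr|\le B\,e^{BT}\Bigl(\sqrt{\tfrac{\log(m/\delta)}{m}}+\sqrt{\epsilon\,\bigl(D+\log(m/\delta)\bigr)}\Bigr).$$ -/

import Mathlib

open MeasureTheory ProbabilityTheory Set

noncomputable section

namespace MeanFieldTD

/-- Euclidean space `ℝⁿ`. -/
abbrev Euc (n : ℕ) : Type := EuclideanSpace ℝ (Fin n)

/-- The space `ℝᵈ = ℝ^{d₁} × ℝ^{d₂}` of network inputs, with its Euclidean norm. -/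
abbrev Inp (d₁ d₂ : ℕ) : Type := WithLp 2 (Euc d₁ × Euc d₂)

/-- A state-action pair `x = (s, a)`, viewed as a vector of `ℝᵈ`. -/
def vec {d₁ d₂ : ℕ} {S : Set (Euc d₁)} {A : Set (Euc d₂)} (x : S × A) : Inp d₁ d₂ :=
  WithLp.toLp 2 ((x.1 : Euc d₁), (x.2 : Euc d₂))

/-! ### The Markov decision process -/

/-- The transition kernel of state-action pairs under the policy `pol`:
`s' ∼ P(· | s, a)` and then `a' ∼ pol(· | s')`. -/
def nextPair {d₁ d₂ : ℕ} {S : Set (Euc d₁)} {A : Set (Euc d₂)}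
    (P : Kernel (S × A) S) (pol : Kernel S A) : Kernel (S × A) (S × A) :=
  P.compProd (Kernel.prodMkLeft (S × A) pol)

/-- The law of `(x, r, x')` where `x = (s, a) ∼ 𝒟`, and, given `x`, independently
`r ∼ R(· | s, a)` and `x' = (s', a')` with `s' ∼ P(· | s, a)`, `a' ∼ pol(· | s')`. -/
def sampleLaw {d₁ d₂ : ℕ} {S : Set (Euc d₁)} {A : Set (Euc d₂)}
    (P : Kernel (S × A) S) (R : Kernel (S × A) ℝ) (pol : Kernel S A)
    (𝒟 : Measure (S × A)) : Measure ((S × A) × ℝ × (S × A)) :=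
  𝒟.compProd (R.prod (nextPair P pol))

/-! ### The network and the assumption on the activation function -/

/-- The Hessian matrix of a function on `ℝᴰ`. -/
def hessian {D : ℕ} (f : Euc D → ℝ) (θ : Euc D) : Matrix (Fin D) (Fin D) ℝ :=
  Matrix.of fun i j => (fderiv ℝ (gradient f) θ (EuclideanSpace.single j 1)) i

/-- The Frobenius norm of a matrix. -/
def frobeniusNorm {D : ℕ} (M : Matrix (Fin D) (Fin D) ℝ) : ℝ :=
  √(∑ i, ∑ j, M i j ^ 2)

/-- The regularity of the activation function `σ(x; θ)` on the state-action pairs `x ∈ S × A`. -/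
structure ActivationBounds {d₁ d₂ D : ℕ} (S : Set (Euc d₁)) (A : Set (Euc d₂))
    (σ : Inp d₁ d₂ → Euc D → ℝ) (B₀ B₁ B₂ : ℝ) : Prop where
  measurable : ∀ θ, Measurable fun x : S × A => σ (vec x) θ
  differentiable : ∀ x : S × A, Differentiable ℝ (σ (vec x))
  differentiable_gradient : ∀ x : S × A, Differentiable ℝ (gradient (σ (vec x)))
  bound : ∀ (x : S × A) θ, |σ (vec x) θ| ≤ B₀
  gradient_bound : ∀ (x : S × A) θ, ‖gradient (σ (vec x)) θ‖ ≤ B₁ * ‖vec x‖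
  hessian_bound : ∀ (x : S × A) θ, frobeniusNorm (hessian (σ (vec x)) θ) ≤ B₂ * ‖vec x‖ ^ 2

/-- The network of width `m`: `(α / m) ∑ᵢ σ(x; θᵢ)`. -/
def netQ {d₁ d₂ D m : ℕ} (α : ℝ) (σ : Inp d₁ d₂ → Euc D → ℝ) (x : Inp d₁ d₂)
    (θ : Fin m → Euc D) : ℝ :=
  α / m * ∑ i, σ x (θ i)

/-- The infinitely wide network: `α ∫ σ(x; θ) dρ(θ)`. -/
def meanQ {d₁ d₂ D : ℕ} (α : ℝ) (σ : Inp d₁ d₂ → Euc D → ℝ) (x : Inp d₁ d₂)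
    (ρ : Measure (Euc D)) : ℝ :=
  α * ∫ θ, σ x θ ∂ρ

/-! ### The TD dynamics -/

/-- The TD iterates `θ(k) = (θ₁(k), …, θₘ(k))`, started at `θ₀` and driven by the samples
`z k = (x_k, r_k, x'_k)`. -/
def tdIterate {d₁ d₂ D m : ℕ} {S : Set (Euc d₁)} {A : Set (Euc d₂)}
    (α η γ ε : ℝ) (σ : Inp d₁ d₂ → Euc D → ℝ)
    (θ₀ : Fin m → Euc D) (z : ℕ → (S × A) × ℝ × (S × A)) : ℕ → Fin m → Euc D
  | 0 => θ₀
  | k + 1 => fun i =>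
      let θ := tdIterate α η γ ε σ θ₀ z k
      θ i - (η * ε * α * (netQ α σ (vec (z k).1) θ - (z k).2.1
          - γ * netQ α σ (vec (z k).2.2) θ)) • gradient (σ (vec (z k).1)) (θ i)

/-- The empirical distribution `m⁻¹ ∑ᵢ δ_{θᵢ}`. -/
def empirical {D m : ℕ} (θ : Fin m → Euc D) : Measure (Euc D) :=
  (m : ENNReal)⁻¹ • ∑ i, Measure.dirac (θ i)

/-- The randomness of the TD algorithm: the initial particles `θ₀ i` are i.i.d. with law `ρ₀`,
the samples `z k` are i.i.d. with law `ν`, and the initial particles are independent of the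
samples. -/
structure IsTDSampling {Ω Z E : Type*} [MeasurableSpace Ω] [MeasurableSpace Z]
    [MeasurableSpace E] {m : ℕ} (μ : Measure Ω) (ρ₀ : Measure E) (ν : Measure Z)
    (θ₀ : Fin m → Ω → E) (z : ℕ → Ω → Z) : Prop where
  measurable_init : ∀ i, Measurable (θ₀ i)
  measurable_sample : ∀ k, Measurable (z k)
  law_init : ∀ i, μ.map (θ₀ i) = ρ₀
  law_sample : ∀ k, μ.map (z k) = ν
  indep_init : iIndepFun θ₀ μ
  indep_sample : iIndepFun z μ
  indep : IndepFun (fun ω i => θ₀ i ω) (fun ω k => z k ω) μ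

/-! ### The mean-field limit -/

/-- The vector field
`g(θ; ρ) = -α 𝔼_{(x, r, x') ∼ ν} [(Q(x; ρ) - r - γ Q(x'; ρ)) ∇_θ σ(x; θ)]`. -/
def driftField {d₁ d₂ D : ℕ} {S : Set (Euc d₁)} {A : Set (Euc d₂)}
    (α γ : ℝ) (σ : Inp d₁ d₂ → Euc D → ℝ) (ν : Measure ((S × A) × ℝ × (S × A)))
    (ρ : Measure (Euc D)) (θ : Euc D) : Euc D :=
  -α • ∫ z, (meanQ α σ (vec z.1) ρ - z.2.1 - γ * meanQ α σ (vec z.2.2) ρ) •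
    gradient (σ (vec z.1)) θ ∂ν

/-- `ρ` is a (narrowly continuous) distributional solution on `[0, T]` of the continuity equation
`∂ₜ ρₜ = -η div (ρₜ g(·; ρₜ))` with initial distribution `ρ₀`. The topology of
`ProbabilityMeasure` is that of weak convergence. -/
structure IsMeanFieldSolution {d₁ d₂ D : ℕ} {S : Set (Euc d₁)} {A : Set (Euc d₂)}
    (α η γ : ℝ) (σ : Inp d₁ d₂ → Euc D → ℝ) (ν : Measure ((S × A) × ℝ × (S × A)))
    (T : ℝ) (ρ₀ : ProbabilityMeasure (Euc D)) (ρ : ℝ → ProbabilityMeasure (Euc D)) : Prop where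
  continuousOn : ContinuousOn ρ (Icc 0 T)
  initial : ρ 0 = ρ₀
  weak : ∀ φ : Euc D → ℝ, ContDiff ℝ ((⊤ : ℕ∞) : WithTop ℕ∞) φ → HasCompactSupport φ → ∀ t ∈ Icc 0 T,
    ∫ θ, φ θ ∂(ρ t : Measure (Euc D)) = ∫ θ, φ θ ∂(ρ₀ : Measure (Euc D)) +
      η * ∫ s in (0 : ℝ)..t, ∫ θ, inner ℝ (gradient φ θ)
        (driftField α γ σ ν (ρ s : Measure (Euc D)) θ) ∂(ρ s : Measure (Euc D))

end MeanFieldTD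

end

/-!
# Propagation of chaos for mean-field temporal-difference learning

Write `L` for a common bound of the velocity fields of the mean-field equation and of their
Lipschitz constants. Three processes are compared: the solution `ρ` of the PDE, independent
particles that are distributed as `ρ 0` and follow a deterministic flow `Φ`, and the TD iterates
started from the same positions.

*The flow.* `Φ` is the Euler scheme with step `ε` for the velocity fields of `ρ`, averaged over
balls of radius `κ = √(ε (D + 1))`. The averages are `L κ`-close to the fields, still
`L`-Lipschitz, and their derivative is Lipschitz with constant of order `L D / κ`
(`norm_fderiv_ballAvg_sub_le`): Rademacher's theorem gives the derivative, and two balls of radius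
`κ` at distance `d` differ by at most a fraction `D d / κ` of their volume. No existence or
uniqueness theory for the PDE is needed to compare `ρ` with `Φ`: a test function is transported
backwards along the scheme, and each step is compared with the weak form of the PDE, which holds
for bounded `C¹` functions with bounded derivative (`IsContinuitySolution.weakIdentity`). One step
costs `O(ε κ)`, since its second-order term is `ε² D / κ ≤ ε κ`, and the regularity of the test
function grows by a factor `1 + O(ε)`. The result is
`IsContinuitySolution.abs_integral_sub_eulerFlow_mollifiedField_le`, with an error of order
`κ exp (O(T))`.

*The independent particles.* The quantities needed along the flow are averaged over time, and for
the interaction term also over samples. By convexity of the exponential an average of mean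
absolute deviations is as concentrated as a single one
(`measureReal_integral_abs_deviation_ge_le`), so no union bound over the time steps is taken.
Applied to the increments of `f ∘ Φ k` in `k`, which are `ε L`-bounded, this controls
`f ∘ Φ k` for all `k` simultaneously (`abs_deviation_le_sum`).

*The TD iterates.* A TD step is the mean-field step for the empirical distribution plus `ε` times
a bounded martingale increment. For sums of such increments in a Euclidean space, the exponential
square moment is bounded independently of the dimension (`lintegral_exp_norm_chain_sq_le`), and
stopping gives a maximal inequality (`measureReal_exists_norm_chain_ge_le`); a union bound over
the `m` particles costs the logarithm of `m / δ`. A discrete Grönwall argument then bounds the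
distance between the particles and the flow (`InteractionBounds.norm_sub_eulerFlow_le`), and
`InteractionBounds.exists_event` collects the estimates for `ε ≤ 1`. For `ε > 1` the right-hand
side exceeds `2`, and there is nothing to prove.
-/

namespace MeanFieldTD

open Module Metric

open scoped NNReal ENNReal Topology

set_option linter.unusedSectionVars false

/-! ### Averages over balls -/

section BallAverage

variable {E : Type*} [NormedAddCommGroup E] [InnerProductSpace ℝ E] [FiniteDimensional ℝ E]
  [MeasurableSpace E] [BorelSpace E]
  {F : Type*} [NormedAddCommGroup F] [NormedSpace ℝ F] [FiniteDimensional ℝ F]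

/-- The average of `g` over the ball of radius `κ` centred at `x`. -/
noncomputable def ballAvg (κ : ℝ) (g : E → F) (x : E) : F :=
  (volume.real (ball (0 : E) κ))⁻¹ • ∫ y in ball (0 : E) κ, g (x + y)

theorem volume_real_ball_pos {κ : ℝ} (hκ : 0 < κ) : 0 < volume.real (ball (0 : E) κ) :=
  ENNReal.toReal_pos (measure_ball_pos volume _ hκ).ne' measure_ball_lt_top.ne

theorem volume_real_ball_eq (x : E) {r : ℝ} (hr : 0 < r) :
    volume.real (ball x r) = r ^ finrank ℝ E * volume.real (ball (0 : E) 1) := by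
  rw [measureReal_def, Measure.addHaar_ball_of_pos _ _ hr, ENNReal.toReal_mul,
    ENNReal.toReal_ofReal (by positivity), measureReal_def]

/-- The volume of the difference of two balls of the same radius `κ` is at most the fraction
`finrank ℝ E * dist x y / κ` of the volume of the ball: the first ball minus the second one lies
in a spherical shell of width `dist x y`, and Bernoulli's inequality bounds its volume. -/
theorem volume_real_ball_diff_le {κ : ℝ} (hκ : 0 < κ) (x y : E) :
    volume.real (ball x κ \ ball y κ) ≤
      volume.real (ball (0 : E) κ) * (finrank ℝ E * dist x y / κ) := by
  rcases lt_or_ge (dist x y) κ with h | h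
  · have hsub : ball x (κ - dist x y) ⊆ ball y κ :=
      ball_subset_ball' (by linarith)
    have hsub' : ball x (κ - dist x y) ⊆ ball x κ := ball_subset_ball (by linarith [dist_nonneg (x := x) (y := y)])
    have h1 : volume.real (ball x κ \ ball y κ) ≤
        volume.real (ball x κ) - volume.real (ball x (κ - dist x y)) := by
      rw [← measureReal_sdiff hsub' measurableSet_ball measure_ball_lt_top.ne]
      exact measureReal_mono (sdiff_subset_sdiff_right hsub)
        ((measure_mono sdiff_subset).trans_lt measure_ball_lt_top).ne
    refine h1.trans ?_
    rw [volume_real_ball_eq x hκ, volume_real_ball_eq x (sub_pos.2 h), volume_real_ball_eq 0 hκ]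
    have hb : 1 + (finrank ℝ E : ℝ) * (-(dist x y / κ)) ≤ (1 + -(dist x y / κ)) ^ finrank ℝ E := by
      apply one_add_mul_le_pow
      have : dist x y / κ < 1 := (div_lt_one hκ).2 h
      linarith
    have he : κ - dist x y = κ * (1 + -(dist x y / κ)) := by field_simp; ring
    rw [he, mul_pow]
    have hp : 0 ≤ κ ^ finrank ℝ E * volume.real (ball (0 : E) 1) := by positivity
    have := mul_le_mul_of_nonneg_left hb hp
    have e2 : (finrank ℝ E : ℝ) * dist x y / κ = finrank ℝ E * (dist x y / κ) := by ring
    rw [e2]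
    nlinarith
  · have hne : x ≠ y := by
      rintro rfl
      simp only [dist_self] at h
      linarith
    have : Nontrivial E := ⟨x, y, hne⟩
    have h1 : (1 : ℝ) ≤ finrank ℝ E := by exact_mod_cast finrank_pos (R := ℝ) (M := E)
    have h2 : 1 ≤ (finrank ℝ E : ℝ) * dist x y / κ := by
      rw [le_div_iff₀ hκ]; nlinarith
    calc volume.real (ball x κ \ ball y κ) ≤ volume.real (ball x κ) :=
          measureReal_mono sdiff_subset measure_ball_lt_top.ne
      _ = volume.real (ball (0 : E) κ) := by
          rw [volume_real_ball_eq x hκ, volume_real_ball_eq 0 hκ]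
      _ ≤ _ := le_mul_of_one_le_right measureReal_nonneg h2

variable {κ : ℝ} {g : E → F} {l : ℝ≥0}

theorem integrableOn_ball_comp_add (hg : Continuous g) (x : E) :
    IntegrableOn (fun y => g (x + y)) (ball (0 : E) κ) := by
  have hc : Continuous fun y => g (x + y) := by fun_prop
  exact (hc.continuousOn.integrableOn_compact (isCompact_closedBall 0 κ)).mono_set
    ball_subset_closedBall

theorem norm_ballAvg_sub_le (hκ : 0 < κ) (hg : Continuous g) {c : ℝ} {x : E} {a : F}
    (h : ∀ y ∈ ball (0 : E) κ, ‖g (x + y) - a‖ ≤ c) : ‖ballAvg κ g x - a‖ ≤ c := by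
  have hv := volume_real_ball_pos (E := E) hκ
  have h1 : ballAvg κ g x - a =
      (volume.real (ball (0 : E) κ))⁻¹ • ∫ y in ball (0 : E) κ, (g (x + y) - a) := by
    rw [integral_sub (integrableOn_ball_comp_add hg x)
      (integrableOn_const measure_ball_lt_top.ne), setIntegral_const, smul_sub, smul_smul,
      inv_mul_cancel₀ hv.ne', one_smul, ballAvg]
  have h2 := norm_setIntegral_le_of_norm_le_const (f := fun y => g (x + y) - a)
    (measure_ball_lt_top (μ := volume) (x := (0 : E)) (r := κ)) h
  rw [h1, norm_smul, norm_inv, Real.norm_of_nonneg hv.le, inv_mul_le_iff₀ hv]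
  linarith

theorem norm_ballAvg_le (hκ : 0 < κ) (hg : Continuous g) {c : ℝ} (h : ∀ y, ‖g y‖ ≤ c) (x : E) :
    ‖ballAvg κ g x‖ ≤ c := by
  simpa using norm_ballAvg_sub_le (a := 0) hκ hg (x := x) (c := c) fun y _ => by simpa using h _

theorem norm_ballAvg_sub_self_le (hκ : 0 < κ) (hg : LipschitzWith l g) (x : E) :
    ‖ballAvg κ g x - g x‖ ≤ l * κ := by
  refine norm_ballAvg_sub_le hκ hg.continuous fun y hy => ?_
  have := hg.norm_sub_le (x + y) x
  rw [add_sub_cancel_left] at this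
  exact this.trans (by gcongr; exact (mem_ball_zero_iff.1 hy).le)

theorem ballAvg_sub (hg : Continuous g) (x x' : E) :
    ballAvg κ g x - ballAvg κ g x' =
      (volume.real (ball (0 : E) κ))⁻¹ • ∫ y in ball (0 : E) κ, (g (x + y) - g (x' + y)) := by
  rw [integral_sub (integrableOn_ball_comp_add hg x) (integrableOn_ball_comp_add hg x'), smul_sub]
  rfl

theorem lipschitzWith_ballAvg (hκ : 0 < κ) (hg : LipschitzWith l g) :
    LipschitzWith l (ballAvg κ g) := by
  refine LipschitzWith.of_dist_le_mul fun x x' => ?_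
  have hv := volume_real_ball_pos (E := E) hκ
  have h2 := norm_setIntegral_le_of_norm_le_const (f := fun y => g (x + y) - g (x' + y))
    (C := l * dist x x')
    (measure_ball_lt_top (μ := volume) (x := (0 : E)) (r := κ)) fun y _ => by
      have := hg.dist_le_mul (x + y) (x' + y)
      rwa [dist_add_right, dist_eq_norm] at this
  rw [dist_eq_norm, ballAvg_sub hg.continuous, norm_smul, norm_inv, Real.norm_of_nonneg hv.le,
    inv_mul_le_iff₀ hv]
  linarith

/-- The average of a Lipschitz function over balls is differentiable everywhere: by Rademacher's
theorem the function is differentiable almost everywhere on each ball. -/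
theorem hasFDerivAt_ballAvg (hg : LipschitzWith l g) (x : E) :
    HasFDerivAt (ballAvg κ g)
      ((volume.real (ball (0 : E) κ))⁻¹ • ∫ y in ball x κ, fderiv ℝ g y) x := by
  have htr : ∫ y in ball (0 : E) κ, fderiv ℝ g (x + y) = ∫ y in ball x κ, fderiv ℝ g y := by
    have h := (measurePreserving_add_left (volume : Measure E) x).setIntegral_preimage_emb
      (measurableEmbedding_addLeft x) (fderiv ℝ g) (ball x κ)
    rw [← h]
    congr 2
    ext y
    simp [mem_ball, dist_eq_norm]
  rw [← htr]
  have hae : ∀ᵐ y ∂(volume.restrict (ball (0 : E) κ)), DifferentiableAt ℝ g (x + y) := by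
    refine ae_restrict_of_ae ?_
    have := hg.ae_differentiableAt (μ := (volume : Measure E))
    exact (measurePreserving_add_left (volume : Measure E) x).quasiMeasurePreserving.ae this
  have hmeas : Measurable (fderiv ℝ g) := measurable_fderiv ℝ g
  refine HasFDerivAt.const_smul ?_ _
  refine (hasFDerivAt_integral_of_dominated_loc_of_lip (s := univ) (bound := fun _ => (l : ℝ))
    (F := fun x y => g (x + y)) (F' := fun y => fderiv ℝ g (x + y)) Filter.univ_mem
    ?_ (integrableOn_ball_comp_add hg.continuous x) ?_ ?_
    (integrableOn_const measure_ball_lt_top.ne) ?_).2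
  · exact Filter.Eventually.of_forall fun x =>
      (integrableOn_ball_comp_add hg.continuous x).aestronglyMeasurable
  · exact (hmeas.comp (measurable_const_add x)).stronglyMeasurable.aestronglyMeasurable
  · refine Filter.Eventually.of_forall fun y => LipschitzOnWith.of_dist_le_mul fun a _ b _ => ?_
    have := hg.dist_le_mul (a + y) (b + y)
    rw [dist_add_right] at this
    simpa using this
  · filter_upwards [hae] with y hy
    have h1 : HasFDerivAt g (fderiv ℝ g (x + y)) (x + y) := hy.hasFDerivAt
    exact (hasFDerivAt_comp_add_right y).2 h1

theorem differentiable_ballAvg (hg : LipschitzWith l g) : Differentiable ℝ (ballAvg κ g) :=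
  fun x => (hasFDerivAt_ballAvg hg x).differentiableAt

theorem norm_fderiv_ballAvg_sub_le (hκ : 0 < κ) (hg : LipschitzWith l g) (x x' : E) :
    ‖fderiv ℝ (ballAvg κ g) x - fderiv ℝ (ballAvg κ g) x'‖ ≤
      2 * l * finrank ℝ E / κ * ‖x - x'‖ := by
  have hv := volume_real_ball_pos (E := E) hκ
  have hmeas : Measurable (fderiv ℝ g) := measurable_fderiv ℝ g
  have hint : ∀ x, IntegrableOn (fderiv ℝ g) (ball x κ) := fun x =>
    Measure.integrableOn_of_bounded measure_ball_lt_top.ne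
      hmeas.stronglyMeasurable.aestronglyMeasurable
      (Filter.Eventually.of_forall fun y => norm_fderiv_le_of_lipschitz ℝ hg)
  have hd : ∀ x x' : E, ‖∫ y in ball x κ \ ball x' κ, fderiv ℝ g y‖ ≤
      l * (volume.real (ball (0 : E) κ) * (finrank ℝ E * ‖x - x'‖ / κ)) := fun x x' => by
    refine (norm_setIntegral_le_of_norm_le_const (C := l)
      ((measure_mono sdiff_subset).trans_lt measure_ball_lt_top)
      fun y _ => norm_fderiv_le_of_lipschitz ℝ hg).trans ?_
    gcongr
    rw [← dist_eq_norm]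
    exact volume_real_ball_diff_le hκ x x'
  have e1 := integral_inter_add_sdiff (t := ball x' κ) measurableSet_ball (hint x)
  have e2 := integral_inter_add_sdiff (t := ball x κ) measurableSet_ball (hint x')
  rw [inter_comm] at e2
  rw [(hasFDerivAt_ballAvg hg x).fderiv, (hasFDerivAt_ballAvg hg x').fderiv, ← smul_sub, ← e1,
    ← e2, add_sub_add_left_eq_sub, norm_smul, norm_inv, Real.norm_of_nonneg hv.le,
    inv_mul_le_iff₀ hv]
  have h1 := hd x x'
  have h2 := hd x' x
  rw [norm_sub_rev x' x] at h2
  refine (norm_sub_le _ _).trans ((add_le_add h1 h2).trans (le_of_eq ?_))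
  ring

end BallAverage

/-! ### Continuity equations and their test functions -/

section ContinuityEquation

variable {E : Type*} [NormedAddCommGroup E] [InnerProductSpace ℝ E] [FiniteDimensional ℝ E]
  [MeasurableSpace E] [BorelSpace E]

theorem integrable_of_continuous_of_bound {F : Type*} [NormedAddCommGroup F]
    [SecondCountableTopology F] {μ : Measure E}
    [IsFiniteMeasure μ] {f : E → F} {M : ℝ} (hf : Continuous f) (hM : ∀ x, ‖f x‖ ≤ M) :
    Integrable f μ :=
  Integrable.of_bound hf.aestronglyMeasurable M (Filter.Eventually.of_forall hM)

/-- `ρ` is a narrowly continuous distributional solution on `[0, T]` of the linear continuity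
equation `∂ₜ ρₜ = -div (ρₜ bₜ)`, whose field `b` is bounded by `L`, `L`-Lipschitz in space, and
continuous in time uniformly in space. -/
structure IsContinuitySolution (T : ℝ) (L : ℝ≥0) (b : ℝ → E → E) (ρ : ℝ → ProbabilityMeasure E) :
    Prop where
  continuousOn : ContinuousOn ρ (Icc 0 T)
  norm_le : ∀ s θ, ‖b s θ‖ ≤ L
  lipschitz : ∀ s, LipschitzWith L (b s)
  tendstoUniformly : ∀ s ∈ Icc 0 T, TendstoUniformly b (b s) (𝓝[Icc 0 T] s)
  weak : ∀ φ : E → ℝ, ContDiff ℝ ((⊤ : ℕ∞) : WithTop ℕ∞) φ → HasCompactSupport φ → ∀ t ∈ Icc 0 T,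
    ∫ θ, φ θ ∂(ρ t : Measure E) = ∫ θ, φ θ ∂(ρ 0 : Measure E) +
      ∫ s in (0 : ℝ)..t, ∫ θ, fderiv ℝ φ θ (b s θ) ∂(ρ s : Measure E)

/-- The weak form of the continuity equation, tested against `ψ`. -/
def WeakIdentity (T : ℝ) (b : ℝ → E → E) (ρ : ℝ → ProbabilityMeasure E) (ψ : E → ℝ) : Prop :=
  ∀ t ∈ Icc 0 T, ∫ θ, ψ θ ∂(ρ t : Measure E) = ∫ θ, ψ θ ∂(ρ 0 : Measure E) +
      ∫ s in (0 : ℝ)..t, ∫ θ, fderiv ℝ ψ θ (b s θ) ∂(ρ s : Measure E)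

/-- A bounded test function with bounded Lipschitz derivative. -/
structure IsSmoothTest (ψ : E → ℝ) (M l l₂ : ℝ) : Prop where
  differentiable : Differentiable ℝ ψ
  abs_le : ∀ θ, |ψ θ| ≤ M
  norm_fderiv_le : ∀ θ, ‖fderiv ℝ ψ θ‖ ≤ l
  norm_fderiv_sub_le : ∀ θ θ', ‖fderiv ℝ ψ θ - fderiv ℝ ψ θ'‖ ≤ l₂ * ‖θ - θ'‖

theorem continuous_of_norm_sub_le {F : Type*} [NormedAddCommGroup F] {f : E → F} {K : ℝ}
    (h : ∀ x y, ‖f x - f y‖ ≤ K * ‖x - y‖) : Continuous f :=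
  (LipschitzWith.of_dist_le_mul (K := K.toNNReal) fun x y => by
    rw [dist_eq_norm, dist_eq_norm]
    exact (h x y).trans (by gcongr; exact Real.le_coe_toNNReal K)).continuous

namespace IsSmoothTest

variable {ψ : E → ℝ} {M l l₂ : ℝ}

theorem contDiff (h : IsSmoothTest ψ M l l₂) : ContDiff ℝ 1 ψ :=
  contDiff_one_iff_fderiv.2 ⟨h.differentiable, continuous_of_norm_sub_le h.norm_fderiv_sub_le⟩

theorem abs_taylor_le (h : IsSmoothTest ψ M l l₂) (hl₂ : 0 ≤ l₂) (θ v : E) :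
    |ψ (θ + v) - ψ θ - fderiv ℝ ψ θ v| ≤ l₂ * ‖v‖ ^ 2 := by
  have := (convex_closedBall θ ‖v‖).norm_image_sub_le_of_norm_fderiv_le' (𝕜 := ℝ)
    (φ := fderiv ℝ ψ θ) (C := l₂ * ‖v‖) (x := θ) (y := θ + v)
    (fun x _ => h.differentiable x) (fun x hx => (h.norm_fderiv_sub_le x θ).trans (by
      gcongr; rwa [mem_closedBall, dist_eq_norm] at hx))
    (mem_closedBall_self (norm_nonneg _)) (by simp [mem_closedBall, dist_eq_norm])
  rw [add_sub_cancel_left] at this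
  rw [← Real.norm_eq_abs]
  refine this.trans (le_of_eq (by ring))

/-- Test functions are stable under composition with a perturbation of the identity. -/
theorem comp_add_smul (hψ : IsSmoothTest ψ M l l₂) (hl : 0 ≤ l) (hl₂ : 0 ≤ l₂) {c : E → E}
    {L h K : ℝ} (hh : 0 ≤ h) (hL : 0 ≤ L)
    (hc : Differentiable ℝ c) (hcL : ∀ θ, ‖fderiv ℝ c θ‖ ≤ L)
    (hcK : ∀ θ θ', ‖fderiv ℝ c θ - fderiv ℝ c θ'‖ ≤ K * ‖θ - θ'‖) :
    IsSmoothTest (fun θ => ψ (θ + h • c θ)) M ((1 + h * L) * l)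
      ((1 + h * L) ^ 2 * l₂ + h * K * l) := by
  have hA : ∀ θ, HasFDerivAt (fun θ => θ + h • c θ)
      (ContinuousLinearMap.id ℝ E + h • fderiv ℝ c θ) θ := fun θ =>
    (hasFDerivAt_id θ).add ((hc θ).hasFDerivAt.const_smul h)
  have hAn : ∀ θ, ‖ContinuousLinearMap.id ℝ E + h • fderiv ℝ c θ‖ ≤ 1 + h * L := fun θ => by
    refine (norm_add_le _ _).trans (add_le_add ContinuousLinearMap.norm_id_le ?_)
    rw [norm_smul, Real.norm_of_nonneg hh]
    gcongr
    exact hcL θ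
  have hd : ∀ θ, HasFDerivAt (fun θ => ψ (θ + h • c θ))
      ((fderiv ℝ ψ (θ + h • c θ)).comp (ContinuousLinearMap.id ℝ E + h • fderiv ℝ c θ)) θ :=
    fun θ => (hψ.differentiable _).hasFDerivAt.comp θ (hA θ)
  refine ⟨fun θ => (hd θ).differentiableAt, fun θ => hψ.abs_le _, fun θ => ?_, fun θ θ' => ?_⟩
  · rw [(hd θ).fderiv, mul_comm]
    refine (ContinuousLinearMap.opNorm_comp_le _ _).trans ?_
    gcongr
    · exact hψ.norm_fderiv_le _
    · exact hAn θ
  · rw [(hd θ).fderiv, (hd θ').fderiv]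
    set A := ContinuousLinearMap.id ℝ E + h • fderiv ℝ c θ with hAdef
    set A' := ContinuousLinearMap.id ℝ E + h • fderiv ℝ c θ' with hA'def
    set P := fderiv ℝ ψ (θ + h • c θ)
    set P' := fderiv ℝ ψ (θ' + h • c θ')
    have e : P.comp A - P'.comp A' = (P - P').comp A + P'.comp (A - A') := by
      ext x; simp
    have h1 : ‖(θ + h • c θ) - (θ' + h • c θ')‖ ≤ (1 + h * L) * ‖θ - θ'‖ :=
      convex_univ.norm_image_sub_le_of_norm_fderiv_le (𝕜 := ℝ) (f := fun θ => θ + h • c θ)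
        (fun x _ => (hA x).differentiableAt) (fun x _ => by rw [(hA x).fderiv]; exact hAn x)
        (mem_univ _) (mem_univ _)
    have h2 : ‖P - P'‖ ≤ l₂ * ((1 + h * L) * ‖θ - θ'‖) :=
      (hψ.norm_fderiv_sub_le _ _).trans (by gcongr)
    have h3 : ‖A - A'‖ ≤ h * (K * ‖θ - θ'‖) := by
      rw [hAdef, hA'def, add_sub_add_left_eq_sub, ← smul_sub, norm_smul, Real.norm_of_nonneg hh]
      gcongr
      exact hcK θ θ'
    rw [e]
    calc ‖(P - P').comp A + P'.comp (A - A')‖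
        ≤ ‖P - P'‖ * ‖A‖ + ‖P'‖ * ‖A - A'‖ :=
          (norm_add_le _ _).trans (add_le_add (ContinuousLinearMap.opNorm_comp_le _ _)
            (ContinuousLinearMap.opNorm_comp_le _ _))
      _ ≤ l₂ * ((1 + h * L) * ‖θ - θ'‖) * (1 + h * L) + l * (h * (K * ‖θ - θ'‖)) := by
          gcongr
          · exact hAn θ
          · exact hψ.norm_fderiv_le _
      _ = _ := by ring

end IsSmoothTest

/-- Averages over balls turn bounded Lipschitz functions into test functions. -/
theorem isSmoothTest_ballAvg {f : E → ℝ} {M κ : ℝ} {l : ℝ≥0} (hκ : 0 < κ)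
    (hM : ∀ θ, |f θ| ≤ M) (hf : LipschitzWith l f) :
    IsSmoothTest (ballAvg κ f) M l (2 * l * finrank ℝ E / κ) where
  differentiable := differentiable_ballAvg hf
  abs_le := norm_ballAvg_le hκ hf.continuous hM
  norm_fderiv_le _ := norm_fderiv_le_of_lipschitz ℝ (lipschitzWith_ballAvg hκ hf)
  norm_fderiv_sub_le := norm_fderiv_ballAvg_sub_le hκ hf

theorem norm_normed_convolution_le {F : Type*} [NormedAddCommGroup F] [NormedSpace ℝ F]
    [CompleteSpace F] (φ : ContDiffBump (0 : E)) {f : E → F} {c : ℝ} (hf : AEStronglyMeasurable f)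
    (hc : ∀ x, ‖f x‖ ≤ c) (x : E) :
    ‖convolution (φ.normed volume) f (ContinuousLinearMap.lsmul ℝ ℝ) volume x‖ ≤ 3 * c := by
  have := φ.dist_normed_convolution_le (μ := volume) (g := f) (x₀ := x) (ε := 2 * c) hf
    fun y _ => by
      rw [dist_eq_norm]
      linarith [norm_sub_le (f y) (f x), hc y, hc x]
  rw [dist_eq_norm] at this
  linarith [norm_le_norm_add_norm_sub' (convolution (φ.normed volume) f
    (ContinuousLinearMap.lsmul ℝ ℝ) volume x) (f x), hc x]

variable {T : ℝ} {L : ℝ≥0} {b : ℝ → E → E} {ρ : ℝ → ProbabilityMeasure E}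

namespace IsContinuitySolution

theorem continuousOn_integral (h : IsContinuitySolution T L b ρ) {Ψ : E → E →L[ℝ] ℝ} {l : ℝ}
    (hΨ : Continuous Ψ) (hl : ∀ θ, ‖Ψ θ‖ ≤ l) :
    ContinuousOn (fun s => ∫ θ, Ψ θ (b s θ) ∂(ρ s : Measure E)) (Icc 0 T) := by
  intro s hs
  have hl0 : 0 ≤ l := (norm_nonneg _).trans (hl 0)
  have hc : ∀ τ, Continuous fun θ => Ψ θ (b τ θ) := fun τ => hΨ.clm_apply (h.lipschitz τ).continuous
  have hb : ∀ τ θ, ‖Ψ θ (b τ θ)‖ ≤ l * L := fun τ θ =>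
    ((Ψ θ).le_opNorm _).trans (by gcongr; exacts [hl θ, h.norm_le τ θ])
  have hi : ∀ τ τ', Integrable (fun θ => Ψ θ (b τ θ)) (ρ τ' : Measure E) := fun τ τ' =>
    integrable_of_continuous_of_bound (hc τ) (hb τ)
  have h1 : Filter.Tendsto (fun τ => ∫ θ, Ψ θ (b s θ) ∂(ρ τ : Measure E)) (𝓝[Icc 0 T] s)
      (𝓝 (∫ θ, Ψ θ (b s θ) ∂(ρ s : Measure E))) :=
    ProbabilityMeasure.tendsto_iff_forall_integral_tendsto.1 (h.continuousOn s hs)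
      (BoundedContinuousFunction.ofNormedAddCommGroup _ (hc s) _ (hb s))
  have h2 : Filter.Tendsto (fun τ => ∫ θ, Ψ θ (b τ θ) ∂(ρ τ : Measure E) -
      ∫ θ, Ψ θ (b s θ) ∂(ρ τ : Measure E)) (𝓝[Icc 0 T] s) (𝓝 0) := by
    rw [Metric.tendsto_nhds]
    intro e he
    have := Metric.tendstoUniformly_iff.1 (h.tendstoUniformly s hs) (e / (l + 1)) (by positivity)
    filter_upwards [this] with τ hτ
    rw [dist_zero_right, ← integral_sub (hi _ _) (hi _ _)]
    have : ‖∫ θ, (Ψ θ (b τ θ) - Ψ θ (b s θ)) ∂(ρ τ : Measure E)‖ ≤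
        l * (e / (l + 1)) * (ρ τ : Measure E).real univ := by
      refine norm_integral_le_of_norm_le_const (Filter.Eventually.of_forall fun θ => ?_)
      rw [← map_sub]
      refine ((Ψ θ).le_opNorm _).trans ?_
      have := (hτ θ).le
      rw [dist_comm, dist_eq_norm] at this
      gcongr
      exact hl θ
    rw [probReal_univ, mul_one] at this
    refine this.trans_lt ?_
    rw [mul_div_assoc', div_lt_iff₀ (by positivity)]
    nlinarith
  have h3 := h2.add h1
  simp only [sub_add_cancel, zero_add] at h3
  exact h3

theorem intervalIntegrable (h : IsContinuitySolution T L b ρ) {Ψ : E → E →L[ℝ] ℝ} {l : ℝ}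
    (hΨ : Continuous Ψ) (hl : ∀ θ, ‖Ψ θ‖ ≤ l) {s t : ℝ} (hs : s ∈ Icc 0 T) (ht : t ∈ Icc 0 T) :
    IntervalIntegrable (fun s => ∫ θ, Ψ θ (b s θ) ∂(ρ s : Measure E)) volume s t :=
  ((h.continuousOn_integral hΨ hl).mono (uIcc_subset_Icc hs ht)).intervalIntegrable

/-- The weak form passes to limits of test functions that converge pointwise together with their
derivatives and are uniformly bounded together with their derivatives. -/
theorem weakIdentity_of_tendsto (h : IsContinuitySolution T L b ρ) {ψ : E → ℝ} {ψs : ℕ → E → ℝ}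
    {M l : ℝ} (hd : ∀ n, ContDiff ℝ 1 (ψs n)) (hM : ∀ n θ, ‖ψs n θ‖ ≤ M)
    (hl : ∀ n θ, ‖fderiv ℝ (ψs n) θ‖ ≤ l) (hw : ∀ n, WeakIdentity T b ρ (ψs n))
    (hlim : ∀ θ, Filter.Tendsto (fun n => ψs n θ) Filter.atTop (𝓝 (ψ θ)))
    (hlim' : ∀ θ, Filter.Tendsto (fun n => fderiv ℝ (ψs n) θ) Filter.atTop (𝓝 (fderiv ℝ ψ θ))) :
    WeakIdentity T b ρ ψ := by
  intro t ht
  have hl0 : 0 ≤ l := (norm_nonneg _).trans (hl 0 0)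
  have hT : (0 : ℝ) ∈ Icc 0 T := ⟨le_rfl, ht.1.trans ht.2⟩
  have hcf : ∀ n, Continuous (fderiv ℝ (ψs n)) := fun n => (hd n).continuous_fderiv one_ne_zero
  have h1 : ∀ t, Filter.Tendsto (fun n => ∫ θ, ψs n θ ∂(ρ t : Measure E)) Filter.atTop
      (𝓝 (∫ θ, ψ θ ∂(ρ t : Measure E))) := fun t =>
    tendsto_integral_of_dominated_convergence (fun _ => M)
      (fun n => (hd n).continuous.aestronglyMeasurable) (integrable_const _)
      (fun n => Filter.Eventually.of_forall (hM n)) (Filter.Eventually.of_forall hlim)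
  have hb : ∀ n s θ, ‖fderiv ℝ (ψs n) θ (b s θ)‖ ≤ l * L := fun n s θ =>
    ((fderiv ℝ (ψs n) θ).le_opNorm _).trans (by gcongr; exacts [hl n θ, h.norm_le s θ])
  have h2 : ∀ s, Filter.Tendsto (fun n => ∫ θ, fderiv ℝ (ψs n) θ (b s θ) ∂(ρ s : Measure E))
      Filter.atTop (𝓝 (∫ θ, fderiv ℝ ψ θ (b s θ) ∂(ρ s : Measure E))) := fun s =>
    tendsto_integral_of_dominated_convergence (fun _ => l * L)
      (fun n => ((hcf n).clm_apply (h.lipschitz s).continuous).aestronglyMeasurable)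
      (integrable_const _) (fun n => Filter.Eventually.of_forall (hb n s))
      (Filter.Eventually.of_forall fun θ =>
        ((ContinuousLinearMap.apply ℝ ℝ (b s θ)).continuous.tendsto _).comp (hlim' θ))
  have h3 : Filter.Tendsto
      (fun n => ∫ s in (0 : ℝ)..t, ∫ θ, fderiv ℝ (ψs n) θ (b s θ) ∂(ρ s : Measure E))
      Filter.atTop (𝓝 (∫ s in (0 : ℝ)..t, ∫ θ, fderiv ℝ ψ θ (b s θ) ∂(ρ s : Measure E))) := by
    refine intervalIntegral.tendsto_integral_filter_of_dominated_convergence (fun _ => l * L)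
      (Filter.Eventually.of_forall fun n => ?_) (Filter.Eventually.of_forall fun n =>
        Filter.Eventually.of_forall fun s _ => ?_) intervalIntegrable_const
      (Filter.Eventually.of_forall fun s _ => h2 s)
    · exact (intervalIntegrable_iff.1
        (h.intervalIntegrable (hcf n) (hl n) hT ht)).aestronglyMeasurable
    · have := norm_integral_le_of_norm_le_const (μ := (ρ s : Measure E))
        (Filter.Eventually.of_forall (hb n s))
      rwa [probReal_univ, mul_one] at this
  refine tendsto_nhds_unique (h1 t) (((h1 0).add h3).congr fun n => ?_)
  exact (hw n t ht).symm

/-- The weak form holds for continuously differentiable test functions of compact support,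
since these are limits of their convolutions with smooth bump functions. -/
theorem weakIdentity_of_hasCompactSupport (h : IsContinuitySolution T L b ρ) {g : E → ℝ}
    (hg : ContDiff ℝ 1 g) (hs : HasCompactSupport g) : WeakIdentity T b ρ g := by
  let φ : ℕ → ContDiffBump (0 : E) := fun n =>
    ⟨1 / (n + 1), 2 / (n + 1), by positivity, by gcongr; norm_num⟩
  have hφ : Filter.Tendsto (fun n => (φ n).rOut) Filter.atTop (𝓝 0) := by
    have := tendsto_one_div_add_atTop_nhds_zero_nat (𝕜 := ℝ).const_mul 2
    simpa [φ, div_eq_mul_inv] using this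
  have hcf : Continuous (fderiv ℝ g) := hg.continuous_fderiv one_ne_zero
  obtain ⟨M, hM⟩ := hg.continuous.bounded_above_of_compact_support hs
  obtain ⟨l, hl⟩ := hcf.bounded_above_of_compact_support (hs.fderiv ℝ)
  have hfd : ∀ n, fderiv ℝ (convolution ((φ n).normed volume) g (ContinuousLinearMap.lsmul ℝ ℝ)
      volume) = convolution ((φ n).normed volume) (fderiv ℝ g) (ContinuousLinearMap.lsmul ℝ ℝ)
      volume := fun n => by
    ext1 x
    rw [(hs.hasFDerivAt_convolution_right (ContinuousLinearMap.lsmul ℝ ℝ)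
      ((φ n).continuous_normed.locallyIntegrable) hg x).fderiv]
    unfold convolution
    congr 1
  have hsm : ∀ n, ContDiff ℝ ((⊤ : ℕ∞) : WithTop ℕ∞) (convolution ((φ n).normed volume) g
      (ContinuousLinearMap.lsmul ℝ ℝ) volume) := fun n =>
    (φ n).hasCompactSupport_normed.contDiff_convolution_left _ (φ n).contDiff_normed
      hg.continuous.locallyIntegrable
  refine h.weakIdentity_of_tendsto (M := 3 * M) (l := 3 * l)
    (ψs := fun n => convolution ((φ n).normed volume) g (ContinuousLinearMap.lsmul ℝ ℝ) volume)
    (fun n => (hsm n).of_le (by exact_mod_cast le_top)) (fun n =>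
      norm_normed_convolution_le (φ n) hg.continuous.aestronglyMeasurable hM) ?_ (fun n => ?_)
    (fun x => ContDiffBump.convolution_tendsto_right_of_continuous hφ hg.continuous x)
    fun x => ?_
  · intro n θ
    rw [hfd]
    exact norm_normed_convolution_le (φ n) hcf.aestronglyMeasurable hl θ
  · exact h.weak _ (hsm n) ((φ n).hasCompactSupport_normed.convolution _ hs)
  · simp only [hfd]
    exact ContDiffBump.convolution_tendsto_right_of_continuous hφ hcf x

/-- The weak form holds for bounded, continuously differentiable test functions with bounded
derivative, by cutting them off at infinity. -/
theorem weakIdentity (h : IsContinuitySolution T L b ρ) {ψ : E → ℝ} {M l : ℝ}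
    (hψ : ContDiff ℝ 1 ψ) (hM : ∀ θ, |ψ θ| ≤ M) (hl : ∀ θ, ‖fderiv ℝ ψ θ‖ ≤ l) :
    WeakIdentity T b ρ ψ := by
  let χ : ContDiffBump (0 : E) := ⟨1, 2, by norm_num, by norm_num⟩
  have hχ : ContDiff ℝ 1 χ := χ.contDiff
  obtain ⟨c, hc⟩ := (hχ.continuous_fderiv one_ne_zero).bounded_above_of_compact_support
    (χ.hasCompactSupport.fderiv ℝ)
  have hM0 : 0 ≤ M := (abs_nonneg _).trans (hM 0)
  have hc0 : 0 ≤ c := (norm_nonneg _).trans (hc 0)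
  let a : ℕ → ℝ := fun n => 1 / ((n : ℝ) + 1)
  have ha0 : ∀ n, 0 < a n := fun n => by positivity
  have ha1 : ∀ n, a n ≤ 1 := fun n => by
    simp only [a]; rw [div_le_one (by positivity)]; linarith [(Nat.cast_nonneg n : (0 : ℝ) ≤ n)]
  have hal : Filter.Tendsto a Filter.atTop (𝓝 0) := tendsto_one_div_add_atTop_nhds_zero_nat
  have hs : ∀ n θ, HasFDerivAt (fun θ : E => χ (a n • θ)) (a n • fderiv ℝ χ (a n • θ)) θ := by
    intro n θ
    have h1 := ((hχ.differentiable one_ne_zero) (a n • θ)).hasFDerivAt.comp θ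
      ((hasFDerivAt_id θ).const_smul (a n))
    have e : a n • fderiv ℝ χ (a n • θ) =
        (fderiv ℝ χ (a n • θ)).comp (a n • ContinuousLinearMap.id ℝ E) := by
      ext v
      simp
    rw [e]
    exact h1
  have hd : ∀ n θ, HasFDerivAt (fun θ : E => χ (a n • θ) * ψ θ)
      (χ (a n • θ) • fderiv ℝ ψ θ + ψ θ • a n • fderiv ℝ χ (a n • θ)) θ := fun n θ =>
    (hs n θ).mul ((hψ.differentiable one_ne_zero) θ).hasFDerivAt
  have hev : ∀ θ : E, ∀ᶠ n in Filter.atTop, ∀ᶠ θ' in 𝓝 θ, χ (a n • θ') = 1 := fun θ => by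
    have h1 : Filter.Tendsto (fun n => ‖a n • θ‖) Filter.atTop (𝓝 0) := by
      simpa using (hal.smul_const θ).norm
    filter_upwards [h1.eventually (gt_mem_nhds one_pos)] with n hn
    have h2 : Filter.Tendsto (fun θ' : E => ‖a n • θ'‖) (𝓝 θ) (𝓝 ‖a n • θ‖) :=
      (continuous_const_smul (a n)).norm.tendsto θ
    filter_upwards [h2.eventually (gt_mem_nhds hn)] with θ' hθ'
    exact χ.one_of_mem_closedBall (by simpa [χ] using hθ'.le)
  refine h.weakIdentity_of_tendsto (M := M) (l := l + M * c)
    (ψs := fun n θ => χ (a n • θ) * ψ θ) (fun n => ?_) (fun n θ => ?_) (fun n θ => ?_)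
    (fun n => ?_) (fun θ => ?_) (fun θ => ?_)
  · exact (hχ.comp (contDiff_const_smul _)).mul hψ
  · rw [norm_mul, Real.norm_of_nonneg χ.nonneg]
    exact (mul_le_mul χ.le_one (hM θ) (abs_nonneg _) zero_le_one).trans (one_mul M).le
  · rw [(hd n θ).fderiv]
    refine (norm_add_le _ _).trans (add_le_add ?_ ?_)
    · rw [norm_smul, Real.norm_of_nonneg χ.nonneg]
      exact (mul_le_mul χ.le_one (hl θ) (norm_nonneg _) zero_le_one).trans (one_mul l).le
    · rw [norm_smul, norm_smul, Real.norm_of_nonneg (ha0 n).le]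
      refine mul_le_mul (hM θ) ?_ (by have := (ha0 n).le; positivity) hM0
      exact (mul_le_mul (ha1 n) (hc _) (norm_nonneg _) zero_le_one).trans (one_mul c).le
  · refine h.weakIdentity_of_hasCompactSupport ((hχ.comp (contDiff_const_smul _)).mul hψ) ?_
    exact HasCompactSupport.mul_right (χ.hasCompactSupport.comp_smul (ha0 n).ne')
  · refine tendsto_const_nhds.congr' ?_
    filter_upwards [hev θ] with n hn
    rw [hn.self_of_nhds, one_mul]
  · refine tendsto_const_nhds.congr' ?_
    filter_upwards [hev θ] with n hn
    refine Filter.EventuallyEq.fderiv_eq ?_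
    filter_upwards [hn] with θ' hθ'
    rw [hθ', one_mul]

theorem integral_sub_eq (h : IsContinuitySolution T L b ρ) {ψ : E → ℝ} {M l : ℝ}
    (hψ : ContDiff ℝ 1 ψ) (hM : ∀ θ, |ψ θ| ≤ M) (hl : ∀ θ, ‖fderiv ℝ ψ θ‖ ≤ l)
    {s t : ℝ} (hs : s ∈ Icc 0 T) (ht : t ∈ Icc 0 T) :
    ∫ θ, ψ θ ∂(ρ t : Measure E) - ∫ θ, ψ θ ∂(ρ s : Measure E) =
      ∫ τ in s..t, ∫ θ, fderiv ℝ ψ θ (b τ θ) ∂(ρ τ : Measure E) := by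
  have hT : (0 : ℝ) ∈ Icc 0 T := ⟨le_rfl, hs.1.trans hs.2⟩
  have hcf := hψ.continuous_fderiv one_ne_zero
  rw [h.weakIdentity hψ hM hl t ht, h.weakIdentity hψ hM hl s hs, add_sub_add_left_eq_sub,
    intervalIntegral.integral_interval_sub_left (h.intervalIntegrable hcf hl hT ht)
      (h.intervalIntegrable hcf hl hT hs)]

/-- A solution moves with speed at most `L` in the bounded Lipschitz distance. -/
theorem abs_integral_sub_le (h : IsContinuitySolution T L b ρ) {f : E → ℝ} {M : ℝ} {l : ℝ≥0}
    (hM : ∀ θ, |f θ| ≤ M) (hf : LipschitzWith l f)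
    {s t : ℝ} (hs : s ∈ Icc 0 T) (ht : t ∈ Icc 0 T) :
    |∫ θ, f θ ∂(ρ t : Measure E) - ∫ θ, f θ ∂(ρ s : Measure E)| ≤ l * L * |t - s| := by
  refine le_of_forall_pos_le_add fun e he => ?_
  obtain ⟨κ, hκ, hκe⟩ : ∃ κ : ℝ, 0 < κ ∧ 2 * (l * κ) ≤ e := by
    refine ⟨e / (2 * (l + 1)), by positivity, ?_⟩
    rw [mul_div_assoc', mul_div_assoc', div_le_iff₀ (by positivity)]
    nlinarith [l.coe_nonneg]
  have hg := isSmoothTest_ballAvg hκ hM hf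
  have h1 := h.integral_sub_eq hg.contDiff hg.abs_le hg.norm_fderiv_le hs ht
  have h2 : ‖∫ τ in s..t, ∫ θ, fderiv ℝ (ballAvg κ f) θ (b τ θ) ∂(ρ τ : Measure E)‖ ≤
      l * L * |t - s| := by
    refine intervalIntegral.norm_integral_le_of_norm_le_const fun τ _ => ?_
    have := norm_integral_le_of_norm_le_const (μ := (ρ τ : Measure E)) (C := l * L)
      (f := fun θ => fderiv ℝ (ballAvg κ f) θ (b τ θ)) (Filter.Eventually.of_forall fun θ =>
        (ContinuousLinearMap.le_opNorm _ _).trans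
          (mul_le_mul (hg.norm_fderiv_le θ) (h.norm_le τ θ) (norm_nonneg _) l.coe_nonneg))
    rwa [probReal_univ, mul_one] at this
  have h3 : ∀ τ, |∫ θ, ballAvg κ f θ ∂(ρ τ : Measure E) - ∫ θ, f θ ∂(ρ τ : Measure E)| ≤ l * κ :=
    fun τ => by
      rw [← integral_sub (integrable_of_continuous_of_bound hg.contDiff.continuous hg.abs_le)
        (integrable_of_continuous_of_bound hf.continuous hM)]
      have := norm_integral_le_of_norm_le_const (μ := (ρ τ : Measure E)) (C := l * κ)
        (f := fun θ => ballAvg κ f θ - f θ)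
        (Filter.Eventually.of_forall fun θ => norm_ballAvg_sub_self_le hκ hf θ)
      rwa [probReal_univ, mul_one] at this
  rw [← h1, Real.norm_eq_abs] at h2
  have a1 := abs_le.1 (h3 t)
  have a2 := abs_le.1 (h3 s)
  have a3 := abs_le.1 h2
  exact abs_le.2 ⟨by linarith, by linarith⟩

end IsContinuitySolution

end ContinuityEquation

/-! ### The Euler scheme of a continuity equation -/

section Euler

variable {E : Type*} [NormedAddCommGroup E] [InnerProductSpace ℝ E] [FiniteDimensional ℝ E]
  [MeasurableSpace E] [BorelSpace E]
  {T : ℝ} {L : ℝ≥0} {b : ℝ → E → E} {ρ : ℝ → ProbabilityMeasure E}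

/-- One Euler step of length `h` along a field `c` that is `L * κ`-close to `b s`. The error is
of second order in `h`, up to the term caused by the difference of the fields. -/
theorem IsContinuitySolution.abs_integral_sub_step_le (hρ : IsContinuitySolution T L b ρ)
    (hL : 1 ≤ L)
    (hbt : ∀ s ∈ Icc 0 T, ∀ t ∈ Icc 0 T, ∀ θ, ‖b t θ - b s θ‖ ≤ L ^ 2 * |t - s|)
    {ψ : E → ℝ} {M l l₂ : ℝ} (hψ : IsSmoothTest ψ M l l₂) (hl : 0 ≤ l) (hl₂ : 0 ≤ l₂)
    {s h κ : ℝ} (hh : 0 ≤ h) (hκ : 0 ≤ κ) (hs : s ∈ Icc 0 T) (hsh : s + h ∈ Icc 0 T) {c : E → E}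
    (hc : Continuous c) (hcL : ∀ θ, ‖c θ‖ ≤ L) (hcb : ∀ θ, ‖c θ - b s θ‖ ≤ L * κ) :
    |∫ θ, ψ θ ∂(ρ (s + h) : Measure E) - ∫ θ, ψ (θ + h • c θ) ∂(ρ s : Measure E)| ≤
      2 * L ^ 2 * h * ((h + κ) * l + h * l₂) := by
  have hL' : (1 : ℝ) ≤ L := by exact_mod_cast hL
  have hcf := hψ.contDiff.continuous_fderiv one_ne_zero
  set G0 := ∫ θ, fderiv ℝ ψ θ (b s θ) ∂(ρ s : Measure E) with hG0
  have hcont : ∀ τ, Continuous fun θ => fderiv ℝ ψ θ (b τ θ) := fun τ =>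
    hcf.clm_apply (hρ.lipschitz τ).continuous
  have hbd : ∀ τ θ, ‖fderiv ℝ ψ θ (b τ θ)‖ ≤ l * L := fun τ θ =>
    ((fderiv ℝ ψ θ).le_opNorm _).trans
      (mul_le_mul (hψ.norm_fderiv_le θ) (hρ.norm_le τ θ) (norm_nonneg _) hl)
  have hint : ∀ τ τ', Integrable (fun θ => fderiv ℝ ψ θ (b τ θ)) (ρ τ' : Measure E) :=
    fun τ τ' => integrable_of_continuous_of_bound (hcont τ) (hbd τ)
  have hlip : LipschitzWith (l₂.toNNReal * L + l.toNNReal * L) fun θ => fderiv ℝ ψ θ (b s θ) := by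
    refine LipschitzWith.of_dist_le_mul fun x y => ?_
    rw [dist_eq_norm, dist_eq_norm]
    have e : fderiv ℝ ψ x (b s x) - fderiv ℝ ψ y (b s y) =
        (fderiv ℝ ψ x - fderiv ℝ ψ y) (b s x) + fderiv ℝ ψ y (b s x - b s y) := by simp
    rw [e]
    calc _ ≤ l₂ * ‖x - y‖ * L + l * (L * ‖x - y‖) := by
          refine (norm_add_le _ _).trans (add_le_add
            ((ContinuousLinearMap.le_opNorm _ _).trans (mul_le_mul (hψ.norm_fderiv_sub_le _ _)
              (hρ.norm_le _ _) (norm_nonneg _) (by positivity)))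
            ((ContinuousLinearMap.le_opNorm _ _).trans (mul_le_mul (hψ.norm_fderiv_le _)
              ((hρ.lipschitz s).norm_sub_le x y) (norm_nonneg _) hl)))
      _ = _ := by
          push_cast
          rw [Real.coe_toNNReal _ hl, Real.coe_toNNReal _ hl₂]
          ring
  have h1 : |∫ θ, ψ θ ∂(ρ (s + h) : Measure E) - ∫ θ, ψ θ ∂(ρ s : Measure E) - h * G0| ≤
      (2 * l * L ^ 2 + l₂ * L ^ 2) * h * h := by
    have e : ∫ θ, ψ θ ∂(ρ (s + h) : Measure E) - ∫ θ, ψ θ ∂(ρ s : Measure E) - h * G0 =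
        ∫ τ in s..(s + h), (∫ θ, fderiv ℝ ψ θ (b τ θ) ∂(ρ τ : Measure E) - G0) := by
      rw [hρ.integral_sub_eq hψ.contDiff hψ.abs_le hψ.norm_fderiv_le hs hsh,
        intervalIntegral.integral_sub
          (hρ.intervalIntegrable hcf hψ.norm_fderiv_le hs hsh) intervalIntegrable_const]
      simp
    rw [e, ← Real.norm_eq_abs]
    refine (intervalIntegral.norm_integral_le_of_norm_le_const
      (C := (2 * l * L ^ 2 + l₂ * L ^ 2) * h) fun τ hτ => ?_).trans (by
        rw [add_sub_cancel_left, abs_of_nonneg hh])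
    rw [uIoc_of_le (by linarith)] at hτ
    have hτT : τ ∈ Icc 0 T := ⟨hs.1.trans hτ.1.le, hτ.2.trans hsh.2⟩
    have hτs : |τ - s| ≤ h := by rw [abs_of_pos (by linarith [hτ.1])]; linarith [hτ.2]
    have i1 : |∫ θ, fderiv ℝ ψ θ (b τ θ) ∂(ρ τ : Measure E) -
        ∫ θ, fderiv ℝ ψ θ (b s θ) ∂(ρ τ : Measure E)| ≤ l * (L ^ 2 * |τ - s|) := by
      rw [← integral_sub (hint _ _) (hint _ _)]
      have := norm_integral_le_of_norm_le_const (μ := (ρ τ : Measure E))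
        (C := l * (L ^ 2 * |τ - s|))
        (f := fun θ => fderiv ℝ ψ θ (b τ θ) - fderiv ℝ ψ θ (b s θ))
        (Filter.Eventually.of_forall fun θ => by
          rw [← map_sub]
          exact (ContinuousLinearMap.le_opNorm _ _).trans (mul_le_mul (hψ.norm_fderiv_le _)
            (hbt s hs τ hτT θ) (norm_nonneg _) hl))
      rwa [probReal_univ, mul_one] at this
    have i2 := hρ.abs_integral_sub_le (hbd s) hlip hs hτT
    push_cast at i2
    rw [Real.coe_toNNReal _ hl, Real.coe_toNNReal _ hl₂] at i2
    rw [← hG0] at i2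
    rw [Real.norm_eq_abs]
    calc _ ≤ l * (L ^ 2 * |τ - s|) + (l₂ * L + l * L) * L * |τ - s| :=
          (abs_sub_le _ _ _).trans (add_le_add i1 i2)
      _ = (2 * l * L ^ 2 + l₂ * L ^ 2) * |τ - s| := by ring
      _ ≤ _ := by gcongr
  have h2 : |∫ θ, ψ (θ + h • c θ) ∂(ρ s : Measure E) - ∫ θ, ψ θ ∂(ρ s : Measure E) - h * G0| ≤
      l₂ * (h * L) ^ 2 + h * (l * (L * κ)) := by
    have hψc := hψ.contDiff.continuous
    have j1 : Integrable (fun θ => ψ (θ + h • c θ)) (ρ s : Measure E) :=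
      integrable_of_continuous_of_bound (by fun_prop) fun _ => hψ.abs_le _
    have j2 : Integrable ψ (ρ s : Measure E) := integrable_of_continuous_of_bound hψc hψ.abs_le
    rw [hG0, ← integral_const_mul, ← integral_sub j1 j2,
      ← integral_sub (f := fun θ => ψ (θ + h • c θ) - ψ θ) (j1.sub j2) ((hint s s).const_mul h)]
    have := norm_integral_le_of_norm_le_const (μ := (ρ s : Measure E))
      (C := l₂ * (h * L) ^ 2 + h * (l * (L * κ)))
      (f := fun θ => ψ (θ + h • c θ) - ψ θ - h * fderiv ℝ ψ θ (b s θ))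
      (Filter.Eventually.of_forall fun θ => by
        have t1 := hψ.abs_taylor_le hl₂ θ (h • c θ)
        have t2 : ‖h • c θ‖ ≤ h * L := by
          rw [norm_smul, Real.norm_of_nonneg hh]; gcongr; exact hcL θ
        have t3 : |fderiv ℝ ψ θ (c θ - b s θ)| ≤ l * (L * κ) :=
          (ContinuousLinearMap.le_opNorm _ _).trans (mul_le_mul (hψ.norm_fderiv_le _)
            (hcb θ) (norm_nonneg _) hl)
        have e : ψ (θ + h • c θ) - ψ θ - h * fderiv ℝ ψ θ (b s θ) =
            (ψ (θ + h • c θ) - ψ θ - fderiv ℝ ψ θ (h • c θ)) +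
              h * fderiv ℝ ψ θ (c θ - b s θ) := by
          rw [map_sub, map_smul, smul_eq_mul]; ring
        rw [e]
        refine (norm_add_le _ _).trans (add_le_add (t1.trans (by gcongr)) ?_)
        rw [norm_mul, Real.norm_of_nonneg hh]
        gcongr
        exact t3)
    rwa [probReal_univ, mul_one] at this
  have h3 : (l * (L : ℝ) * κ) * h ≤ 2 * (l * L ^ 2 * κ) * h := by
    have : (L : ℝ) ≤ 2 * L ^ 2 := by nlinarith
    have := mul_le_mul_of_nonneg_left this (show 0 ≤ l * κ * h by positivity)
    linarith
  have a1 := abs_le.1 h1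
  have a2 := abs_le.1 h2
  refine abs_le.2 ⟨?_, ?_⟩ <;> nlinarith

/-- The flow of the explicit Euler scheme with step `h` along the fields `c 0, c 1, …`. -/
def eulerFlow (h : ℝ) (c : ℕ → E → E) : ℕ → E → E
  | 0 => id
  | k + 1 => fun θ => eulerFlow h c k θ + h • c k (eulerFlow h c k θ)

theorem continuous_eulerFlow (h : ℝ) {c : ℕ → E → E} (hc : ∀ k, Continuous (c k)) (k : ℕ) :
    Continuous (eulerFlow h c k) := by
  induction k with
  | zero => exact continuous_id
  | succ k ih => exact ih.add (((hc k).comp ih).const_smul h)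

/-- The law at time `n * h` of a solution of the continuity equation is close to the push-forward
of its initial law under the Euler flow. The test function is transported backwards along the
scheme; `w * l + h * l₂` measures its regularity and grows by a factor `exp ((2 * L + 1) * h)` per
step, while every step costs `2 * L ^ 2 * h` times this quantity. -/
theorem IsContinuitySolution.abs_integral_sub_eulerFlow_le (hρ : IsContinuitySolution T L b ρ)
    (hL : 1 ≤ L)
    (hbt : ∀ s ∈ Icc 0 T, ∀ t ∈ Icc 0 T, ∀ θ, ‖b t θ - b s θ‖ ≤ L ^ 2 * |t - s|)
    {h κ K w : ℝ} (hh : 0 ≤ h) (hκ : 0 ≤ κ) (hK : 0 ≤ K) (hw : h + κ ≤ w) (hw' : h * K ≤ w)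
    {c : ℕ → E → E} (hcL : ∀ k θ, ‖c k θ‖ ≤ L) (hcd : ∀ k, Differentiable ℝ (c k))
    (hcd' : ∀ k θ, ‖fderiv ℝ (c k) θ‖ ≤ L)
    (hcK : ∀ k θ θ', ‖fderiv ℝ (c k) θ - fderiv ℝ (c k) θ'‖ ≤ K * ‖θ - θ'‖)
    (hcb : ∀ k θ, ‖c k θ - b (k * h) θ‖ ≤ L * κ) (n : ℕ) (hn : n * h ≤ T)
    {ψ : E → ℝ} {M l l₂ : ℝ} (hψ : IsSmoothTest ψ M l l₂) (hl : 0 ≤ l) (hl₂ : 0 ≤ l₂) :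
    |∫ θ, ψ θ ∂(ρ (n * h) : Measure E) - ∫ θ, ψ (eulerFlow h c n θ) ∂(ρ 0 : Measure E)| ≤
      2 * L ^ 2 * (n * h) * Real.exp ((2 * L + 1) * (n * h)) * (w * l + h * l₂) := by
  have hL' : (1 : ℝ) ≤ L := by exact_mod_cast hL
  have hw0 : 0 ≤ w := by linarith
  induction n generalizing ψ l l₂ with
  | zero => simp [eulerFlow]
  | succ n ih =>
    push_cast at hn ⊢
    have hnh : 0 ≤ n * h := by positivity
    have hψ' := hψ.comp_add_smul hl hl₂ hh L.coe_nonneg (hcd n) (hcd' n) (hcK n)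
    have h1 := ih (by linarith) hψ' (by positivity) (by positivity)
    have h2 := hρ.abs_integral_sub_step_le hL hbt hψ hl hl₂ hh hκ (s := n * h)
      ⟨hnh, by linarith⟩ ⟨by linarith, by linarith⟩ (hcd n).continuous (hcL n) (hcb n)
    set N := w * l + h * l₂
    have hN0 : 0 ≤ N := by positivity
    have hN : w * ((1 + h * L) * l) + h * ((1 + h * L) ^ 2 * l₂ + h * K * l) ≤
        Real.exp ((2 * L + 1) * h) * N := by
      have e1 : (1 + h * L) ^ 2 ≤ Real.exp ((2 * L + 1) * h) := by
        have : 1 + h * L ≤ Real.exp (h * L) := by linarith [Real.add_one_le_exp (h * (L : ℝ))]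
        calc (1 + h * L) ^ 2 ≤ Real.exp (h * L) ^ 2 := by gcongr
          _ = Real.exp (2 * (h * L)) := by rw [← Real.exp_nat_mul]; norm_num
          _ ≤ _ := Real.exp_le_exp.2 (by nlinarith)
      have e2 : 1 + h * L + h ≤ Real.exp ((2 * L + 1) * h) := by
        have := Real.add_one_le_exp ((2 * (L : ℝ) + 1) * h)
        nlinarith
      calc _ = w * l * (1 + h * L) + h * K * (l * h) + h * l₂ * (1 + h * L) ^ 2 := by ring
        _ ≤ w * l * (1 + h * L) + w * (l * h) + h * l₂ * (1 + h * L) ^ 2 := by gcongr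
        _ = w * l * (1 + h * L + h) + h * l₂ * (1 + h * L) ^ 2 := by ring
        _ ≤ w * l * Real.exp ((2 * L + 1) * h) + h * l₂ * Real.exp ((2 * L + 1) * h) := by
          gcongr
        _ = _ := by ring
    have h3 : 2 * (L : ℝ) ^ 2 * h * ((h + κ) * l + h * l₂) ≤
        2 * L ^ 2 * h * (Real.exp ((2 * L + 1) * ((n + 1) * h)) * N) := by
      gcongr
      refine le_trans ?_ (le_mul_of_one_le_left hN0 (Real.one_le_exp (by positivity)))
      change _ ≤ w * l + h * l₂
      gcongr
    have h4 : 2 * (L : ℝ) ^ 2 * (n * h) * Real.exp ((2 * L + 1) * (n * h)) *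
        (w * ((1 + h * L) * l) + h * ((1 + h * L) ^ 2 * l₂ + h * K * l)) ≤
        2 * L ^ 2 * (n * h) * (Real.exp ((2 * L + 1) * ((n + 1) * h)) * N) := by
      have e : Real.exp ((2 * L + 1) * ((n + 1) * h)) =
          Real.exp ((2 * L + 1) * (n * h)) * Real.exp ((2 * L + 1) * h) := by
        rw [← Real.exp_add]; congr 1; ring
      rw [e, mul_assoc (Real.exp _), ← mul_assoc (2 * (L : ℝ) ^ 2 * (n * h))]
      gcongr
    have e : ((n : ℝ) + 1) * h = n * h + h := by ring
    rw [e] at h3 h4 ⊢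
    calc _ ≤ _ := abs_sub_le _ (∫ θ, ψ (θ + h • c n θ) ∂(ρ (n * h) : Measure E)) _
      _ ≤ _ := add_le_add (h2.trans h3) (h1.trans h4)
      _ = _ := by ring

/-- The fields along which the Euler scheme runs: averages of `b (k * h)` over balls of radius `κ`.
-/
noncomputable def mollifiedField (κ h : ℝ) (b : ℝ → E → E) (k : ℕ) : E → E :=
  ballAvg κ (b (k * h))

/-- The comparison of a solution with the Euler scheme along mollified fields, for bounded
Lipschitz test functions. Both the fields and the test function are mollified at scale `κ`, at a
cost of order `κ`; their second derivatives are of order `finrank ℝ E / κ`, so that the step `h`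
costs `h * finrank ℝ E / κ`. -/
theorem IsContinuitySolution.abs_integral_sub_eulerFlow_mollifiedField_le
    (hρ : IsContinuitySolution T L b ρ) (hL : 1 ≤ L)
    (hbt : ∀ s ∈ Icc 0 T, ∀ t ∈ Icc 0 T, ∀ θ, ‖b t θ - b s θ‖ ≤ L ^ 2 * |t - s|)
    {h κ : ℝ} (hh : 0 ≤ h) (hκ : 0 < κ) (hhκ : h ≤ κ) (hD : h * finrank ℝ E ≤ κ ^ 2)
    (n : ℕ) (hn : n * h ≤ T) {f : E → ℝ} {M : ℝ} {l : ℝ≥0}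
    (hM : ∀ θ, |f θ| ≤ M) (hf : LipschitzWith l f) :
    |∫ θ, f θ ∂(ρ (n * h) : Measure E) -
        ∫ θ, f (eulerFlow h (mollifiedField κ h b) n θ) ∂(ρ 0 : Measure E)| ≤
      12 * L ^ 3 * l * κ * Real.exp ((2 * L + 2) * T) := by
  have hL' : (1 : ℝ) ≤ L := by exact_mod_cast hL
  have hT : 0 ≤ T := le_trans (by positivity) hn
  have hDκ : h * (finrank ℝ E / κ) ≤ κ := by
    rw [mul_div_assoc', div_le_iff₀ hκ]; nlinarith
  have hg := isSmoothTest_ballAvg hκ hM hf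
  have hcont : ∀ k, Continuous (mollifiedField κ h b k) := fun k =>
    (lipschitzWith_ballAvg hκ (hρ.lipschitz (k * h))).continuous
  have hΦ := continuous_eulerFlow h hcont n
  have h1 := hρ.abs_integral_sub_eulerFlow_le hL hbt hh hκ.le (K := 2 * L * finrank ℝ E / κ)
    (w := (2 + 2 * L) * κ) (by positivity) (by nlinarith) (by
      calc h * (2 * L * finrank ℝ E / κ) = 2 * L * (h * (finrank ℝ E / κ)) := by ring
        _ ≤ 2 * L * κ := by gcongr
        _ ≤ _ := by nlinarith)
    (c := mollifiedField κ h b)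
    (fun k => norm_ballAvg_le hκ (hρ.lipschitz _).continuous (hρ.norm_le _))
    (fun k => differentiable_ballAvg (hρ.lipschitz _))
    (fun k _ => norm_fderiv_le_of_lipschitz ℝ (lipschitzWith_ballAvg hκ (hρ.lipschitz _)))
    (fun k => norm_fderiv_ballAvg_sub_le hκ (hρ.lipschitz _))
    (fun k θ => norm_ballAvg_sub_self_le hκ (hρ.lipschitz _) θ) n hn hg l.coe_nonneg
    (by positivity)
  have hm : ∀ (μ : Measure E) [IsProbabilityMeasure μ] (Ψ : E → E), Continuous Ψ →
      |∫ θ, ballAvg κ f (Ψ θ) ∂μ - ∫ θ, f (Ψ θ) ∂μ| ≤ l * κ := fun μ _ Ψ hΨ => by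
    rw [← integral_sub (f := fun θ => ballAvg κ f (Ψ θ)) (g := fun θ => f (Ψ θ))
      (integrable_of_continuous_of_bound (hg.contDiff.continuous.comp hΨ) fun _ => hg.abs_le _)
      (integrable_of_continuous_of_bound (hf.continuous.comp hΨ) fun _ => hM _)]
    have := norm_integral_le_of_norm_le_const (μ := μ) (C := l * κ)
      (f := fun θ => ballAvg κ f (Ψ θ) - f (Ψ θ))
      (Filter.Eventually.of_forall fun θ => norm_ballAvg_sub_self_le hκ hf _)
    rwa [probReal_univ, mul_one] at this
  have h2 := hm (ρ (n * h) : Measure E) id continuous_id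
  have h3 := hm (ρ 0 : Measure E) _ hΦ
  have h4 : 2 * (L : ℝ) ^ 2 * (n * h) * Real.exp ((2 * L + 1) * (n * h)) *
      ((2 + 2 * L) * κ * l + h * (2 * l * finrank ℝ E / κ)) ≤
      2 * L ^ 2 * T * Real.exp ((2 * L + 1) * T) * (6 * L * κ * l) := by
    gcongr
    calc _ = (2 + 2 * L) * κ * l + 2 * l * (h * (finrank ℝ E / κ)) := by ring
      _ ≤ (2 + 2 * L) * κ * l + 2 * l * κ := by gcongr
      _ = (4 + 2 * L) * (κ * l) := by ring
      _ ≤ (6 * L) * (κ * l) := by gcongr; linarith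
      _ = _ := by ring
  have h5 : 2 * (l * κ) + 2 * L ^ 2 * T * Real.exp ((2 * L + 1) * T) * (6 * L * κ * l) ≤
      12 * L ^ 3 * l * κ * Real.exp ((2 * L + 2) * T) := by
    have e1 : Real.exp ((2 * L + 2) * T) = Real.exp T * Real.exp ((2 * L + 1) * T) := by
      rw [← Real.exp_add]; congr 1; ring
    have e2 : 1 ≤ Real.exp ((2 * L + 1) * T) := Real.one_le_exp (by positivity)
    have e3 : 1 + T ≤ Real.exp T := by linarith [Real.add_one_le_exp T]
    have e4 : (1 : ℝ) ≤ L ^ 3 := one_le_pow₀ hL'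
    rw [e1]
    calc _ = (2 * 1 * 1 + 12 * L ^ 3 * T * Real.exp ((2 * L + 1) * T)) * (l * κ) := by ring
      _ ≤ (12 * L ^ 3 * Real.exp ((2 * L + 1) * T) +
            12 * L ^ 3 * T * Real.exp ((2 * L + 1) * T)) * (l * κ) := by
          gcongr
          linarith
      _ = 12 * L ^ 3 * (1 + T) * Real.exp ((2 * L + 1) * T) * (l * κ) := by ring
      _ ≤ 12 * L ^ 3 * Real.exp T * Real.exp ((2 * L + 1) * T) * (l * κ) := by gcongr
      _ = _ := by ring
  simp only [id_eq] at h2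
  have a1 := abs_le.1 (h1.trans h4)
  have a2 := abs_le.1 h2
  have a3 := abs_le.1 h3
  exact abs_le.2 ⟨by linarith, by linarith⟩

end Euler

/-! ### Concentration of empirical averages -/

section Averages

variable {Ω E I : Type*} [MeasurableSpace Ω] [MeasurableSpace E] [MeasurableSpace I]

/-- The deviation of the empirical mean of `h` at the points `x i` from its mean under `ρ₀`. -/
noncomputable def deviation {m : ℕ} (ρ₀ : Measure E) (x : Fin m → E) (h : E → ℝ) : ℝ :=
  (m : ℝ)⁻¹ * ∑ i, h (x i) - ∫ θ, h θ ∂ρ₀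

theorem abs_average_le {m : ℕ} {c : ℝ} (hc : 0 ≤ c) {a : Fin m → ℝ} (ha : ∀ i, |a i| ≤ c) :
    |(m : ℝ)⁻¹ * ∑ i, a i| ≤ c := by
  rw [abs_mul, abs_of_nonneg (by positivity)]
  have h1 : |∑ i, a i| ≤ m * c :=
    (Finset.abs_sum_le_sum_abs _ _).trans ((Finset.sum_le_sum fun i _ => ha i).trans (by simp))
  rcases Nat.eq_zero_or_pos m with rfl | hm
  · simpa using hc
  · rw [inv_mul_le_iff₀ (by positivity)]
    exact h1

theorem abs_integral_le_of_abs_le {μ : Measure E} [IsProbabilityMeasure μ] {f : E → ℝ} {c : ℝ}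
    (h : ∀ x, |f x| ≤ c) : |∫ x, f x ∂μ| ≤ c := by
  have := norm_integral_le_of_norm_le_const (μ := μ) (C := c) (f := f)
    (Filter.Eventually.of_forall h)
  rwa [probReal_univ, mul_one] at this

theorem abs_deviation_le {m : ℕ} {ρ₀ : Measure E} [IsProbabilityMeasure ρ₀] {x : Fin m → E}
    {h : E → ℝ} {c : ℝ} (hc : ∀ θ, |h θ| ≤ c) (hc0 : 0 ≤ c) : |deviation ρ₀ x h| ≤ 2 * c := by
  have h1 := abs_average_le hc0 fun i => hc (x i)
  have h2 := abs_integral_le_of_abs_le (μ := ρ₀) hc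
  exact (abs_sub _ _).trans (by linarith)

variable {m : ℕ} {μ : Measure Ω} [IsProbabilityMeasure μ] {ρ₀ : Measure E}
  {X : Fin m → Ω → E}

theorem mgf_deviation_le (hX : ∀ i, Measurable (X i)) (hlaw : ∀ i, μ.map (X i) = ρ₀)
    (hind : iIndepFun X μ) (hm : 1 ≤ m) {h : E → ℝ} (hh : Measurable h) {c : ℝ}
    (hc : ∀ θ, |h θ| ≤ c) (hc0 : 0 ≤ c) (t : ℝ) :
    mgf (fun ω => deviation ρ₀ (fun i => X i ω) h) μ t ≤ Real.exp (c ^ 2 * t ^ 2 / (2 * m)) := by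
  have hm0 : (0 : ℝ) < m := by exact_mod_cast hm
  have hmean : ∀ i, ∫ ω, h (X i ω) ∂μ = ∫ θ, h θ ∂ρ₀ := fun i => by
    rw [← hlaw i, integral_map (hX i).aemeasurable hh.aestronglyMeasurable]
  have hsub : ∀ i, HasSubgaussianMGF (fun ω => h (X i ω) - ∫ θ, h θ ∂ρ₀) (c.toNNReal ^ 2) μ :=
    fun i => by
      have h1 := hasSubgaussianMGF_of_mem_Icc (μ := μ) (X := fun ω => h (X i ω)) (a := -c) (b := c)
        (hh.comp (hX i)).aemeasurable (Filter.Eventually.of_forall fun ω => abs_le.1 (hc _))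
      rw [hmean i] at h1
      convert h1 using 1
      ext
      push_cast
      rw [Real.coe_toNNReal _ hc0, Real.norm_of_nonneg (by linarith)]
      ring
  have hind' : iIndepFun (fun i ω => h (X i ω) - ∫ θ, h θ ∂ρ₀) μ :=
    hind.comp (fun _ θ => h θ - ∫ θ, h θ ∂ρ₀) fun _ => hh.sub_const _
  have hsum := (HasSubgaussianMGF.sum_of_iIndepFun hind' (s := Finset.univ)
    fun i _ => hsub i).mgf_le (t / m)
  have e : (fun ω => deviation ρ₀ (fun i => X i ω) h) =
      fun ω => (m : ℝ)⁻¹ * ∑ i, (h (X i ω) - ∫ θ, h θ ∂ρ₀) := by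
    ext ω
    rw [deviation, Finset.sum_sub_distrib, mul_sub]
    simp [hm0.ne']
  rw [e, mgf]
  rw [mgf] at hsum
  convert hsum using 2
  · ext ω; field_simp
  · push_cast
    rw [Real.coe_toNNReal _ hc0]
    simp
    field_simp

/-- **Concentration.** For a family `h q` of bounded functions, the mean absolute deviation, over
a probability measure in `q`, of the empirical means of i.i.d. variables is sub-Gaussian: by
Jensen's inequality its exponential moments are bounded by those for a single `q`. -/
theorem measureReal_integral_abs_deviation_ge_le [IsProbabilityMeasure ρ₀]
    (hX : ∀ i, Measurable (X i)) (hlaw : ∀ i, μ.map (X i) = ρ₀) (hind : iIndepFun X μ)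
    (hm : 1 ≤ m) {Q : Measure I} [IsProbabilityMeasure Q] {h : I → E → ℝ}
    (hh : Measurable (Function.uncurry h)) {c : ℝ} (hc : ∀ q θ, |h q θ| ≤ c) (hc0 : 0 < c)
    {y : ℝ} (hy : 0 ≤ y) :
    μ.real {ω | y ≤ ∫ q, |deviation ρ₀ (fun i => X i ω) (h q)| ∂Q} ≤
      2 * Real.exp (-(m * y ^ 2 / (2 * c ^ 2))) := by
  have hm0 : (0 : ℝ) < m := by exact_mod_cast hm
  set A : I → Ω → ℝ := fun q ω => deviation ρ₀ (fun i => X i ω) (h q) with hA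
  have hmeas : Measurable (Function.uncurry A) := by
    have h1 : Measurable fun p : I × Ω => ∫ θ, h p.1 θ ∂ρ₀ :=
      (hh.stronglyMeasurable.integral_prod_right (ν := ρ₀)).measurable.comp measurable_fst
    have h2 : ∀ i, Measurable fun p : I × Ω => h p.1 (X i p.2) := fun i =>
      hh.comp (measurable_fst.prodMk ((hX i).comp measurable_snd))
    exact ((Finset.measurable_sum _ fun i _ => h2 i).const_mul _).sub h1
  have hAq : ∀ q, Measurable (A q) := fun q => hmeas.comp measurable_prodMk_left
  have hAω : ∀ ω, Measurable fun q => A q ω := fun ω => hmeas.comp measurable_prodMk_right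
  have hAb : ∀ q ω, |A q ω| ≤ 2 * c := fun q ω => abs_deviation_le (hc q) hc0.le
  set t : ℝ := m * y / c ^ 2 with ht
  have ht0 : 0 ≤ t := by positivity
  have hexpb : ∀ s, |s| ≤ 2 * c → |Real.exp (t * s)| ≤ Real.exp (t * (2 * c)) := fun s hs => by
    rw [abs_of_pos (Real.exp_pos _)]
    gcongr
    exact (le_abs_self s).trans hs
  have hmoment : ∀ q, ∫ ω, Real.exp (t * |A q ω|) ∂μ ≤ 2 * Real.exp (c ^ 2 * t ^ 2 / (2 * m)) := by
    intro q
    have i1 : ∀ s : ℝ, Integrable (fun ω => Real.exp (s * A q ω)) μ := fun s =>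
      Integrable.of_bound ((hAq q).const_mul s).exp.aestronglyMeasurable (Real.exp (|s| * (2 * c)))
        (Filter.Eventually.of_forall fun ω => by
          rw [Real.norm_eq_abs, abs_of_pos (Real.exp_pos _)]
          refine Real.exp_le_exp.2 ((le_abs_self _).trans ?_)
          rw [abs_mul]
          gcongr
          exact hAb q ω)
    have m1 := mgf_deviation_le hX hlaw hind hm (hh.comp (measurable_prodMk_left (x := q)))
      (hc q) hc0.le t
    have m2 := mgf_deviation_le hX hlaw hind hm (hh.comp (measurable_prodMk_left (x := q)))
      (hc q) hc0.le (-t)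
    rw [neg_sq] at m2
    calc ∫ ω, Real.exp (t * |A q ω|) ∂μ
        ≤ ∫ ω, (Real.exp (t * A q ω) + Real.exp (-t * A q ω)) ∂μ := by
          refine integral_mono_of_nonneg (Filter.Eventually.of_forall fun ω => (Real.exp_pos _).le)
            ((i1 t).add (i1 (-t))) (Filter.Eventually.of_forall fun ω => ?_)
          dsimp only
          rcases abs_cases (A q ω) with ⟨e, -⟩ | ⟨e, -⟩ <;> rw [e]
          · linarith [Real.exp_pos (-t * A q ω)]
          · rw [mul_neg, ← neg_mul]; linarith [Real.exp_pos (t * A q ω)]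
      _ = _ := integral_add (i1 t) (i1 (-t))
      _ ≤ _ := by rw [two_mul]; exact add_le_add m1 m2
  set V : Ω → ℝ := fun ω => ∫ q, |A q ω| ∂Q with hV
  have hVm : Measurable V := by
    have : Measurable fun p : Ω × I => |A p.2 p.1| := (hmeas.comp measurable_swap).abs
    exact (this.stronglyMeasurable.integral_prod_right (ν := Q)).measurable
  have hVb : ∀ ω, |V ω| ≤ 2 * c := fun ω =>
    abs_integral_le_of_abs_le fun q => by rw [abs_abs]; exact hAb q ω
  have hVi : Integrable (fun ω => Real.exp (t * V ω)) μ :=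
    Integrable.of_bound (hVm.const_mul t).exp.aestronglyMeasurable (Real.exp (t * (2 * c)))
      (Filter.Eventually.of_forall fun ω => hexpb _ (hVb ω))
  have hjoint : Integrable (fun p : Ω × I => Real.exp (t * |A p.2 p.1|)) (μ.prod Q) :=
    Integrable.of_bound
      (((hmeas.comp measurable_swap).abs.const_mul t).exp).aestronglyMeasurable
      (Real.exp (t * (2 * c))) (Filter.Eventually.of_forall fun p =>
        hexpb _ (by rw [abs_abs]; exact hAb _ _))
  have hmgf : mgf V μ t ≤ 2 * Real.exp (c ^ 2 * t ^ 2 / (2 * m)) := by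
    have hconv : ConvexOn ℝ univ fun s : ℝ => Real.exp (t * s) :=
      (convexOn_exp.comp_linearMap (LinearMap.mulLeft ℝ t))
    calc mgf V μ t ≤ ∫ ω, ∫ q, Real.exp (t * |A q ω|) ∂Q ∂μ := by
          refine integral_mono_of_nonneg (Filter.Eventually.of_forall fun ω => (Real.exp_pos _).le)
            hjoint.integral_prod_left (Filter.Eventually.of_forall fun ω => ?_)
          refine hconv.map_integral_le (by fun_prop) isClosed_univ
            (Filter.Eventually.of_forall fun _ => mem_univ _) ?_ ?_
          · exact Integrable.of_bound (hAω ω).abs.aestronglyMeasurable (2 * c)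
              (Filter.Eventually.of_forall fun q => by
                rw [Real.norm_eq_abs, abs_abs]; exact hAb q ω)
          · exact Integrable.of_bound ((hAω ω).abs.const_mul t).exp.aestronglyMeasurable
              (Real.exp (t * (2 * c))) (Filter.Eventually.of_forall fun q =>
                hexpb _ (by rw [abs_abs]; exact hAb q ω))
      _ = ∫ q, ∫ ω, Real.exp (t * |A q ω|) ∂μ ∂Q := integral_integral_swap hjoint
      _ ≤ ∫ q, 2 * Real.exp (c ^ 2 * t ^ 2 / (2 * m)) ∂Q :=
          integral_mono_of_nonneg (Filter.Eventually.of_forall fun q =>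
            integral_nonneg fun ω => (Real.exp_pos _).le) (integrable_const _)
            (Filter.Eventually.of_forall hmoment)
      _ = _ := by simp
  refine (measure_ge_le_exp_mul_mgf y ht0 hVi).trans ?_
  calc Real.exp (-t * y) * mgf V μ t
      ≤ Real.exp (-t * y) * (2 * Real.exp (c ^ 2 * t ^ 2 / (2 * m))) := by gcongr
    _ = 2 * Real.exp (-t * y + c ^ 2 * t ^ 2 / (2 * m)) := by rw [Real.exp_add]; ring
    _ = _ := by
      congr 2
      rw [ht]
      field_simp
      ring

end Averages

/-! ### Maximal inequality for Markovian martingale increments -/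

section Martingale

variable {E : Type*} [NormedAddCommGroup E] [InnerProductSpace ℝ E] [FiniteDimensional ℝ E]
  [MeasurableSpace E] [BorelSpace E]
  {Ω A S Z : Type*} [MeasurableSpace Ω] [MeasurableSpace A] [MeasurableSpace S] [MeasurableSpace Z]

/-- Adding an independent centred increment of norm at most `c` to `x`: expand
`‖x + ξ‖ ^ 2 = ‖x‖ ^ 2 + 2 ⟪x, ξ⟫ + ‖ξ‖ ^ 2` and apply Hoeffding's lemma to `⟪x, ξ⟫`. -/
theorem lintegral_exp_norm_add_sq_le {ν : Measure Z} [IsProbabilityMeasure ν] {ξ : Z → E}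
    (hξ : Measurable ξ) {c : ℝ} (hc : 0 ≤ c) (hξc : ∀ᵐ z ∂ν, ‖ξ z‖ ≤ c) (hξ0 : ∫ z, ξ z ∂ν = 0)
    {a : ℝ} (ha : 0 ≤ a) (x : E) :
    ∫⁻ z, ENNReal.ofReal (Real.exp (a * ‖x + ξ z‖ ^ 2)) ∂ν ≤
      ENNReal.ofReal (Real.exp (a * c ^ 2)) *
        ENNReal.ofReal (Real.exp (a * (1 + 2 * a * c ^ 2) * ‖x‖ ^ 2)) := by
  have hint : Integrable ξ ν := Integrable.of_bound hξ.aestronglyMeasurable c hξc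
  have hX : HasSubgaussianMGF (fun z => inner ℝ x (ξ z)) ((‖x‖ * c).toNNReal ^ 2) ν := by
    have h1 := hasSubgaussianMGF_of_mem_Icc_of_integral_eq_zero (μ := ν)
      (X := fun z => inner ℝ x (ξ z)) (a := -(‖x‖ * c)) (b := ‖x‖ * c)
      (measurable_const.inner hξ).aemeasurable
      (by
        filter_upwards [hξc] with z hz
        refine abs_le.1 ((abs_real_inner_le_norm _ _).trans (by gcongr)))
      (by rw [integral_inner hint, hξ0, inner_zero_right])
    convert h1 using 1
    ext
    push_cast
    have : 0 ≤ ‖x‖ * c := by positivity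
    rw [Real.coe_toNNReal _ this, Real.norm_of_nonneg (by linarith)]
    ring
  have h2 := hX.mgf_le (2 * a)
  rw [mgf] at h2
  push_cast at h2
  rw [Real.coe_toNNReal _ (by positivity)] at h2
  have h3 : ∫⁻ z, ENNReal.ofReal (Real.exp (2 * a * inner ℝ x (ξ z))) ∂ν ≤
      ENNReal.ofReal (Real.exp ((‖x‖ * c) ^ 2 * (2 * a) ^ 2 / 2)) := by
    rw [← ofReal_integral_eq_lintegral_ofReal (hX.integrable_exp_mul _)
      (Filter.Eventually.of_forall fun _ => (Real.exp_pos _).le)]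
    exact ENNReal.ofReal_le_ofReal h2
  calc ∫⁻ z, ENNReal.ofReal (Real.exp (a * ‖x + ξ z‖ ^ 2)) ∂ν
      ≤ ∫⁻ z, ENNReal.ofReal (Real.exp (a * c ^ 2 + a * ‖x‖ ^ 2)) *
          ENNReal.ofReal (Real.exp (2 * a * inner ℝ x (ξ z))) ∂ν := by
        refine lintegral_mono_ae ?_
        filter_upwards [hξc] with z hz
        rw [← ENNReal.ofReal_mul (Real.exp_pos _).le, ← Real.exp_add]
        refine ENNReal.ofReal_le_ofReal (Real.exp_le_exp.2 ?_)
        rw [norm_add_sq_real]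
        have : ‖ξ z‖ ^ 2 ≤ c ^ 2 := by gcongr
        nlinarith
    _ = ENNReal.ofReal (Real.exp (a * c ^ 2 + a * ‖x‖ ^ 2)) *
          ∫⁻ z, ENNReal.ofReal (Real.exp (2 * a * inner ℝ x (ξ z))) ∂ν :=
        lintegral_const_mul' _ _ ENNReal.ofReal_ne_top
    _ ≤ ENNReal.ofReal (Real.exp (a * c ^ 2 + a * ‖x‖ ^ 2)) *
          ENNReal.ofReal (Real.exp ((‖x‖ * c) ^ 2 * (2 * a) ^ 2 / 2)) := by gcongr
    _ = _ := by
        rw [← ENNReal.ofReal_mul (Real.exp_pos _).le, ← ENNReal.ofReal_mul (Real.exp_pos _).le,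
          ← Real.exp_add, ← Real.exp_add]
        ring_nf

variable {μ : Measure Ω} [IsProbabilityMeasure μ] {ν : Measure Z}

theorem indepFun_prodMk_left {X : Ω → A} {Y : Ω → S} {W : Ω → Z} (hX : Measurable X)
    (hY : Measurable Y) (hW : Measurable W) (h : IndepFun X (fun ω => (Y ω, W ω)) μ)
    (h' : IndepFun Y W μ) : IndepFun (fun ω => (X ω, Y ω)) W μ := by
  have hXY : IndepFun X Y μ := h.comp measurable_id measurable_fst
  rw [indepFun_iff_map_prod_eq_prod_map_map (by fun_prop) (by fun_prop)] at h h' hXY ⊢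
  have := Measure.isProbabilityMeasure_map (μ := μ) hX.aemeasurable
  have := Measure.isProbabilityMeasure_map (μ := μ) hY.aemeasurable
  have := Measure.isProbabilityMeasure_map (μ := μ) hW.aemeasurable
  rw [hXY]
  have e : (fun ω => ((X ω, Y ω), W ω)) =
      MeasurableEquiv.prodAssoc.symm ∘ fun ω => (X ω, (Y ω, W ω)) := rfl
  rw [e, ← Measure.map_map (MeasurableEquiv.measurable _) (by fun_prop), h, h',
    ← Measure.prodAssoc_prod, Measure.map_map (MeasurableEquiv.measurable _)
      (MeasurableEquiv.measurable _), MeasurableEquiv.symm_comp_self, Measure.map_id]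

variable {θ₀ : Ω → A} {z : ℕ → Ω → Z}

/-- The states of a chain `W (k + 1) = F (W k, z k)` that is driven by independent variables are
independent of the next driving variable. -/
theorem indepFun_chain (hθ₀ : Measurable θ₀) (hz : ∀ k, Measurable (z k))
    (hind : iIndepFun z μ) (hindθ : IndepFun θ₀ (fun ω k => z k ω) μ)
    {w₀ : A → S} (hw₀ : Measurable w₀) {F : S × Z → S} (hF : Measurable F) {W : ℕ → Ω → S}
    (hW₀ : ∀ ω, W 0 ω = w₀ (θ₀ ω)) (hW : ∀ k ω, W (k + 1) ω = F (W k ω, z k ω)) (k : ℕ) :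
    Measurable (W k) ∧ IndepFun (W k) (z k) μ := by
  have hG : ∀ k, ∃ G : A × (Finset.range k → Z) → S, Measurable G ∧
      ∀ ω, W k ω = G (θ₀ ω, fun j => z j ω) := by
    intro k
    induction k with
    | zero => exact ⟨fun p => w₀ p.1, hw₀.comp measurable_fst, hW₀⟩
    | succ k ih =>
      obtain ⟨G, hG, hGW⟩ := ih
      refine ⟨fun p => F (G (p.1, fun j => p.2 ⟨j, Finset.mem_range.2
        ((Finset.mem_range.1 j.2).trans (Nat.lt_succ_self k))⟩),
          p.2 ⟨k, Finset.self_mem_range_succ k⟩), ?_, fun ω => ?_⟩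
      · refine hF.comp ((hG.comp (measurable_fst.prodMk (measurable_pi_lambda _ fun j => ?_))).prodMk
          ?_)
        · exact (measurable_pi_apply _).comp measurable_snd
        · exact (measurable_pi_apply _).comp measurable_snd
      · rw [hW, hGW]
  obtain ⟨G, hG, hGW⟩ := hG k
  have hzk : Measurable fun ω => fun j : Finset.range k => z j ω :=
    measurable_pi_lambda _ fun j => hz j
  have hpast : IndepFun (fun ω => (θ₀ ω, fun j : Finset.range k => z j ω)) (z k) μ := by
    refine indepFun_prodMk_left hθ₀ hzk (hz k) ?_ ?_
    · refine hindθ.comp (φ := id) (ψ := fun v : ℕ → Z => (fun j : Finset.range k => v j, v k))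
        measurable_id ?_
      exact (measurable_pi_lambda _ fun j => measurable_pi_apply _).prodMk (measurable_pi_apply _)
    · have h1 := hind.indepFun_finset (Finset.range k) {k} (by simp) hz
      exact h1.comp (φ := id) (ψ := fun v : ({k} : Finset ℕ) → Z =>
        v ⟨k, Finset.mem_singleton_self k⟩) measurable_id (measurable_pi_apply _)
  have e : W k = fun ω => G (θ₀ ω, fun j => z j ω) := funext hGW
  rw [e]
  exact ⟨hG.comp (hθ₀.prodMk hzk), hpast.comp hG measurable_id⟩

theorem lintegral_exp_norm_add_sq_indep_le {W : Ω → S} {ζ : Ω → Z} (hW : Measurable W)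
    (hζ : Measurable ζ) (hlaw : μ.map ζ = ν) (hind : IndepFun W ζ μ) {x : S → E}
    (hx : Measurable x) {ξ : S → Z → E} (hξ : Measurable (Function.uncurry ξ)) {c : ℝ}
    (hc : 0 ≤ c) (hξc : ∀ s, ∀ᵐ z ∂ν, ‖ξ s z‖ ≤ c) (hξ0 : ∀ s, ∫ z, ξ s z ∂ν = 0)
    {a : ℝ} (ha : 0 ≤ a) :
    ∫⁻ ω, ENNReal.ofReal (Real.exp (a * ‖x (W ω) + ξ (W ω) (ζ ω)‖ ^ 2)) ∂μ ≤
      ENNReal.ofReal (Real.exp (a * c ^ 2)) *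
        ∫⁻ ω, ENNReal.ofReal (Real.exp (a * (1 + 2 * a * c ^ 2) * ‖x (W ω)‖ ^ 2)) ∂μ := by
  have : IsProbabilityMeasure ν := hlaw ▸ Measure.isProbabilityMeasure_map (μ := μ) hζ.aemeasurable
  have := Measure.isProbabilityMeasure_map (μ := μ) hW.aemeasurable
  have hm : Measurable fun p : S × Z =>
      ENNReal.ofReal (Real.exp (a * ‖x p.1 + ξ p.1 p.2‖ ^ 2)) := by
    have : Measurable fun p : S × Z => ξ p.1 p.2 := hξ
    fun_prop
  have hmap := (indepFun_iff_map_prod_eq_prod_map_map hW.aemeasurable hζ.aemeasurable).1 hind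
  rw [hlaw] at hmap
  have e1 : ∫⁻ ω, ENNReal.ofReal (Real.exp (a * ‖x (W ω) + ξ (W ω) (ζ ω)‖ ^ 2)) ∂μ =
      ∫⁻ s, ∫⁻ z, ENNReal.ofReal (Real.exp (a * ‖x s + ξ s z‖ ^ 2)) ∂ν ∂(μ.map W) := by
    rw [← lintegral_prod _ hm.aemeasurable, ← hmap, lintegral_map hm (hW.prodMk hζ)]
  have e2 : ∫⁻ ω, ENNReal.ofReal (Real.exp (a * (1 + 2 * a * c ^ 2) * ‖x (W ω)‖ ^ 2)) ∂μ =
      ∫⁻ s, ENNReal.ofReal (Real.exp (a * (1 + 2 * a * c ^ 2) * ‖x s‖ ^ 2)) ∂(μ.map W) := by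
    rw [lintegral_map (by fun_prop) hW]
  rw [e1, e2, ← lintegral_const_mul' _ _ ENNReal.ofReal_ne_top]
  exact lintegral_mono fun s => lintegral_exp_norm_add_sq_le (hξ.comp measurable_prodMk_left) hc
    (hξc s) (hξ0 s) ha (x s)

/-- The exponential square moment of a sum of `k` martingale increments bounded by `c`. The
exponent grows from `a` to `a * (1 + 2 * a * c ^ 2)` when one increment is removed, so that its
inverse decreases by at most `2 * c ^ 2`. -/
theorem lintegral_exp_norm_chain_sq_le {W : ℕ → Ω → S} (hW : ∀ k, Measurable (W k))
    (hz : ∀ k, Measurable (z k)) (hlaw : ∀ k, μ.map (z k) = ν)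
    (hind : ∀ k, IndepFun (W k) (z k) μ) {x : S → E} (hx : Measurable x) {ξ : S → Z → E}
    (hξ : Measurable (Function.uncurry ξ)) {c : ℝ} (hc : 0 ≤ c)
    (hξc : ∀ s, ∀ᵐ z ∂ν, ‖ξ s z‖ ≤ c) (hξ0 : ∀ s, ∫ z, ξ s z ∂ν = 0)
    (hx₀ : ∀ ω, x (W 0 ω) = 0)
    (hxs : ∀ k ω, x (W (k + 1) ω) = x (W k ω) + ξ (W k ω) (z k ω)) {N : ℝ} (hN : 0 < N) (k : ℕ)
    {a : ℝ} (ha : 0 ≤ a) (haN : 2 * a * c ^ 2 * (N + k) ≤ 1) :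
    ∫⁻ ω, ENNReal.ofReal (Real.exp (a * ‖x (W k ω)‖ ^ 2)) ∂μ ≤
      ENNReal.ofReal (Real.exp (k / (2 * N))) := by
  induction k generalizing a with
  | zero => simp [hx₀]
  | succ k ih =>
    push_cast at haN ⊢
    have hu0 : 0 ≤ 2 * a * c ^ 2 := by positivity
    have h1 := lintegral_exp_norm_add_sq_indep_le (hW k) (hz k) (hlaw k) (hind k) hx hξ hc hξc hξ0
      ha
    simp only [hxs]
    have hNk : 0 ≤ N + k := by positivity
    have h2 := ih (a := a * (1 + 2 * a * c ^ 2)) (by positivity) (by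
      have e : 2 * (a * (1 + 2 * a * c ^ 2)) * c ^ 2 * (N + k) =
        (1 + 2 * a * c ^ 2) * (2 * a * c ^ 2 * (N + k)) := by ring
      have e' : 2 * a * c ^ 2 * (N + k) ≤ 1 - 2 * a * c ^ 2 := by linarith
      rw [e]
      nlinarith)
    have h3 : a * c ^ 2 ≤ 1 / (2 * N) := by
      rw [le_div_iff₀ (by positivity)]
      nlinarith [mul_nonneg hu0 (show (0 : ℝ) ≤ (k : ℝ) + 1 by positivity)]
    calc _ ≤ _ := h1
      _ ≤ ENNReal.ofReal (Real.exp (1 / (2 * N))) * ENNReal.ofReal (Real.exp (k / (2 * N))) := by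
        gcongr
      _ = _ := by
        rw [← ENNReal.ofReal_mul (Real.exp_pos _).le, ← Real.exp_add]
        congr 2
        ring

/-- **Maximal inequality** for sums `M` of martingale increments `ξ (W k) (z k)` bounded by `c`,
along a chain `W` driven by i.i.d. variables `z`: the sum is frozen once its norm has reached `r`,
and the exponential square moment of the frozen sum is bounded. -/
theorem measureReal_exists_norm_chain_ge_le (hθ₀ : Measurable θ₀) (hz : ∀ k, Measurable (z k))
    (hlaw : ∀ k, μ.map (z k) = ν) (hind : iIndepFun z μ)
    (hindθ : IndepFun θ₀ (fun ω k => z k ω) μ)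
    {w₀ : A → S} (hw₀ : Measurable w₀) {F : S × Z → S} (hF : Measurable F) {W : ℕ → Ω → S}
    (hW₀ : ∀ ω, W 0 ω = w₀ (θ₀ ω)) (hW : ∀ k ω, W (k + 1) ω = F (W k ω, z k ω))
    {ξ : S → Z → E} (hξ : Measurable (Function.uncurry ξ)) {c : ℝ} (hc : 0 < c)
    (hξc : ∀ s, ∀ᵐ z ∂ν, ‖ξ s z‖ ≤ c) (hξ0 : ∀ s, ∫ z, ξ s z ∂ν = 0)
    {M : ℕ → Ω → E} (hM₀ : ∀ ω, M 0 ω = 0)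
    (hM : ∀ k ω, M (k + 1) ω = M k ω + ξ (W k ω) (z k ω)) {N : ℕ} (hN : 0 < N) {r : ℝ}
    (hr : 0 < r) :
    μ.real {ω | ∃ k ≤ N, r ≤ ‖M k ω‖} ≤ 2 * Real.exp (-(r ^ 2 / (4 * N * c ^ 2))) := by
  classical
  have hN0 : (0 : ℝ) < N := by exact_mod_cast hN
  let ξ' : S × E → Z → E := fun p z => if ‖p.2‖ < r then ξ p.1 z else 0
  let F' : (S × E) × Z → S × E := fun q => (F (q.1.1, q.2), q.1.2 + ξ' q.1 q.2)
  have hξ'm : Measurable (Function.uncurry ξ') := by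
    refine Measurable.ite ?_ (hξ.comp ((measurable_fst.comp measurable_fst).prodMk measurable_snd))
      measurable_const
    exact measurableSet_lt (by fun_prop) measurable_const
  have hF'm : Measurable F' :=
    (hF.comp ((measurable_fst.comp measurable_fst).prodMk measurable_snd)).prodMk (Measurable.add (by fun_prop) hξ'm)
  let W' : ℕ → Ω → S × E := fun k ω =>
    Nat.rec (motive := fun _ => S × E) (w₀ (θ₀ ω), 0) (fun k p => F' (p, z k ω)) k
  have hW'0 : ∀ ω, W' 0 ω = (w₀ (θ₀ ω), 0) := fun ω => rfl
  have hW's : ∀ k ω, W' (k + 1) ω = F' (W' k ω, z k ω) := fun k ω => rfl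
  have hchain := indepFun_chain (μ := μ) hθ₀ hz hind hindθ (w₀ := fun a => (w₀ a, (0 : E)))
    (hw₀.prodMk measurable_const) hF'm hW'0 hW's
  have hW'W : ∀ k ω, (W' k ω).1 = W k ω := by
    intro k ω
    induction k with
    | zero => rw [hW'0, hW₀]
    | succ k ih => rw [hW's, hW, ← ih]
  have hxs : ∀ k ω, (W' (k + 1) ω).2 = (W' k ω).2 + ξ' (W' k ω) (z k ω) := fun k ω => rfl
  -- The frozen sum agrees with `M` until one of them reaches norm `r`, and stays beyond then.
  have hfreeze : ∀ k ω, (∀ j < k, ‖M j ω‖ < r) → (W' k ω).2 = M k ω := by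
    intro k ω hk
    induction k with
    | zero => rw [hW'0, hM₀]
    | succ k ih =>
      have h1 := ih fun j hj => hk j (hj.trans (Nat.lt_succ_self k))
      rw [hxs, h1, hM]
      simp only [ξ', h1, hk k (Nat.lt_succ_self k), if_true, hW'W]
  have hstay : ∀ k ω, r ≤ ‖(W' k ω).2‖ → ∀ j, r ≤ ‖(W' (k + j) ω).2‖ := by
    intro k ω hk j
    induction j with
    | zero => exact hk
    | succ j ih =>
      rw [← add_assoc, hxs]
      simpa only [ξ', not_lt.2 ih, if_false, add_zero] using ih
  have hsub : {ω | ∃ k ≤ N, r ≤ ‖M k ω‖} ⊆ {ω | r ≤ ‖(W' N ω).2‖} := by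
    rintro ω ⟨k, hkN, hk⟩
    have hex : ∃ k, r ≤ ‖M k ω‖ := ⟨k, hk⟩
    have h1 : (W' (Nat.find hex) ω).2 = M (Nat.find hex) ω :=
      hfreeze _ ω fun j hj => not_le.1 (Nat.find_min hex hj)
    have h2 := hstay (Nat.find hex) ω (by rw [h1]; exact Nat.find_spec hex)
      (N - Nat.find hex)
    rwa [Nat.add_sub_cancel' ((Nat.find_min' hex hk).trans hkN)] at h2
  have hmom := lintegral_exp_norm_chain_sq_le (fun k => (hchain k).1) hz hlaw
    (fun k => (hchain k).2) (x := Prod.snd) measurable_snd hξ'm hc.le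
    (fun p => by
      by_cases hp : ‖p.2‖ < r
      · simpa only [ξ', hp, if_true] using hξc p.1
      · simp [ξ', hp, hc.le])
    (fun p => by
      by_cases hp : ‖p.2‖ < r
      · simpa only [ξ', hp, if_true] using hξ0 p.1
      · simp [ξ', hp])
    (fun ω => rfl) hxs hN0 N (a := 1 / (4 * N * c ^ 2)) (by positivity) (by
      apply le_of_eq; field_simp; norm_num)
  set a : ℝ := 1 / (4 * N * c ^ 2)
  have hmark := meas_ge_le_lintegral_div (μ := μ)
    (f := fun ω => ENNReal.ofReal (Real.exp (a * ‖(W' N ω).2‖ ^ 2)))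
    (by have := (hchain N).1; fun_prop) (ε := ENNReal.ofReal (Real.exp (a * r ^ 2)))
    (by simp [Real.exp_pos]) ENNReal.ofReal_ne_top
  have hle : μ {ω | ∃ k ≤ N, r ≤ ‖M k ω‖} ≤ ENNReal.ofReal (2 * Real.exp (-(a * r ^ 2))) := by
    calc _ ≤ μ {ω | ENNReal.ofReal (Real.exp (a * r ^ 2)) ≤
          ENNReal.ofReal (Real.exp (a * ‖(W' N ω).2‖ ^ 2))} := by
          refine measure_mono (hsub.trans fun ω hω => ENNReal.ofReal_le_ofReal ?_)
          have : r ≤ ‖(W' N ω).2‖ := hω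
          gcongr
      _ ≤ _ := hmark
      _ ≤ ENNReal.ofReal (Real.exp (N / (2 * N))) / ENNReal.ofReal (Real.exp (a * r ^ 2)) := by
          gcongr
      _ = ENNReal.ofReal (Real.exp (1 / 2) * Real.exp (-(a * r ^ 2))) := by
          rw [← ENNReal.ofReal_div_of_pos (Real.exp_pos _), Real.exp_neg, div_eq_mul_inv]
          congr 3
          field_simp
      _ ≤ _ := by
          gcongr
          have : Real.exp (1 / 2) ^ 2 ≤ 2 ^ 2 := by
            rw [← Real.exp_nat_mul]
            norm_num
            linarith [Real.exp_one_lt_d9]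
          exact le_of_sq_le_sq this (by norm_num)
  have := ENNReal.toReal_mono ENNReal.ofReal_ne_top hle
  rw [ENNReal.toReal_ofReal (by positivity)] at this
  refine this.trans (le_of_eq ?_)
  simp only [a]
  congr 3
  ring

end Martingale

/-! ### Interaction fields -/

section Field

variable {E : Type*} [NormedAddCommGroup E] [InnerProductSpace ℝ E] [FiniteDimensional ℝ E]
  [MeasurableSpace E] [BorelSpace E] {Z : Type*} [MeasurableSpace Z]

/-- The abstract form of the TD update: on the sample `z`, a particle `θ` moves in the direction
`-(U z - r z) • v z θ`, where `U z` is the mean of `u z` over the particles. All functions are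
bounded by `C`, and `u`, `v` are `C`-Lipschitz in `θ`. -/
structure InteractionBounds (ν : Measure Z) (u : Z → E → ℝ) (v : Z → E → E) (r : Z → ℝ)
    (C : ℝ≥0) : Prop where
  measurable_u : Measurable (Function.uncurry u)
  measurable_v : Measurable (Function.uncurry v)
  measurable_r : Measurable r
  abs_u_le : ∀ z θ, |u z θ| ≤ C
  lipschitz_u : ∀ z, LipschitzWith C (u z)
  norm_v_le : ∀ z θ, ‖v z θ‖ ≤ C
  lipschitz_v : ∀ z, LipschitzWith C (v z)
  abs_r_le : ∀ᵐ z ∂ν, |r z| ≤ C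

/-- The mean direction of motion of a particle at `θ` when the interaction term is `U`. -/
noncomputable def meanField (ν : Measure Z) (v : Z → E → E) (r : Z → ℝ) (U : Z → ℝ) (θ : E) : E :=
  ∫ z, -(U z - r z) • v z θ ∂ν

/-- The mean-field velocity at `θ` when the particles have law `ρ`. -/
noncomputable def velocity (ν : Measure Z) (u : Z → E → ℝ) (v : Z → E → E) (r : Z → ℝ)
    (ρ : Measure E) : E → E :=
  meanField ν v r fun z => ∫ θ, u z θ ∂ρ

namespace InteractionBounds

variable {ν : Measure Z} [IsProbabilityMeasure ν] {u : Z → E → ℝ} {v : Z → E → E} {r : Z → ℝ}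
  {C : ℝ≥0}

theorem ae_norm_le (h : InteractionBounds ν u v r C) {U : Z → ℝ} (hUC : ∀ z, |U z| ≤ C) :
    ∀ᵐ z ∂ν, ∀ θ, ‖-(U z - r z) • v z θ‖ ≤ 2 * C ^ 2 := by
  filter_upwards [h.abs_r_le] with z hz θ
  rw [norm_smul, norm_neg, Real.norm_eq_abs]
  calc |U z - r z| * ‖v z θ‖ ≤ (C + C) * C :=
        mul_le_mul ((abs_sub _ _).trans (add_le_add (hUC z) hz)) (h.norm_v_le z θ)
          (norm_nonneg _) (by positivity)
    _ = 2 * (C : ℝ) ^ 2 := by ring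

theorem measurable_v_apply (h : InteractionBounds ν u v r C) (θ : E) : Measurable fun z => v z θ :=
  h.measurable_v.comp (measurable_id.prodMk measurable_const)

theorem integrable (h : InteractionBounds ν u v r C) {U : Z → ℝ} (hU : Measurable U)
    (hUC : ∀ z, |U z| ≤ C) (θ : E) : Integrable (fun z => -(U z - r z) • v z θ) ν := by
  refine Integrable.of_bound ?_ (2 * (C : ℝ) ^ 2) ((h.ae_norm_le hUC).mono fun z hz => hz θ)
  exact ((hU.sub h.measurable_r).neg.smul (h.measurable_v_apply θ)).aestronglyMeasurable

theorem norm_meanField_le (h : InteractionBounds ν u v r C) {U : Z → ℝ} (hUC : ∀ z, |U z| ≤ C)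
    (θ : E) : ‖meanField ν v r U θ‖ ≤ 2 * C ^ 2 := by
  have := norm_integral_le_of_norm_le_const ((h.ae_norm_le hUC).mono fun z hz => hz θ)
  rwa [probReal_univ, mul_one] at this

theorem lipschitzWith_meanField (h : InteractionBounds ν u v r C) {U : Z → ℝ} (hU : Measurable U)
    (hUC : ∀ z, |U z| ≤ C) : LipschitzWith (2 * C ^ 2) (meanField ν v r U) := by
  refine LipschitzWith.of_dist_le_mul fun θ θ' => ?_
  rw [dist_eq_norm, dist_eq_norm, meanField, meanField,
    ← integral_sub (h.integrable hU hUC θ) (h.integrable hU hUC θ')]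
  have := norm_integral_le_of_norm_le_const (μ := ν) (C := 2 * C ^ 2 * ‖θ - θ'‖)
    (f := fun z => -(U z - r z) • v z θ - -(U z - r z) • v z θ') (by
      filter_upwards [h.abs_r_le] with z hz
      rw [← smul_sub, norm_smul, norm_neg, Real.norm_eq_abs]
      calc |U z - r z| * ‖v z θ - v z θ'‖ ≤ (C + C) * (C * ‖θ - θ'‖) :=
            mul_le_mul ((abs_sub _ _).trans (add_le_add (hUC z) hz))
              ((h.lipschitz_v z).norm_sub_le θ θ') (norm_nonneg _) (by positivity)
        _ = 2 * (C : ℝ) ^ 2 * ‖θ - θ'‖ := by ring)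
  rw [probReal_univ, mul_one] at this
  exact_mod_cast this

theorem norm_meanField_sub_le (h : InteractionBounds ν u v r C) {U U' : Z → ℝ}
    (hU : Measurable U) (hUC : ∀ z, |U z| ≤ C) (hU' : Measurable U') (hUC' : ∀ z, |U' z| ≤ C)
    (θ : E) :
    ‖meanField ν v r U θ - meanField ν v r U' θ‖ ≤ C * ∫ z, |U z - U' z| ∂ν := by
  rw [meanField, meanField, ← integral_sub (h.integrable hU hUC θ) (h.integrable hU' hUC' θ),
    ← integral_const_mul]
  have hi : Integrable (fun z => |U z - U' z|) ν :=
    Integrable.of_bound (hU.sub hU').abs.aestronglyMeasurable (C + C)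
      (Filter.Eventually.of_forall fun z => by
        rw [Real.norm_eq_abs, abs_abs]
        exact (abs_sub _ _).trans (add_le_add (hUC z) (hUC' z)))
  refine norm_integral_le_of_norm_le (hi.const_mul C) (Filter.Eventually.of_forall fun z => ?_)
  rw [← sub_smul, norm_smul, Real.norm_eq_abs, mul_comm]
  have e : |-(U z - r z) - -(U' z - r z)| = |U z - U' z| := by
    rw [abs_sub_comm]; congr 1; ring
  rw [e]
  gcongr
  exact h.norm_v_le z θ

theorem measurable_integral_u (h : InteractionBounds ν u v r C) (ρ : Measure E) [SFinite ρ] :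
    Measurable fun z => ∫ θ, u z θ ∂ρ :=
  (h.measurable_u.stronglyMeasurable.integral_prod_right (ν := ρ)).measurable

/-- A solution of the mean-field equation solves the linear continuity equation along its own
velocity field. -/
theorem isContinuitySolution (h : InteractionBounds ν u v r C) {T : ℝ}
    {ρ : ℝ → ProbabilityMeasure E} (hρ : ContinuousOn ρ (Icc 0 T))
    (hw : ∀ φ : E → ℝ, ContDiff ℝ ((⊤ : ℕ∞) : WithTop ℕ∞) φ → HasCompactSupport φ →
      WeakIdentity T (fun s => velocity ν u v r (ρ s : Measure E)) ρ φ) :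
    IsContinuitySolution T (2 * C ^ 2) (fun s => velocity ν u v r (ρ s : Measure E)) ρ where
  continuousOn := hρ
  norm_le s θ := by
    have := h.norm_meanField_le (fun z => abs_integral_le_of_abs_le (μ := (ρ s : Measure E))
      (h.abs_u_le z)) θ
    exact_mod_cast this
  lipschitz s := h.lipschitzWith_meanField (h.measurable_integral_u _) fun z =>
    abs_integral_le_of_abs_le (h.abs_u_le z)
  weak := hw
  tendstoUniformly s hs := by
    have hz : ∀ z, Filter.Tendsto (fun τ => |∫ θ, u z θ ∂(ρ τ : Measure E) -
        ∫ θ, u z θ ∂(ρ s : Measure E)|) (𝓝[Icc 0 T] s) (𝓝 0) := fun z => by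
      have h1 := ProbabilityMeasure.tendsto_iff_forall_integral_tendsto.1 (hρ s hs)
        (BoundedContinuousFunction.ofNormedAddCommGroup _ (h.lipschitz_u z).continuous _
          (h.abs_u_le z))
      have h2 := (h1.sub_const (∫ θ, u z θ ∂(ρ s : Measure E))).abs
      simpa using h2
    have hlim : Filter.Tendsto (fun τ => ∫ z, |∫ θ, u z θ ∂(ρ τ : Measure E) -
        ∫ θ, u z θ ∂(ρ s : Measure E)| ∂ν) (𝓝[Icc 0 T] s) (𝓝 0) := by
      have := tendsto_integral_filter_of_dominated_convergence (μ := ν) (l := 𝓝[Icc 0 T] s)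
        (F := fun τ z => |∫ θ, u z θ ∂(ρ τ : Measure E) - ∫ θ, u z θ ∂(ρ s : Measure E)|)
        (f := fun _ => (0 : ℝ)) (fun _ => (C : ℝ) + C)
        (Filter.Eventually.of_forall fun τ => ((h.measurable_integral_u _).sub
          (h.measurable_integral_u _)).abs.aestronglyMeasurable)
        (Filter.Eventually.of_forall fun τ => Filter.Eventually.of_forall fun z => by
          rw [Real.norm_eq_abs, abs_abs]
          exact (abs_sub _ _).trans (add_le_add (abs_integral_le_of_abs_le (h.abs_u_le z))
            (abs_integral_le_of_abs_le (h.abs_u_le z))))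
        (integrable_const _) (Filter.Eventually.of_forall hz)
      simpa using this
    rw [Metric.tendstoUniformly_iff]
    intro e he
    have hlim' := hlim.const_mul (C : ℝ)
    rw [mul_zero] at hlim'
    filter_upwards [hlim'.eventually (gt_mem_nhds he)] with τ hτ θ
    rw [dist_comm, dist_eq_norm]
    exact (h.norm_meanField_sub_le (h.measurable_integral_u _)
      (fun z => abs_integral_le_of_abs_le (h.abs_u_le z)) (h.measurable_integral_u _)
      (fun z => abs_integral_le_of_abs_le (h.abs_u_le z)) θ).trans_lt hτ

/-- The velocity field of a solution is Lipschitz in time, because the solution moves at bounded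
speed. -/
theorem norm_velocity_sub_le (h : InteractionBounds ν u v r C) {T : ℝ}
    {ρ : ℝ → ProbabilityMeasure E}
    (hρ : IsContinuitySolution T (2 * C ^ 2) (fun s => velocity ν u v r (ρ s : Measure E)) ρ)
    {s t : ℝ} (hs : s ∈ Icc 0 T) (ht : t ∈ Icc 0 T) (θ : E) :
    ‖velocity ν u v r (ρ t : Measure E) θ - velocity ν u v r (ρ s : Measure E) θ‖ ≤
      ((2 * C ^ 2 : ℝ≥0) : ℝ) ^ 2 * |t - s| := by
  refine (h.norm_meanField_sub_le (h.measurable_integral_u _)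
      (fun z => abs_integral_le_of_abs_le (h.abs_u_le z)) (h.measurable_integral_u _)
      (fun z => abs_integral_le_of_abs_le (h.abs_u_le z)) θ).trans ?_
  have h1 : ∫ z, |∫ θ, u z θ ∂(ρ t : Measure E) - ∫ θ, u z θ ∂(ρ s : Measure E)| ∂ν ≤
      C * (2 * C ^ 2) * |t - s| := by
    refine (integral_mono_of_nonneg (Filter.Eventually.of_forall fun _ => abs_nonneg _)
      (integrable_const (C * (2 * C ^ 2) * |t - s|)) (Filter.Eventually.of_forall fun z => ?_)).trans
      (by simp)
    have := hρ.abs_integral_sub_le (h.abs_u_le z) (h.lipschitz_u z) hs ht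
    exact_mod_cast this
  push_cast
  calc (C : ℝ) * _ ≤ C * (C * (2 * C ^ 2) * |t - s|) := by gcongr
    _ = (2 * C ^ 4) * |t - s| := by ring
    _ ≤ (4 * C ^ 4) * |t - s| := by gcongr; norm_num
    _ = _ := by ring

end InteractionBounds

end Field

/-! ### The particle system and its coupling with the Euler scheme -/

section Particles

variable {E : Type*} [NormedAddCommGroup E] [InnerProductSpace ℝ E] [FiniteDimensional ℝ E]
  [MeasurableSpace E] [BorelSpace E] {Z : Type*} [MeasurableSpace Z]
  {ν : Measure Z} [IsProbabilityMeasure ν] {u : Z → E → ℝ} {v : Z → E → E} {r : Z → ℝ}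
  {C : ℝ≥0} {m : ℕ}

/-- The empirical interaction term. -/
noncomputable def averageU (u : Z → E → ℝ) (Θ : Fin m → E) (z : Z) : ℝ :=
  (m : ℝ)⁻¹ * ∑ i, u z (Θ i)

/-- The direction in which the particle `i` of the configuration `Θ` moves on the sample `z`. -/
noncomputable def increment (u : Z → E → ℝ) (v : Z → E → E) (r : Z → ℝ) (i : Fin m)
    (Θ : Fin m → E) (z : Z) : E :=
  -(averageU u Θ z - r z) • v z (Θ i)

/-- The centred increment of the particle `i`. -/
noncomputable def noise (ν : Measure Z) (u : Z → E → ℝ) (v : Z → E → E) (r : Z → ℝ) (i : Fin m)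
    (Θ : Fin m → E) (z : Z) : E :=
  increment u v r i Θ z - meanField ν v r (averageU u Θ) (Θ i)

namespace InteractionBounds

theorem abs_averageU_le (h : InteractionBounds ν u v r C) (Θ : Fin m → E) (z : Z) :
    |averageU u Θ z| ≤ C :=
  abs_average_le C.coe_nonneg fun i => h.abs_u_le z (Θ i)

theorem measurable_uncurry_averageU (h : InteractionBounds ν u v r C) :
    Measurable fun p : (Fin m → E) × Z => averageU u p.1 p.2 :=
  (Finset.measurable_sum _ fun i _ => h.measurable_u.comp
    (measurable_snd.prodMk ((measurable_pi_apply i).comp measurable_fst))).const_mul _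

theorem measurable_averageU (h : InteractionBounds ν u v r C) (Θ : Fin m → E) :
    Measurable (averageU u Θ) :=
  h.measurable_uncurry_averageU.comp measurable_prodMk_left

theorem measurable_increment (h : InteractionBounds ν u v r C) (i : Fin m) :
    Measurable (Function.uncurry (increment u v r i)) :=
  ((h.measurable_uncurry_averageU.sub (h.measurable_r.comp measurable_snd)).neg).smul
    (h.measurable_v.comp (measurable_snd.prodMk ((measurable_pi_apply i).comp measurable_fst)))

theorem measurable_noise (h : InteractionBounds ν u v r C) (i : Fin m) :
    Measurable (Function.uncurry (noise ν u v r i)) :=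
  (h.measurable_increment i).sub
    (((h.measurable_increment i).stronglyMeasurable.integral_prod_right (ν := ν)).measurable.comp
      measurable_fst)

theorem ae_norm_noise_le (h : InteractionBounds ν u v r C) (i : Fin m) (Θ : Fin m → E) :
    ∀ᵐ z ∂ν, ‖noise ν u v r i Θ z‖ ≤ 2 * (2 * C ^ 2) := by
  filter_upwards [h.ae_norm_le (h.abs_averageU_le Θ)] with z hz
  have h1 := h.norm_meanField_le (h.abs_averageU_le Θ) (Θ i)
  have h2 : ‖increment u v r i Θ z‖ ≤ 2 * C ^ 2 := hz (Θ i)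
  exact (norm_sub_le _ _).trans (by linarith)

theorem integral_noise (h : InteractionBounds ν u v r C) (i : Fin m) (Θ : Fin m → E) :
    ∫ z, noise ν u v r i Θ z ∂ν = 0 := by
  unfold noise
  rw [integral_sub (f := increment u v r i Θ) (h.integrable (h.measurable_averageU Θ) (h.abs_averageU_le Θ) (Θ i))
    (integrable_const _)]
  simp only [integral_const, probReal_univ, one_smul]
  exact sub_self _

theorem integrable_abs_deviation (h : InteractionBounds ν u v r C) (ρ₀ : Measure E)
    [IsProbabilityMeasure ρ₀] (x : Fin m → E) {Ψ : E → E} (hΨ : Continuous Ψ) :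
    Integrable (fun z => |deviation ρ₀ x fun θ => u z (Ψ θ)|) ν := by
  have h1 : Measurable fun z => ∫ θ, u z (Ψ θ) ∂ρ₀ :=
    (StronglyMeasurable.integral_prod_right (ν := ρ₀) (f := fun z θ => u z (Ψ θ))
      (h.measurable_u.comp (measurable_fst.prodMk
        (hΨ.measurable.comp measurable_snd))).stronglyMeasurable).measurable
  have h2 : Measurable fun z => deviation ρ₀ x fun θ => u z (Ψ θ) :=
    (h.measurable_averageU fun i => Ψ (x i)).sub h1
  refine Integrable.of_bound h2.abs.aestronglyMeasurable (2 * C)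
    (Filter.Eventually.of_forall fun z => ?_)
  rw [Real.norm_eq_abs, abs_abs]
  exact abs_deviation_le (fun θ => h.abs_u_le z _) C.coe_nonneg

/-- **Coupling.** The particles stay close to the Euler flow of their initial positions, up to the
noise (`a`), the deviations of the empirical interaction term along the Euler flow (`y`), the error
`e` of the Euler scheme for the interaction term, and the mollification of the field (`κ`). -/
theorem norm_sub_eulerFlow_le (h : InteractionBounds ν u v r C) {ρ : ℝ → ProbabilityMeasure E}
    {ε κ a y e : ℝ} (hε : 0 ≤ ε) (hκ : 0 < κ) {n : ℕ} {Θ : ℕ → Fin m → E}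
    {z : ℕ → Z} (hΘ : ∀ k i, Θ (k + 1) i = Θ k i + ε • increment u v r i (Θ k) (z k))
    {Φ : ℕ → E → E} (hΦ : Φ = eulerFlow ε
      (mollifiedField κ ε fun s => velocity ν u v r (ρ s : Measure E)))
    (ha : ∀ i, ∀ k ≤ n, ‖∑ j ∈ Finset.range k, noise ν u v r i (Θ j) (z j)‖ ≤ a)
    (hy : ∑ j ∈ Finset.range n,
      ∫ z, |deviation (ρ 0 : Measure E) (Θ 0) fun θ => u z (Φ j θ)| ∂ν ≤ y)
    (he : ∀ j ≤ n, ∀ z, |∫ θ, u z θ ∂(ρ (j * ε) : Measure E) -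
      ∫ θ, u z (Φ j θ) ∂(ρ 0 : Measure E)| ≤ e) (hy0 : 0 ≤ y) (he0 : 0 ≤ e) (ha0 : 0 ≤ a) (i : Fin m)
    {k : ℕ} (hk : k ≤ n) :
    ‖Θ k i - Φ k (Θ 0 i)‖ ≤ (ε * a + ε * (C * y) + n * ε * (C * e + 2 * C ^ 2 * κ)) *
      (1 + 4 * C ^ 2 * ε) ^ k := by
  set b : ℝ → E → E := fun s => velocity ν u v r (ρ s : Measure E) with hb
  set c := mollifiedField κ ε b with hc
  have hbl : ∀ s, LipschitzWith (2 * C ^ 2) (b s) := fun s =>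
    h.lipschitzWith_meanField (h.measurable_integral_u _) fun z =>
      abs_integral_le_of_abs_le (h.abs_u_le z)
  have hcc : ∀ k, Continuous (c k) := fun k => (lipschitzWith_ballAvg hκ (hbl _)).continuous
  have hΦc : ∀ k, Continuous (Φ k) := fun k => hΦ ▸ continuous_eulerFlow ε hcc k
  have hΦ0 : ∀ θ, Φ 0 θ = θ := fun θ => by rw [hΦ]; rfl
  have hΦs : ∀ k θ, Φ (k + 1) θ = Φ k θ + ε • c k (Φ k θ) := fun k θ => by rw [hΦ]; rfl
  set W : ℕ → ℝ := fun j => ∫ z, |deviation (ρ 0 : Measure E) (Θ 0) fun θ => u z (Φ j θ)| ∂ν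
  have hW0 : ∀ j, 0 ≤ W j := fun j => integral_nonneg fun z => abs_nonneg _
  set A := ε * a + ε * (C * y) + n * ε * (C * e + 2 * C ^ 2 * κ) with hA
  have hA0 : 0 ≤ A := by positivity
  set β := 4 * (C : ℝ) ^ 2 * ε with hβ
  have hβ0 : 0 ≤ β := by positivity
  induction k using Nat.strong_induction_on generalizing i with
  | _ k ih =>
  set g : ℕ → E := fun j => meanField ν v r (averageU u (Θ j)) (Θ j i) - c j (Φ j (Θ 0 i)) with hg
  have hrep : ∀ k, Θ k i - Φ k (Θ 0 i) =
      ε • (∑ j ∈ Finset.range k, noise ν u v r i (Θ j) (z j) + ∑ j ∈ Finset.range k, g j) := by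
    intro k
    induction k with
    | zero => simp [hΦ0]
    | succ k ih =>
      have e1 : Θ (k + 1) i - Φ (k + 1) (Θ 0 i) = (Θ k i - Φ k (Θ 0 i)) +
          ε • (noise ν u v r i (Θ k) (z k) + g k) := by
        rw [hΘ, hΦs, hg, noise]
        simp only [smul_add, smul_sub]
        abel
      rw [e1, ih, Finset.sum_range_succ, Finset.sum_range_succ, ← smul_add]
      congr 1
      abel
  have hgj : ∀ j < k, ‖g j‖ ≤ 4 * C ^ 2 * (A * (1 + β) ^ j) + (C * W j + (C * e + 2 * C ^ 2 * κ)) := by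
    intro j hj
    have hjn : j ≤ n := hj.le.trans hk
    have hX : ∀ i, ‖Θ j i - Φ j (Θ 0 i)‖ ≤ A * (1 + β) ^ j := fun i => ih j hj i hjn
    have hX0 : 0 ≤ A * (1 + β) ^ j := by positivity
    have t1 : ‖meanField ν v r (averageU u (Θ j)) (Θ j i) -
        meanField ν v r (averageU u (Θ j)) (Φ j (Θ 0 i))‖ ≤ 2 * C ^ 2 * (A * (1 + β) ^ j) := by
      have := (h.lipschitzWith_meanField (h.measurable_averageU (Θ j))
        (h.abs_averageU_le (Θ j))).norm_sub_le (Θ j i) (Φ j (Θ 0 i))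
      push_cast at this
      exact this.trans (by gcongr; exact hX i)
    have t2 : ‖meanField ν v r (averageU u (Θ j)) (Φ j (Θ 0 i)) - b (j * ε) (Φ j (Θ 0 i))‖ ≤
        C * (C * (A * (1 + β) ^ j) + W j + e) := by
      refine (h.norm_meanField_sub_le (h.measurable_averageU (Θ j)) (h.abs_averageU_le (Θ j))
        (h.measurable_integral_u _) (fun z => abs_integral_le_of_abs_le (h.abs_u_le z)) _).trans ?_
      have hdi := h.integrable_abs_deviation (ρ 0 : Measure E) (Θ 0) (hΦc j)
      gcongr
      calc _ ≤ ∫ z, (C * (A * (1 + β) ^ j) +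
            |deviation (ρ 0 : Measure E) (Θ 0) fun θ => u z (Φ j θ)| + e) ∂ν := by
            refine integral_mono_of_nonneg (Filter.Eventually.of_forall fun z => abs_nonneg _)
              (((integrable_const _).add hdi).add (integrable_const _))
              (Filter.Eventually.of_forall fun z => ?_)
            have d1 : |averageU u (Θ j) z - (m : ℝ)⁻¹ * ∑ i, u z (Φ j (Θ 0 i))| ≤
                C * (A * (1 + β) ^ j) := by
              rw [averageU, ← mul_sub, ← Finset.sum_sub_distrib]
              refine abs_average_le (by positivity) fun l => ?_
              exact ((h.lipschitz_u z).norm_sub_le _ _).trans (by gcongr; exact hX l)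
            have d2 := he j hjn z
            have d3 : averageU u (Θ j) z - ∫ θ, u z θ ∂(ρ (j * ε) : Measure E) =
                (averageU u (Θ j) z - (m : ℝ)⁻¹ * ∑ i, u z (Φ j (Θ 0 i))) +
                (deviation (ρ 0 : Measure E) (Θ 0) fun θ => u z (Φ j θ)) +
                (∫ θ, u z (Φ j θ) ∂(ρ 0 : Measure E) -
                  ∫ θ, u z θ ∂(ρ (j * ε) : Measure E)) := by
              rw [deviation]; ring
            dsimp only
            rw [d3]
            rw [abs_sub_comm] at d2
            exact (abs_add_three _ _ _).trans (by gcongr)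
        _ = _ := by
            rw [integral_add (f := fun z => C * (A * (1 + β) ^ j) +
                |deviation (ρ 0 : Measure E) (Θ 0) fun θ => u z (Φ j θ)|)
                ((integrable_const _).add hdi) (integrable_const _),
              integral_add (integrable_const _) hdi]
            simp [W]
    have t3 : ‖b (j * ε) (Φ j (Θ 0 i)) - c j (Φ j (Θ 0 i))‖ ≤ 2 * C ^ 2 * κ := by
      rw [norm_sub_rev]
      have := norm_ballAvg_sub_self_le hκ (hbl (j * ε)) (Φ j (Θ 0 i))
      exact_mod_cast this
    have hsplit : g j = (meanField ν v r (averageU u (Θ j)) (Θ j i) -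
        meanField ν v r (averageU u (Θ j)) (Φ j (Θ 0 i))) +
        (meanField ν v r (averageU u (Θ j)) (Φ j (Θ 0 i)) - b (j * ε) (Φ j (Θ 0 i))) +
        (b (j * ε) (Φ j (Θ 0 i)) - c j (Φ j (Θ 0 i))) := by
      simp only [hg]; abel
    rw [hsplit]
    refine norm_add₃_le.trans ((add_le_add (add_le_add t1 t2) t3).trans ?_)
    have : 0 ≤ (C : ℝ) ^ 2 * (A * (1 + β) ^ j) := by positivity
    nlinarith
  have hsumW : ∑ j ∈ Finset.range k, W j ≤ y :=
    (Finset.sum_le_sum_of_subset_of_nonneg (Finset.range_mono hk) fun j _ _ => hW0 j).trans hy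
  have hgeom : (∑ j ∈ Finset.range k, (1 + β) ^ j) * β = (1 + β) ^ k - 1 := by
    have := geom_sum_mul (1 + β) k
    rwa [add_sub_cancel_left] at this
  have hsum : ∑ j ∈ Finset.range k, ‖g j‖ ≤
      4 * C ^ 2 * (A * ∑ j ∈ Finset.range k, (1 + β) ^ j) + C * y +
        n * (C * e + 2 * C ^ 2 * κ) := by
    calc _ ≤ ∑ j ∈ Finset.range k,
          (4 * C ^ 2 * (A * (1 + β) ^ j) + (C * W j + (C * e + 2 * C ^ 2 * κ))) :=
          Finset.sum_le_sum fun j hj => hgj j (Finset.mem_range.1 hj)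
      _ = 4 * C ^ 2 * (A * ∑ j ∈ Finset.range k, (1 + β) ^ j) + (C * ∑ j ∈ Finset.range k, W j +
            k * (C * e + 2 * C ^ 2 * κ)) := by
          simp only [Finset.sum_add_distrib, ← Finset.mul_sum, Finset.sum_const, Finset.card_range,
            nsmul_eq_mul]
          ring
      _ ≤ 4 * C ^ 2 * (A * ∑ j ∈ Finset.range k, (1 + β) ^ j) + (C * y +
            n * (C * e + 2 * C ^ 2 * κ)) := by gcongr
      _ = _ := by ring
  rw [hrep, norm_smul, Real.norm_of_nonneg hε]
  calc _ ≤ ε * (a + (4 * C ^ 2 * (A * ∑ j ∈ Finset.range k, (1 + β) ^ j) + C * y +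
        n * (C * e + 2 * C ^ 2 * κ))) := by
        gcongr
        exact (norm_add_le _ _).trans (add_le_add (ha i k hk) ((norm_sum_le _ _).trans hsum))
    _ = A + A * ((∑ j ∈ Finset.range k, (1 + β) ^ j) * β) := by rw [hA, hβ]; ring
    _ = A * (1 + β) ^ k := by rw [hgeom]; ring

end InteractionBounds

end Particles

/-! ### Deviations along the Euler flow -/

section Deviations

variable {Ω E I : Type*} [MeasurableSpace Ω] [MeasurableSpace E] [MeasurableSpace I]
  {m : ℕ} {μ : Measure Ω} [IsProbabilityMeasure μ] {ρ₀ : Measure E} [IsProbabilityMeasure ρ₀]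
  {X : Fin m → Ω → E}

/-- Concentration of the sum over `j < N` of the mean absolute deviations of the families `h j`. -/
theorem measureReal_sum_integral_abs_deviation_ge_le
    (hX : ∀ i, Measurable (X i)) (hlaw : ∀ i, μ.map (X i) = ρ₀) (hind : iIndepFun X μ)
    (hm : 1 ≤ m) {Q : Measure I} [IsProbabilityMeasure Q] {h : ℕ → I → E → ℝ}
    (hh : ∀ j, Measurable (Function.uncurry (h j))) {c : ℝ} (hc : ∀ j q θ, |h j q θ| ≤ c)
    (hc0 : 0 < c) {N : ℕ} (hN : 0 < N) {y : ℝ} (hy : 0 ≤ y) :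
    μ.real {ω | N * y ≤
        ∑ j ∈ Finset.range N, ∫ q, |deviation ρ₀ (fun i => X i ω) (h j q)| ∂Q} ≤
      2 * Real.exp (-(m * y ^ 2 / (2 * c ^ 2))) := by
  have hN0 : (0 : ℝ) < N := by exact_mod_cast hN
  have : Nonempty (Fin N) := ⟨⟨0, hN⟩⟩
  set P := (PMF.uniformOfFintype (Fin N)).toMeasure
  have hm' : Measurable (Function.uncurry fun (p : Fin N × I) (θ : E) => h p.1 p.2 θ) := by
    have h1 : Measurable fun p : Fin N × (I × E) => h p.1 p.2.1 p.2.2 :=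
      measurable_from_prod_countable_right fun j => hh j
    exact h1.comp MeasurableEquiv.prodAssoc.measurable
  have key := measureReal_integral_abs_deviation_ge_le hX hlaw hind hm (Q := P.prod Q)
    hm' (fun p θ => hc p.1 p.2 θ) hc0 hy
  convert key using 3
  ext ω
  have hmeas : Measurable fun p : Fin N × I => |deviation ρ₀ (fun i => X i ω) (h p.1 p.2)| := by
    have h1 : Measurable fun p : Fin N × I => ∫ θ, h p.1 p.2 θ ∂ρ₀ :=
      (hm'.stronglyMeasurable.integral_prod_right (ν := ρ₀)).measurable
    have h2 : ∀ i, Measurable fun p : Fin N × I => h p.1 p.2 (X i ω) := fun i =>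
      hm'.comp measurable_prodMk_right
    exact (((Finset.measurable_sum _ fun i _ => h2 i).const_mul _).sub h1).abs
  have hint : Integrable (fun p : Fin N × I => |deviation ρ₀ (fun i => X i ω) (h p.1 p.2)|)
      (P.prod Q) := Integrable.of_bound hmeas.aestronglyMeasurable (2 * c)
      (Filter.Eventually.of_forall fun p => by
        rw [Real.norm_eq_abs, abs_abs]; exact abs_deviation_le (hc _ _) hc0.le)
  have e : ∫ p, |deviation ρ₀ (fun i => X i ω) (h (p : Fin N × I).1 p.2)| ∂(P.prod Q) =
      (N : ℝ)⁻¹ * ∑ j ∈ Finset.range N, ∫ q, |deviation ρ₀ (fun i => X i ω) (h j q)| ∂Q := by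
    rw [integral_prod _ hint, PMF.integral_eq_sum, Finset.sum_range]
    simp [← Finset.mul_sum]
  rw [e, inv_mul_eq_div, le_div_iff₀ hN0, mul_comm]

theorem deviation_sub {x : Fin m → E} {f g : E → ℝ} (hf : Integrable f ρ₀) (hg : Integrable g ρ₀) :
    deviation ρ₀ x (fun θ => f θ - g θ) = deviation ρ₀ x f - deviation ρ₀ x g := by
  rw [deviation, deviation, deviation, integral_sub hf hg, Finset.sum_sub_distrib]
  ring

/-- Controlling the increments of `F` bounds the deviations of all `F k` at once, without a union
bound over `k`. -/
theorem abs_deviation_le_sum {x : Fin m → E} {F : ℕ → E → ℝ} (hF : ∀ k, Integrable (F k) ρ₀)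
    {k n : ℕ} (hk : k ≤ n) :
    |deviation ρ₀ x (F k)| ≤ |deviation ρ₀ x (F 0)| +
      ∑ j ∈ Finset.range n, |deviation ρ₀ x fun θ => F (j + 1) θ - F j θ| := by
  have h1 : |deviation ρ₀ x (F k)| ≤ |deviation ρ₀ x (F 0)| +
      ∑ j ∈ Finset.range k, |deviation ρ₀ x fun θ => F (j + 1) θ - F j θ| := by
    induction k with
    | zero => simp
    | succ k ih =>
      have ih := ih (Nat.le_of_succ_le hk)
      rw [Finset.sum_range_succ, deviation_sub (hF _) (hF _)]
      linarith [abs_sub_abs_le_abs_sub (deviation ρ₀ x (F (k + 1))) (deviation ρ₀ x (F k))]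
  exact h1.trans (by gcongr)

end Deviations

/-! ### Propagation of chaos for the abstract particle system -/

/-- Collection of the error terms of the coupling. Here `p` and `q` stand for the two error terms
of the final estimate. -/
theorem error_terms_le {L C T p q y κ εr εN : ℝ} (hC : 1 ≤ C) (hL : L = 2 * C ^ 2) (hT : 0 ≤ T)
    (hp : 0 ≤ p) (hq : 0 ≤ q) (hy : y ≤ 3 * p) (hκ0 : 0 ≤ κ) (hκ : κ ≤ 2 * q)
    (hεr : εr ≤ 8 * L * (Real.exp T * q)) (hεN : εN ≤ Real.exp T) {t : ℝ}
    (ht : t ≤ T) {G : ℝ} (hG0 : 0 ≤ G) (hG : G ≤ Real.exp (2 * L * T))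
    (hy0 : 0 ≤ y) :
    12 * L ^ 3 * κ * Real.exp ((2 * L + 2) * T) + (y + εN * (L * y)) +
      (εr + C * (εN * (C * y)) + t * (C * (12 * L ^ 3 * C * κ * Real.exp ((2 * L + 2) * T)) +
        2 * C ^ 2 * κ)) * G ≤
    58 * L ^ 5 * Real.exp ((4 * L + 3) * T) * (p + q) := by
  have hL1 : 1 ≤ L := by nlinarith
  set a := Real.exp T with ha
  set b := Real.exp ((2 * L + 2) * T) with hb
  set g := Real.exp (2 * L * T) with hg
  have hE : Real.exp ((4 * L + 3) * T) = a * b * g := by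
    rw [ha, hb, hg, ← Real.exp_add, ← Real.exp_add]; congr 1; ring
  have ha1 : 1 ≤ a := Real.one_le_exp hT
  have hb1 : 1 ≤ b := Real.one_le_exp (by positivity)
  have hg1 : 1 ≤ g := Real.one_le_exp (by positivity)
  have hTa : t ≤ a := by linarith [Real.add_one_le_exp T]
  rw [hE]
  have hC2 : C ^ 2 = L / 2 := by linarith
  have e2 : L ^ 2 ≤ L ^ 5 := pow_le_pow_right₀ hL1 (by norm_num)
  have e1 : L ≤ L ^ 5 := le_self_pow₀ hL1 (by norm_num)
  have e3 : L ^ 3 ≤ L ^ 5 := pow_le_pow_right₀ hL1 (by norm_num)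
  have e4 : L ^ 4 ≤ L ^ 5 := pow_le_pow_right₀ hL1 (by norm_num)
  have f1 : 1 ≤ a * b * g := one_le_mul_of_one_le_of_one_le (one_le_mul_of_one_le_of_one_le ha1 hb1) hg1
  have f2 : b ≤ a * b * g := by
    calc b = 1 * b * 1 := by ring
      _ ≤ a * b * g := by gcongr
  have f3 : a ≤ a * b * g := by
    calc a = a * 1 * 1 := by ring
      _ ≤ a * b * g := by gcongr
  have f4 : a * g ≤ a * b * g := by
    calc a * g = a * 1 * g := by ring
      _ ≤ a * b * g := by gcongr
  have t1 : 12 * L ^ 3 * κ * b ≤ 24 * L ^ 5 * (a * b * g) * q := by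
    calc 12 * L ^ 3 * κ * b ≤ 12 * L ^ 5 * (2 * q) * (a * b * g) := by gcongr
      _ = _ := by ring
  have t2 : y + εN * (L * y) ≤ 6 * L ^ 5 * (a * b * g) * p := by
    have h1 : y ≤ 3 * L ^ 5 * (a * b * g) * p := by
      have : 1 ≤ L ^ 5 * (a * b * g) := one_le_mul_of_one_le_of_one_le (one_le_pow₀ hL1) f1
      nlinarith [mul_le_mul_of_nonneg_right this hp]
    have h2 : εN * (L * y) ≤ 3 * L ^ 5 * (a * b * g) * p := by
      calc εN * (L * y) ≤ (a * b * g) * (L ^ 5 * (3 * p)) := by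
            gcongr
            exact hεN.trans f3
        _ = _ := by ring
    linarith
  have t3 : εr * G ≤ 8 * L ^ 5 * (a * b * g) * q := by
    calc εr * G ≤ (8 * L * (a * q)) * g := by gcongr
      _ = 8 * L * (a * g) * q := by ring
      _ ≤ _ := by gcongr
  have t4 : C * (εN * (C * y)) * G ≤ 3 * L ^ 5 * (a * b * g) * p := by
    calc C * (εN * (C * y)) * G = C ^ 2 * (εN * y) * G := by ring
      _ ≤ C ^ 2 * (a * (3 * p)) * g := by gcongr
      _ = 3 * (L / 2) * (a * g) * p := by rw [hC2]; ring
      _ ≤ 3 * L ^ 5 * (a * b * g) * p := by gcongr; linarith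
  have t5 : t * (C * (12 * L ^ 3 * C * κ * b) + 2 * C ^ 2 * κ) * G ≤
      14 * L ^ 5 * (a * b * g) * q := by
    calc t * (C * (12 * L ^ 3 * C * κ * b) + 2 * C ^ 2 * κ) * G
        = t * (C ^ 2 * κ * (12 * L ^ 3 * b + 2 * 1)) * G := by ring
      _ ≤ a * (C ^ 2 * (2 * q) * (12 * L ^ 3 * b + 2 * (L ^ 3 * b))) * g := by
          gcongr
          exact one_le_mul_of_one_le_of_one_le (one_le_pow₀ hL1) hb1
      _ = 14 * L ^ 4 * (a * b * g) * q := by rw [hC2]; ring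
      _ ≤ _ := by gcongr
  have hpq : 0 ≤ L ^ 5 * (a * b * g) * p := by positivity
  have hpq' : 0 ≤ L ^ 5 * (a * b * g) * q := by positivity
  rw [add_mul, add_mul]
  nlinarith

section Chaos

variable {E : Type*} [NormedAddCommGroup E] [InnerProductSpace ℝ E] [FiniteDimensional ℝ E]
  [MeasurableSpace E] [BorelSpace E] {Z : Type*} [MeasurableSpace Z]
  {ν : Measure Z} [IsProbabilityMeasure ν] {u : Z → E → ℝ} {v : Z → E → E} {r : Z → ℝ}
  {C : ℝ≥0} {m : ℕ} {Ω : Type*} [MeasurableSpace Ω] {μ : Measure Ω} [IsProbabilityMeasure μ]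

/-- The maximal inequality for the accumulated noise of one particle. -/
theorem InteractionBounds.measureReal_exists_norm_sum_noise_ge_le
    (h : InteractionBounds ν u v r C) (hC : 1 ≤ C) {ρ₀ : Measure E} {θ₀ : Fin m → Ω → E}
    {z : ℕ → Ω → Z} (hs : IsTDSampling μ ρ₀ ν θ₀ z) {ε : ℝ} {Θ : Ω → ℕ → Fin m → E}
    (hΘ0 : ∀ ω i, Θ ω 0 i = θ₀ i ω)
    (hΘ : ∀ ω k i, Θ ω (k + 1) i = Θ ω k i + ε • increment u v r i (Θ ω k) (z k ω)) (i : Fin m)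
    {N : ℕ} (hN : 0 < N) {a : ℝ} (ha : 0 < a) :
    μ.real {ω | ∃ k ≤ N, a ≤ ‖∑ j ∈ Finset.range k, noise ν u v r i (Θ ω j) (z j ω)‖} ≤
      2 * Real.exp (-(a ^ 2 / (4 * N * (2 * (2 * C ^ 2)) ^ 2))) := by
  have hC0 : (0 : ℝ) < C := by exact_mod_cast zero_lt_one.trans_le hC
  have hF : Measurable fun p : (Fin m → E) × Z => fun i => p.1 i + ε • increment u v r i p.1 p.2 :=
    measurable_pi_lambda _ fun i =>
      ((measurable_pi_apply i).comp measurable_fst).add ((h.measurable_increment i).const_smul ε)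
  refine measureReal_exists_norm_chain_ge_le (θ₀ := fun ω i => θ₀ i ω) (w₀ := id)
    (W := fun k ω => Θ ω k) (M := fun k ω => ∑ j ∈ Finset.range k, noise ν u v r i (Θ ω j) (z j ω))
    (measurable_pi_lambda _ hs.measurable_init) hs.measurable_sample hs.law_sample hs.indep_sample
    hs.indep measurable_id hF (fun ω => funext (hΘ0 ω)) (fun k ω => funext (hΘ ω k))
    (h.measurable_noise i) (by positivity) (h.ae_norm_noise_le i) (h.integral_noise i)
    (fun ω => by simp) (fun k ω => Finset.sum_range_succ _ _) hN ha

theorem exp_neg_four_mul_log {m : ℕ} {δ : ℝ} (hm : 1 ≤ m) (hδ : 0 < δ) (h2 : 2 * δ ≤ m) :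
    (m + 3) * (2 * Real.exp (-(4 * Real.log (m / δ)))) ≤ δ := by
  have hm0 : (1 : ℝ) ≤ m := by exact_mod_cast hm
  have hm0' : (0 : ℝ) < m := by linarith
  have e : Real.exp (-(4 * Real.log (m / δ))) = (δ / m) ^ 4 := by
    rw [Real.exp_neg, mul_comm, Real.exp_mul, Real.exp_log (by positivity)]
    norm_num [div_pow]
  have hx : δ / m ≤ 1 / 2 := by rw [div_le_div_iff₀ hm0' two_pos]; linarith
  have hx0 : 0 < δ / m := by positivity
  have h3 : (δ / m) ^ 3 ≤ (1 / 2) ^ 3 := by gcongr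
  calc (m + 3) * (2 * Real.exp (-(4 * Real.log (m / δ))))
      = (m + 3) * (2 * ((δ / m) ^ 3 * (δ / m))) := by rw [e]; ring
    _ ≤ (4 * m) * (2 * ((1 / 2) ^ 3 * (δ / m))) := by gcongr; linarith
    _ = δ := by field_simp; norm_num

set_option maxHeartbeats 800000 in
/-- The quantitative propagation of chaos for step sizes at most one: outside an event of
probability at most `δ`, the empirical distribution of the particles is close to the solution of
the mean-field equation. The error splits into the distance from the solution to the Euler flow,
the fluctuation of the Euler flow over the random initial positions, and the distance between the
particles and the Euler flow. -/
theorem InteractionBounds.exists_event (h : InteractionBounds ν u v r C) (hC : 1 ≤ C)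
    {T : ℝ} (hT : 0 < T) {ρ : ℝ → ProbabilityMeasure E}
    (hρ : IsContinuitySolution T (2 * C ^ 2) (fun s => velocity ν u v r (ρ s : Measure E)) ρ)
    {f : E → ℝ} (hf1 : ∀ θ, |f θ| ≤ 1) (hf : LipschitzWith 1 f) {ε δ : ℝ} (hm : 1 ≤ m)
    (hε : 0 < ε) (hε1 : ε ≤ 1) (hδ : 0 < δ) (hδm : 2 * δ ≤ m)
    {θ₀ : Fin m → Ω → E} {z : ℕ → Ω → Z} (hs : IsTDSampling μ (ρ 0 : Measure E) ν θ₀ z)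
    {Θ : Ω → ℕ → Fin m → E} (hΘ0 : ∀ ω i, Θ ω 0 i = θ₀ i ω)
    (hΘ : ∀ ω k i, Θ ω (k + 1) i = Θ ω k i + ε • increment u v r i (Θ ω k) (z k ω)) :
    ∃ bad : Set Ω, μ.real bad ≤ δ ∧ ∀ ω ∉ bad, ∀ k : ℕ, (k : ℝ) ≤ T / ε →
      |∫ θ, f θ ∂(ρ (k * ε) : Measure E) - (m : ℝ)⁻¹ * ∑ i, f (Θ ω k i)| ≤
        58 * (2 * (C : ℝ) ^ 2) ^ 5 * Real.exp ((4 * (2 * (C : ℝ) ^ 2) + 3) * T) *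
          (√(Real.log (m / δ) / m) + √(ε * (finrank ℝ E + Real.log (m / δ)))) := by
  set D : ℝ := (finrank ℝ E : ℝ) with hD
  have hD0 : 0 ≤ D := Nat.cast_nonneg _
  have hm0 : (0 : ℝ) < m := by exact_mod_cast hm
  have hC1 : (1 : ℝ) ≤ C := by exact_mod_cast hC
  set Λ := Real.log (m / δ) with hΛdef
  have hΛ : 1 / 2 ≤ Λ := by
    have h1 : Real.log 2 ≤ Λ := Real.log_le_log two_pos (by rwa [le_div_iff₀ hδ])
    linarith [Real.log_two_gt_d9]
  set L : ℝ := 2 * (C : ℝ) ^ 2 with hL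
  have hL1 : 1 ≤ L := by nlinarith
  have hL1' : (1 : ℝ≥0) ≤ 2 * C ^ 2 := by exact_mod_cast hL1
  have hLc : ((2 * C ^ 2 : ℝ≥0) : ℝ) = L := by push_cast; rfl
  set κ := √(ε * (D + 1)) with hκdef
  have hκ : 0 < κ := Real.sqrt_pos.2 (by positivity)
  have hκ2 : κ ^ 2 = ε * (D + 1) := Real.sq_sqrt (by positivity)
  have hεκ : ε ≤ κ := Real.le_sqrt_of_sq_le (by nlinarith)
  have hεD : ε * finrank ℝ E ≤ κ ^ 2 := by rw [hκ2]; gcongr; linarith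
  set n := ⌊T / ε⌋₊ with hn
  have hnT : n * ε ≤ T := by
    rw [← le_div_iff₀ hε]; exact Nat.floor_le (by positivity)
  set N := n + 1 with hNdef
  have hN : 0 < N := Nat.succ_pos n
  have hNr : (N : ℝ) = n + 1 := by rw [hNdef]; push_cast; ring
  set b : ℝ → E → E := fun s => velocity ν u v r (ρ s : Measure E) with hb
  set Φ := eulerFlow ε (mollifiedField κ ε b) with hΦ
  have hcL : ∀ j θ, ‖mollifiedField κ ε b j θ‖ ≤ L := fun j θ => by
    rw [← hLc]
    exact norm_ballAvg_le hκ (hρ.lipschitz _).continuous (hρ.norm_le _) θ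
  have hΦc : ∀ j, Continuous (Φ j) := continuous_eulerFlow ε fun j =>
    (lipschitzWith_ballAvg hκ (hρ.lipschitz _)).continuous
  have hΦs : ∀ j θ, Φ (j + 1) θ = Φ j θ + ε • mollifiedField κ ε b j (Φ j θ) := fun j θ => rfl
  have hbt : ∀ s ∈ Icc 0 T, ∀ t ∈ Icc 0 T, ∀ θ, ‖b t θ - b s θ‖ ≤
      ((2 * C ^ 2 : ℝ≥0) : ℝ) ^ 2 * |t - s| := fun s hs t ht θ => h.norm_velocity_sub_le hρ hs ht θ
  have hEuler : ∀ {g : E → ℝ} {M : ℝ} {l : ℝ≥0}, (∀ θ, |g θ| ≤ M) → LipschitzWith l g → ∀ k ≤ n,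
      |∫ θ, g θ ∂(ρ (k * ε) : Measure E) - ∫ θ, g (Φ k θ) ∂(ρ 0 : Measure E)| ≤
        12 * L ^ 3 * l * κ * Real.exp ((2 * L + 2) * T) := by
    intro g M l hM hg k hk
    have hkT : k * ε ≤ T := le_trans (by gcongr) hnT
    have := hρ.abs_integral_sub_eulerFlow_mollifiedField_le hL1' hbt hε.le hκ hεκ hεD k hkT hM hg
    rwa [hLc] at this
  -- The thresholds for which each of the `m + 3` bad events has probability at most
  -- `2 * exp (-4 * Λ)`.
  set y := √(8 * Λ / m) with hy
  have hy0 : 0 < y := Real.sqrt_pos.2 (by positivity)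
  have hy2 : y ^ 2 = 8 * Λ / m := Real.sq_sqrt (by positivity)
  set a := 8 * L * √(N * Λ) with hadef
  have hN0 : (0 : ℝ) < N := by exact_mod_cast hN
  have ha : 0 < a := by
    have : 0 < √(N * Λ) := Real.sqrt_pos.2 (by positivity)
    positivity
  let bad₁ : Set Ω := {ω | y ≤ |deviation (ρ 0 : Measure E) (fun i => θ₀ i ω) f|}
  let bad₂ : Set Ω := {ω | N * (ε * L * y) ≤ ∑ j ∈ Finset.range N,
    |deviation (ρ 0 : Measure E) (fun i => θ₀ i ω) fun θ => f (Φ (j + 1) θ) - f (Φ j θ)|}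
  let bad₃ : Set Ω := {ω | N * (C * y) ≤ ∑ j ∈ Finset.range N,
    ∫ z, |deviation (ρ 0 : Measure E) (fun i => θ₀ i ω) fun θ => u z (Φ j θ)| ∂ν}
  let bad₄ : Fin m → Set Ω := fun i =>
    {ω | ∃ k ≤ N, a ≤ ‖∑ j ∈ Finset.range k, noise ν u v r i (Θ ω j) (z j ω)‖}
  have hexp : ∀ c : ℝ, 0 < c → m * (c * y) ^ 2 / (2 * c ^ 2) = 4 * Λ := fun c hc => by
    rw [mul_pow, hy2]; field_simp; norm_num
  have hP₁ : μ.real bad₁ ≤ 2 * Real.exp (-(4 * Λ)) := by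
    have := measureReal_integral_abs_deviation_ge_le (Q := Measure.dirac ()) (I := Unit)
      hs.measurable_init hs.law_init hs.indep_init hm (h := fun _ => f)
      (hf.continuous.measurable.comp measurable_snd) (fun _ => hf1) one_pos hy0.le
    have e := hexp 1 one_pos
    rw [one_mul] at e
    rw [e] at this
    simpa using this
  have hP₂ : μ.real bad₂ ≤ 2 * Real.exp (-(4 * Λ)) := by
    have := measureReal_sum_integral_abs_deviation_ge_le (Q := Measure.dirac ()) (I := Unit)
      hs.measurable_init hs.law_init hs.indep_init hm
      (h := fun j _ θ => f (Φ (j + 1) θ) - f (Φ j θ)) (c := ε * L)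
      (fun j => (((hf.continuous.comp (hΦc (j + 1))).sub
        (hf.continuous.comp (hΦc j))).measurable).comp measurable_snd) (fun j _ θ => by
        have h1 := hf.norm_sub_le (Φ (j + 1) θ) (Φ j θ)
        rw [hΦs, add_sub_cancel_left, NNReal.coe_one, one_mul, norm_smul,
          Real.norm_of_nonneg hε.le, ← hΦs] at h1
        exact h1.trans (by gcongr; exact hcL _ _)) (by positivity) hN
      (y := ε * L * y) (by positivity)
    rw [hexp (ε * L) (by positivity)] at this
    simpa using this
  have hP₃ : μ.real bad₃ ≤ 2 * Real.exp (-(4 * Λ)) := by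
    have := measureReal_sum_integral_abs_deviation_ge_le (Q := ν)
      hs.measurable_init hs.law_init hs.indep_init hm (h := fun j z θ => u z (Φ j θ)) (c := C)
      (fun j => h.measurable_u.comp (measurable_fst.prodMk
        ((hΦc j).measurable.comp measurable_snd)))
      (fun j z θ => h.abs_u_le z _) (by positivity) hN (y := C * y) (by positivity)
    rwa [hexp C (by positivity)] at this
  have hP₄ : ∀ i, μ.real (bad₄ i) ≤ 2 * Real.exp (-(4 * Λ)) := fun i => by
    have := h.measureReal_exists_norm_sum_noise_ge_le hC hs hΘ0 hΘ i hN ha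
    have e : a ^ 2 / (4 * N * (2 * L) ^ 2) = 4 * Λ := by
      rw [hadef, mul_pow, Real.sq_sqrt (by positivity)]
      field_simp
      norm_num
    rwa [e] at this
  refine ⟨bad₁ ∪ bad₂ ∪ bad₃ ∪ ⋃ i, bad₄ i, ?_, fun ω hω k hk => ?_⟩
  · have h4 : μ.real (⋃ i, bad₄ i) ≤ m * (2 * Real.exp (-(4 * Λ))) :=
      (measureReal_iUnion_fintype_le _).trans
        ((Finset.sum_le_sum fun i _ => hP₄ i).trans (by simp))
    calc _ ≤ μ.real bad₁ + μ.real bad₂ + μ.real bad₃ + μ.real (⋃ i, bad₄ i) :=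
          (measureReal_union_le _ _).trans (by
            gcongr
            exact (measureReal_union_le _ _).trans (by gcongr; exact measureReal_union_le _ _))
      _ ≤ (m + 3) * (2 * Real.exp (-(4 * Λ))) := by linarith
      _ ≤ δ := exp_neg_four_mul_log hm hδ hδm
  · simp only [mem_union, mem_iUnion, not_or, not_exists] at hω
    obtain ⟨⟨⟨h₁, h₂⟩, h₃⟩, h₄⟩ := hω
    have h₁ : |deviation (ρ 0 : Measure E) (fun i => θ₀ i ω) f| < y := not_le.1 h₁
    have h₂ : _ < N * (ε * L * y) := lt_of_not_ge h₂
    have h₃ : _ < N * (C * y) := lt_of_not_ge h₃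
    have hx : (fun i => θ₀ i ω) = Θ ω 0 := funext fun i => (hΘ0 ω i).symm
    rw [hx] at h₁ h₂ h₃
    have hkn : k ≤ n := Nat.le_floor hk
    have hnN : n ≤ N := Nat.le_succ n
    have hcoup : ∀ i, ‖Θ ω k i - Φ k (Θ ω 0 i)‖ ≤ _ := fun i =>
      h.norm_sub_eulerFlow_le (ρ := ρ) (a := a) (y := N * (C * y))
        (e := 12 * L ^ 3 * C * κ * Real.exp ((2 * L + 2) * T)) hε.le hκ (hΘ ω) hΦ
        (fun i k hk => (not_le.1 fun hle => h₄ i ⟨k, hk.trans hnN, hle⟩).le)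
        ((Finset.sum_le_sum_of_subset_of_nonneg (Finset.range_mono hnN) fun _ _ _ =>
          integral_nonneg fun _ => abs_nonneg _).trans h₃.le)
        (fun j hj z => hEuler (h.abs_u_le z) (h.lipschitz_u z) j hj)
        (by positivity) (by positivity) ha.le i hkn
    set X := (ε * a + ε * (C * (N * (C * y))) + n * ε * (C * (12 * L ^ 3 * C * κ *
      Real.exp ((2 * L + 2) * T)) + 2 * C ^ 2 * κ)) * (1 + 4 * C ^ 2 * ε) ^ k with hX
    have hX0 : 0 ≤ X := by positivity
    have s1 := hEuler hf1 hf k hkn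
    rw [NNReal.coe_one, mul_one] at s1
    have s2 : |deviation (ρ 0 : Measure E) (Θ ω 0) fun θ => f (Φ k θ)| ≤
        y + N * (ε * L * y) := by
      have h5 := abs_deviation_le_sum (ρ₀ := (ρ 0 : Measure E)) (x := Θ ω 0)
        (F := fun k θ => f (Φ k θ)) (fun j => integrable_of_continuous_of_bound
          (hf.continuous.comp (hΦc j)) fun _ => hf1 _) (hkn.trans hnN)
      exact h5.trans (add_le_add h₁.le h₂.le)
    have s3 : |(m : ℝ)⁻¹ * ∑ i, f (Φ k (Θ ω 0 i)) - (m : ℝ)⁻¹ * ∑ i, f (Θ ω k i)| ≤ X := by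
      rw [← mul_sub, ← Finset.sum_sub_distrib]
      refine abs_average_le hX0 fun i => ?_
      rw [abs_sub_comm]
      have := hf.norm_sub_le (Θ ω k i) (Φ k (Θ ω 0 i))
      rw [NNReal.coe_one, one_mul] at this
      exact this.trans (hcoup i)
    rw [deviation] at s2
    have hsum : |∫ θ, f θ ∂(ρ (k * ε) : Measure E) - (m : ℝ)⁻¹ * ∑ i, f (Θ ω k i)| ≤
        12 * L ^ 3 * κ * Real.exp ((2 * L + 2) * T) + (y + N * (ε * L * y)) + X := by
      have e : ∫ θ, f θ ∂(ρ (k * ε) : Measure E) - (m : ℝ)⁻¹ * ∑ i, f (Θ ω k i) =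
        (∫ θ, f θ ∂(ρ (k * ε) : Measure E) - ∫ θ, f (Φ k θ) ∂(ρ 0 : Measure E)) +
        (∫ θ, f (Φ k θ) ∂(ρ 0 : Measure E) - (m : ℝ)⁻¹ * ∑ i, f (Φ k (Θ ω 0 i))) +
        ((m : ℝ)⁻¹ * ∑ i, f (Φ k (Θ ω 0 i)) - (m : ℝ)⁻¹ * ∑ i, f (Θ ω k i)) := by ring
      rw [e]
      refine (abs_add_three _ _ _).trans (add_le_add (add_le_add s1 ?_) s3)
      rwa [abs_sub_comm]
    refine hsum.trans ?_
    have hεN : ε * N ≤ Real.exp T := by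
      have h6 := Real.add_one_le_exp T
      have h7 : ε * N = n * ε + ε := by rw [hNr]; ring
      linarith
    have hyp : y ≤ 3 * √(Λ / m) := by
      rw [hy, show (3 : ℝ) = √9 by rw [show (9 : ℝ) = 3 ^ 2 by norm_num, Real.sqrt_sq (by norm_num)],
        ← Real.sqrt_mul (by norm_num)]
      refine Real.sqrt_le_sqrt ?_
      rw [mul_div_assoc]
      gcongr
      norm_num
    have hκq : κ ≤ 2 * √(ε * (D + Λ)) := by
      rw [hκdef, show (2 : ℝ) = √4 by rw [show (4 : ℝ) = 2 ^ 2 by norm_num, Real.sqrt_sq (by norm_num)],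
        ← Real.sqrt_mul (by norm_num)]
      refine Real.sqrt_le_sqrt ?_
      rw [mul_left_comm]
      gcongr
      linarith
    have hεa : ε * a ≤ 8 * L * (Real.exp T * √(ε * (D + Λ))) := by
      have h6 : ε * √(N * Λ) ≤ Real.exp T * √(ε * (D + Λ)) := by
        refine abs_le_of_sq_le_sq' ?_ (by positivity) |>.2
        rw [mul_pow, mul_pow, Real.sq_sqrt (by positivity), Real.sq_sqrt (by positivity)]
        calc ε ^ 2 * (N * Λ) = (ε * N) * (ε * Λ) := by ring
          _ ≤ Real.exp T * (ε * Λ) := by gcongr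
          _ ≤ Real.exp T ^ 2 * (ε * (D + Λ)) := by
            gcongr
            · exact le_self_pow₀ (Real.one_le_exp hT.le) (by norm_num)
            · linarith
      calc ε * a = 8 * L * (ε * √(N * Λ)) := by rw [hadef]; ring
        _ ≤ _ := by gcongr
    have hG : (1 + 4 * (C : ℝ) ^ 2 * ε) ^ k ≤ Real.exp (2 * L * T) := by
      have h7 : 1 + 4 * (C : ℝ) ^ 2 * ε ≤ Real.exp (2 * L * ε) := by
        have := Real.add_one_le_exp (2 * L * ε)
        rw [hL] at this ⊢
        linarith
      calc _ ≤ Real.exp (2 * L * ε) ^ k := by gcongr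
        _ = Real.exp (2 * L * (k * ε)) := by rw [← Real.exp_nat_mul]; congr 1; ring
        _ ≤ _ := by
          gcongr
          exact le_trans (by gcongr) hnT
    have final := error_terms_le hC1 hL hT.le (Real.sqrt_nonneg (Λ / m))
      (Real.sqrt_nonneg (ε * (D + Λ))) hyp hκ.le hκq hεa hεN
      (t := n * ε) hnT (by positivity) hG hy0.le
    refine le_trans (le_of_eq ?_) final
    rw [hX]
    ring

end Chaos

/-! ### Temporal-difference learning as an interacting particle system -/

section TD

variable {d₁ d₂ D : ℕ} {S : Set (Euc d₁)} {A : Set (Euc d₂)} {σ : Inp d₁ d₂ → Euc D → ℝ}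
  {B₀ B₁ B₂ : ℝ}

theorem norm_fderiv_gradient_le (f : Euc D → ℝ) (θ : Euc D) :
    ‖fderiv ℝ (gradient f) θ‖ ≤ frobeniusNorm (hessian f θ) := by
  refine ContinuousLinearMap.opNorm_le_bound _ (Real.sqrt_nonneg _) fun w => ?_
  have hw : w = ∑ j, w j • EuclideanSpace.single j (1 : ℝ) := by
    have := (EuclideanSpace.basisFun (Fin D) ℝ).sum_repr w
    simpa using this.symm
  have hco : ∀ i, (fderiv ℝ (gradient f) θ w) i = ∑ j, hessian f θ i j * w j := fun i => by
    conv_lhs => rw [hw]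
    rw [map_sum]
    simp [hessian, mul_comm]
  refine abs_le_of_sq_le_sq' ?_
    (mul_nonneg (Real.sqrt_nonneg _) (norm_nonneg _)) |>.2
  rw [mul_pow, Real.sq_sqrt (by positivity), EuclideanSpace.norm_sq_eq,
    EuclideanSpace.norm_sq_eq, Finset.sum_mul]
  refine Finset.sum_le_sum fun i _ => ?_
  simp only [Real.norm_eq_abs, sq_abs]
  rw [hco]
  exact Finset.sum_mul_sq_le_sq_mul_sq _ _ _

namespace ActivationBounds

/-- The gradient is measurable in the input, as a limit of difference quotients. -/
theorem measurable_gradient (h : ActivationBounds S A σ B₀ B₁ B₂) (θ : Euc D) :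
    Measurable fun x : S × A => gradient (σ (vec x)) θ := by
  have hco : ∀ w : Euc D, Measurable fun x : S × A => fderiv ℝ (σ (vec x)) θ w := fun w => by
    refine measurable_of_tendsto_metrizable
      (f := fun (n : ℕ) (x : S × A) => (n : ℝ) • (σ (vec x) (θ + (n : ℝ)⁻¹ • w) - σ (vec x) θ))
      (fun n => ((h.measurable (θ + (n : ℝ)⁻¹ • w)).sub (h.measurable θ)).const_smul (n : ℝ))
      (tendsto_pi_nhds.2 fun x => ?_)
    exact ((h.differentiable x θ).hasFDerivAt.lim_real w).comp tendsto_natCast_atTop_atTop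
  have e : (fun x : S × A => gradient (σ (vec x)) θ) = fun x : S × A =>
      ∑ i, fderiv ℝ (σ (vec x)) θ (EuclideanSpace.single i 1) • EuclideanSpace.single i (1 : ℝ) := by
    ext1 x
    have := (EuclideanSpace.basisFun (Fin D) ℝ).sum_repr' (gradient (σ (vec x)) θ)
    rw [← this]
    refine Finset.sum_congr rfl fun i _ => ?_
    rw [real_inner_comm, inner_gradient_left, EuclideanSpace.basisFun_apply]
  rw [e]
  exact Finset.measurable_sum _ fun i _ => (hco _).smul_const _

theorem continuous_gradient (h : ActivationBounds S A σ B₀ B₁ B₂) (x : S × A) :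
    Continuous (gradient (σ (vec x))) :=
  (h.differentiable_gradient x).continuous

theorem measurable_uncurry (h : ActivationBounds S A σ B₀ B₁ B₂) :
    Measurable fun p : (S × A) × Euc D => σ (vec p.1) p.2 :=
  (measurable_uncurry_of_continuous_of_measurable (u := fun θ (x : S × A) => σ (vec x) θ)
    (fun x => (h.differentiable x).continuous) h.measurable).comp measurable_swap

theorem measurable_uncurry_gradient (h : ActivationBounds S A σ B₀ B₁ B₂) :
    Measurable fun p : (S × A) × Euc D => gradient (σ (vec p.1)) p.2 :=
  (measurable_uncurry_of_continuous_of_measurable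
    (u := fun θ (x : S × A) => gradient (σ (vec x)) θ)
    h.continuous_gradient h.measurable_gradient).comp measurable_swap

theorem norm_gradient_le (h : ActivationBounds S A σ B₀ B₁ B₂) (hx : ∀ x : S × A, ‖vec x‖ ≤ 1)
    (x : S × A) (θ : Euc D) : ‖gradient (σ (vec x)) θ‖ ≤ |B₁| :=
  calc _ ≤ B₁ * ‖vec x‖ := h.gradient_bound x θ
    _ ≤ |B₁| * 1 := by gcongr; exacts [le_abs_self _, hx x]
    _ = |B₁| := mul_one _

theorem abs_sub_le (h : ActivationBounds S A σ B₀ B₁ B₂) (hx : ∀ x : S × A, ‖vec x‖ ≤ 1)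
    (x : S × A) (θ θ' : Euc D) : |σ (vec x) θ - σ (vec x) θ'| ≤ |B₁| * ‖θ - θ'‖ := by
  refine convex_univ.norm_image_sub_le_of_norm_fderiv_le (𝕜 := ℝ)
    (fun θ _ => h.differentiable x θ) (fun θ _ => ?_) (mem_univ _) (mem_univ _)
  have := h.norm_gradient_le hx x θ
  rwa [gradient, LinearIsometryEquiv.norm_map] at this

theorem norm_gradient_sub_le (h : ActivationBounds S A σ B₀ B₁ B₂)
    (hx : ∀ x : S × A, ‖vec x‖ ≤ 1) (x : S × A) (θ θ' : Euc D) :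
    ‖gradient (σ (vec x)) θ - gradient (σ (vec x)) θ'‖ ≤ |B₂| * ‖θ - θ'‖ := by
  refine convex_univ.norm_image_sub_le_of_norm_fderiv_le (𝕜 := ℝ)
    (fun θ _ => h.differentiable_gradient x θ) (fun θ _ => ?_) (mem_univ _) (mem_univ _)
  calc _ ≤ _ := norm_fderiv_gradient_le _ _
    _ ≤ B₂ * ‖vec x‖ ^ 2 := h.hessian_bound x θ
    _ ≤ |B₂| * 1 ^ 2 := by gcongr; exacts [le_abs_self _, hx x]
    _ = |B₂| := by ring

end ActivationBounds

/-- The interaction function of TD learning: the temporal difference of the network, without the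
reward. -/
def tdU (α γ : ℝ) (σ : Inp d₁ d₂ → Euc D → ℝ) (z : (S × A) × ℝ × (S × A)) (θ : Euc D) : ℝ :=
  α * (σ (vec z.1) θ - γ * σ (vec z.2.2) θ)

/-- The direction of motion of a particle in TD learning. -/
noncomputable def tdV (α η : ℝ) (σ : Inp d₁ d₂ → Euc D → ℝ) (z : (S × A) × ℝ × (S × A))
    (θ : Euc D) : Euc D :=
  (η * α) • gradient (σ (vec z.1)) θ

/-- A common bound for the constants of the interacting particle system of TD learning. -/
noncomputable def tdBound (α η B₀ B₁ B₂ Br : ℝ) : ℝ≥0 :=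
  (1 + (2 * α * |B₀| + 2 * α * |B₁| + η * α * |B₁| + η * α * |B₂| + |Br|)).toNNReal

variable {α η γ Br : ℝ}

theorem coe_tdBound (hα : 0 < α) (hη : 0 < η) : (tdBound α η B₀ B₁ B₂ Br : ℝ) =
    1 + (2 * α * |B₀| + 2 * α * |B₁| + η * α * |B₁| + η * α * |B₂| + |Br|) :=
  Real.coe_toNNReal _ (by positivity)

instance {P : Kernel (S × A) S} {pol : Kernel S A} [IsMarkovKernel P] [IsMarkovKernel pol] :
    IsMarkovKernel (nextPair P pol) := by
  unfold nextPair; infer_instance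

instance {P : Kernel (S × A) S} {R : Kernel (S × A) ℝ} {pol : Kernel S A} {𝒟 : Measure (S × A)}
    [IsMarkovKernel P] [IsMarkovKernel R] [IsMarkovKernel pol] [IsProbabilityMeasure 𝒟] :
    IsProbabilityMeasure (sampleLaw P R pol 𝒟) := by
  unfold sampleLaw; infer_instance

theorem ae_abs_reward_le {P : Kernel (S × A) S} {R : Kernel (S × A) ℝ} {pol : Kernel S A}
    {𝒟 : Measure (S × A)} [IsMarkovKernel P] [IsMarkovKernel R] [IsMarkovKernel pol]
    [IsProbabilityMeasure 𝒟] (hR : ∀ x : S × A, ∀ᵐ r ∂(R x), |r| ≤ Br) :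
    ∀ᵐ z ∂(sampleLaw P R pol 𝒟), |z.2.1| ≤ Br := by
  refine (Measure.ae_compProd_iff (p := fun z : (S × A) × ℝ × (S × A) => |z.2.1| ≤ Br)
    (measurableSet_le (by fun_prop) measurable_const)).2 (Filter.Eventually.of_forall fun x => ?_)
  rw [Kernel.prod_apply]
  exact Measure.quasiMeasurePreserving_fst.ae (hR x)

theorem ActivationBounds.interactionBounds (h : ActivationBounds S A σ B₀ B₁ B₂)
    (hx : ∀ x : S × A, ‖vec x‖ ≤ 1) (hα : 0 < α) (hη : 0 < η) (hγ : γ ∈ Ioo (0 : ℝ) 1)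
    {ν : Measure ((S × A) × ℝ × (S × A))} (hr : ∀ᵐ z ∂ν, |z.2.1| ≤ Br) :
    InteractionBounds ν (tdU α γ σ) (tdV α η σ) (fun z => z.2.1) (tdBound α η B₀ B₁ B₂ Br) where
  measurable_u := by
    have h1 : Measurable fun p : ((S × A) × ℝ × (S × A)) × Euc D => σ (vec p.1.1) p.2 :=
      h.measurable_uncurry.comp ((measurable_fst.comp measurable_fst).prodMk measurable_snd)
    have h2 : Measurable fun p : ((S × A) × ℝ × (S × A)) × Euc D => σ (vec p.1.2.2) p.2 :=
      h.measurable_uncurry.comp (((measurable_snd.comp measurable_snd).comp measurable_fst).prodMk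
        measurable_snd)
    exact (h1.sub (h2.const_mul γ)).const_mul α
  measurable_v := by
    have h1 : Measurable fun p : ((S × A) × ℝ × (S × A)) × Euc D => gradient (σ (vec p.1.1)) p.2 :=
      h.measurable_uncurry_gradient.comp
        ((measurable_fst.comp measurable_fst).prodMk measurable_snd)
    exact h1.const_smul (η * α)
  measurable_r := measurable_fst.comp measurable_snd
  abs_u_le z θ := by
    rw [coe_tdBound hα hη, tdU, abs_mul, abs_of_pos hα]
    have h1 : |σ (vec z.1) θ - γ * σ (vec z.2.2) θ| ≤ 2 * |B₀| := by
      refine (abs_sub _ _).trans ?_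
      rw [abs_mul, abs_of_pos hγ.1]
      have a1 := (h.bound z.1 θ).trans (le_abs_self _)
      have a2 := (h.bound z.2.2 θ).trans (le_abs_self _)
      nlinarith [hγ.1, hγ.2, abs_nonneg (σ (vec z.2.2) θ)]
    have h2 := mul_le_mul_of_nonneg_left h1 hα.le
    have : 0 ≤ 2 * α * |B₁| + η * α * |B₁| + η * α * |B₂| + |Br| := by positivity
    linarith
  lipschitz_u z := by
    refine LipschitzWith.of_dist_le_mul fun θ θ' => ?_
    rw [coe_tdBound hα hη, Real.dist_eq, dist_eq_norm, tdU, tdU, ← mul_sub, abs_mul, abs_of_pos hα]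
    have h1 : |σ (vec z.1) θ - γ * σ (vec z.2.2) θ - (σ (vec z.1) θ' - γ * σ (vec z.2.2) θ')| ≤
        2 * |B₁| * ‖θ - θ'‖ := by
      have e : σ (vec z.1) θ - γ * σ (vec z.2.2) θ - (σ (vec z.1) θ' - γ * σ (vec z.2.2) θ') =
          (σ (vec z.1) θ - σ (vec z.1) θ') - γ * (σ (vec z.2.2) θ - σ (vec z.2.2) θ') := by ring
      rw [e]
      refine (abs_sub _ _).trans ?_
      rw [abs_mul, abs_of_pos hγ.1]
      have a1 := h.abs_sub_le hx z.1 θ θ'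
      have a2 := h.abs_sub_le hx z.2.2 θ θ'
      nlinarith [hγ.1, hγ.2, abs_nonneg (σ (vec z.2.2) θ - σ (vec z.2.2) θ')]
    calc _ ≤ α * (2 * |B₁| * ‖θ - θ'‖) := by gcongr
      _ = (2 * α * |B₁|) * ‖θ - θ'‖ := by ring
      _ ≤ _ := by
        gcongr
        have : 0 ≤ 2 * α * |B₀| + η * α * |B₁| + η * α * |B₂| + |Br| := by positivity
        linarith
  norm_v_le z θ := by
    rw [coe_tdBound hα hη, tdV, norm_smul, Real.norm_of_nonneg (by positivity)]
    have h1 := mul_le_mul_of_nonneg_left (h.norm_gradient_le hx z.1 θ)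
      (show 0 ≤ η * α by positivity)
    have : 0 ≤ 2 * α * |B₀| + 2 * α * |B₁| + η * α * |B₂| + |Br| := by positivity
    linarith
  lipschitz_v z := by
    refine LipschitzWith.of_dist_le_mul fun θ θ' => ?_
    rw [coe_tdBound hα hη, dist_eq_norm, dist_eq_norm, tdV, tdV, ← smul_sub, norm_smul,
      Real.norm_of_nonneg (by positivity)]
    calc _ ≤ η * α * (|B₂| * ‖θ - θ'‖) := by gcongr; exact h.norm_gradient_sub_le hx z.1 θ θ'
      _ = (η * α * |B₂|) * ‖θ - θ'‖ := by ring
      _ ≤ _ := by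
        gcongr
        have : 0 ≤ 2 * α * |B₀| + 2 * α * |B₁| + η * α * |B₁| + |Br| := by positivity
        linarith
  abs_r_le := by
    filter_upwards [hr] with z hz
    rw [coe_tdBound hα hη]
    have h1 := hz.trans (le_abs_self Br)
    have : 0 ≤ 2 * α * |B₀| + 2 * α * |B₁| + η * α * |B₁| + η * α * |B₂| := by positivity
    linarith

theorem ActivationBounds.velocity_eq (h : ActivationBounds S A σ B₀ B₁ B₂)
    (ν : Measure ((S × A) × ℝ × (S × A))) (ρ : Measure (Euc D)) [IsProbabilityMeasure ρ]
    (θ : Euc D) :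
    velocity ν (tdU α γ σ) (tdV α η σ) (fun z => z.2.1) ρ θ = η • driftField α γ σ ν ρ θ := by
  rw [velocity, meanField, driftField, ← integral_smul, ← integral_smul]
  refine integral_congr_ae (Filter.Eventually.of_forall fun z => ?_)
  have hi : ∀ x : S × A, Integrable (σ (vec x)) ρ := fun x =>
    integrable_of_continuous_of_bound (h.differentiable x).continuous (h.bound x)
  have e : ∫ θ, tdU α γ σ z θ ∂ρ = meanQ α σ (vec z.1) ρ - γ * meanQ α σ (vec z.2.2) ρ := by
    unfold tdU meanQ
    rw [integral_const_mul, integral_sub (hi _) ((hi _).const_mul γ), integral_const_mul]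
    ring
  dsimp only
  rw [e, tdV]
  simp only [smul_smul]
  congr 1
  ring

theorem tdIterate_succ_eq {m : ℕ} (ε : ℝ) (θ₀ : Fin m → Euc D)
    (z : ℕ → (S × A) × ℝ × (S × A)) (k : ℕ) (i : Fin m) :
    tdIterate α η γ ε σ θ₀ z (k + 1) i = tdIterate α η γ ε σ θ₀ z k i +
      ε • increment (tdU α γ σ) (tdV α η σ) (fun z => z.2.1) i
        (tdIterate α η γ ε σ θ₀ z k) (z k) := by
  change tdIterate α η γ ε σ θ₀ z k i -
    (η * ε * α * (netQ α σ (vec (z k).1) (tdIterate α η γ ε σ θ₀ z k) - (z k).2.1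
      - γ * netQ α σ (vec (z k).2.2) (tdIterate α η γ ε σ θ₀ z k))) •
        gradient (σ (vec (z k).1)) (tdIterate α η γ ε σ θ₀ z k i) = _
  rw [increment, tdV, sub_eq_add_neg (tdIterate α η γ ε σ θ₀ z k i), ← neg_smul, smul_smul,
    smul_smul]
  congr 2
  simp only [netQ, averageU, tdU, ← Finset.mul_sum, Finset.sum_sub_distrib]
  ring

theorem integral_empirical {m : ℕ} (θ : Fin m → Euc D) (f : Euc D → ℝ) :
    ∫ x, f x ∂(empirical θ) = (m : ℝ)⁻¹ * ∑ i, f (θ i) := by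
  rw [empirical, integral_smul_measure, integral_finsetSum_measure fun i _ =>
    integrable_dirac (by simp)]
  simp

theorem IsMeanFieldSolution.isContinuitySolution {ν : Measure ((S × A) × ℝ × (S × A))}
    [IsProbabilityMeasure ν] (h : ActivationBounds S A σ B₀ B₁ B₂)
    (hx : ∀ x : S × A, ‖vec x‖ ≤ 1) (hα : 0 < α) (hη : 0 < η) (hγ : γ ∈ Ioo (0 : ℝ) 1)
    (hr : ∀ᵐ z ∂ν, |z.2.1| ≤ Br) {T : ℝ} {ρ₀ : ProbabilityMeasure (Euc D)}
    {ρ : ℝ → ProbabilityMeasure (Euc D)} (hρ : IsMeanFieldSolution α η γ σ ν T ρ₀ ρ) :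
    IsContinuitySolution T (2 * tdBound α η B₀ B₁ B₂ Br ^ 2)
      (fun s => velocity ν (tdU α γ σ) (tdV α η σ) (fun z => z.2.1) (ρ s : Measure (Euc D))) ρ := by
  refine (h.interactionBounds hx hα hη hγ hr).isContinuitySolution hρ.continuousOn
    fun φ hφ hs t ht => ?_
  rw [hρ.weak φ hφ hs t ht, hρ.initial, ← intervalIntegral.integral_const_mul]
  congr 1
  refine intervalIntegral.integral_congr fun s _ => ?_
  dsimp only
  rw [← integral_const_mul]
  refine integral_congr_ae (Filter.Eventually.of_forall fun θ => ?_)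
  dsimp only
  rw [h.velocity_eq, map_smul, inner_gradient_left, smul_eq_mul]

end TD

end MeanFieldTD

theorem mainTheorem5 (α η γ B₀ B₁ B₂ Br : ℝ) (hα : 0 < α) (hη : 0 < η)
    (hγ : γ ∈ Set.Ioo (0 : ℝ) 1) :
    ∃ B : ℝ, 0 < B ∧
      ∀ (d₁ d₂ D : ℕ)
        -- the Markov decision process, the policy and its stationary distribution
        (S : Set (MeanFieldTD.Euc d₁)) (A : Set (MeanFieldTD.Euc d₂))
        (P : Kernel (S × A) S) (R : Kernel (S × A) ℝ) (pol : Kernel S A)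
        (𝒟 : Measure (S × A)) [IsMarkovKernel P] [IsMarkovKernel R] [IsMarkovKernel pol]
        [IsProbabilityMeasure 𝒟],
        (MeanFieldTD.nextPair P pol).Invariant 𝒟 →
        -- state-action pairs in the unit ball, bounded rewards, bounds on the activation function
        (∀ x : S × A, ‖MeanFieldTD.vec x‖ ≤ 1) →
        (∀ x : S × A, ∀ᵐ r ∂(R x), |r| ≤ Br) →
        ∀ (σ : MeanFieldTD.Inp d₁ d₂ → MeanFieldTD.Euc D → ℝ),
        MeanFieldTD.ActivationBounds S A σ B₀ B₁ B₂ →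
        -- the solution of the PDE
        ∀ (T : ℝ), 0 < T →
        ∀ (ρ₀ : ProbabilityMeasure (MeanFieldTD.Euc D))
          (ρ : ℝ → ProbabilityMeasure (MeanFieldTD.Euc D)),
        MeanFieldTD.IsMeanFieldSolution α η γ σ (MeanFieldTD.sampleLaw P R pol 𝒟) T ρ₀ ρ →
        -- the test function
        ∀ (f : MeanFieldTD.Euc D → ℝ), (∀ θ, |f θ| ≤ 1) → LipschitzWith 1 f →
        -- width, stepsize, confidence level
        ∀ (m : ℕ) (ε δ : ℝ), 1 ≤ m → 0 < ε → 0 < δ → δ < 1 → 2 * δ ≤ m →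
        -- the randomness of the TD dynamics
        ∀ (Ω : Type*) [MeasurableSpace Ω] (μ : Measure Ω) [IsProbabilityMeasure μ]
          (θ₀ : Fin m → Ω → MeanFieldTD.Euc D) (z : ℕ → Ω → (S × A) × ℝ × (S × A)),
        MeanFieldTD.IsTDSampling μ (ρ₀ : Measure (MeanFieldTD.Euc D))
          (MeanFieldTD.sampleLaw P R pol 𝒟) θ₀ z →
        1 - δ ≤ μ.real {ω |
          (⨆ k : {k : ℕ // (k : ℝ) ≤ T / ε},
            |∫ θ, f θ ∂(ρ (k.1 * ε) : Measure (MeanFieldTD.Euc D)) -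
              ∫ θ, f θ ∂(MeanFieldTD.empirical (MeanFieldTD.tdIterate α η γ ε σ
                (fun i => θ₀ i ω) (fun j => z j ω) k.1))|) ≤
            B * Real.exp (B * T) *
              (√(Real.log (m / δ) / m) + √(ε * (D + Real.log (m / δ))))} := by
  set C := MeanFieldTD.tdBound α η B₀ B₁ B₂ Br with hCdef
  have hC1 : (1 : ℝ) ≤ C := by
    rw [hCdef, MeanFieldTD.coe_tdBound hα hη]
    have : 0 ≤ 2 * α * |B₀| + 2 * α * |B₁| + η * α * |B₁| + η * α * |B₂| + |Br| := by positivity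
    linarith
  obtain ⟨L, hL⟩ : ∃ L : ℝ, L = 2 * (C : ℝ) ^ 2 := ⟨_, rfl⟩
  have hL1 : 1 ≤ L := by nlinarith
  have hL5 : L ≤ L ^ 5 := le_self_pow₀ hL1 (by norm_num)
  refine ⟨58 * L ^ 5, by positivity, ?_⟩
  intro d₁ d₂ D S A P R pol 𝒟 _ _ _ _ _ hx hR σ hσ T hT ρ₀ ρ hρ f hf1 hf m ε δ hm hε hδ _ hδm
    Ω _ μ _ θ₀ z hs
  have hm0 : (0 : ℝ) < m := by exact_mod_cast hm
  have hr := MeanFieldTD.ae_abs_reward_le (P := P) (pol := pol) (𝒟 := 𝒟) hR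
  set Λ := Real.log (m / δ) with hΛ
  -- enlarging the exponent to the constant of the statement
  have hexp : Real.exp ((4 * L + 3) * T) ≤ Real.exp (58 * L ^ 5 * T) := by
    gcongr
    linarith
  have hexp1 : 1 ≤ Real.exp (58 * L ^ 5 * T) := Real.one_le_exp (by positivity)
  have : Nonempty {k : ℕ // (k : ℝ) ≤ T / ε} := ⟨⟨0, by simp; positivity⟩⟩
  rcases le_or_gt ε 1 with hε1 | hε1
  · rw [← hρ.initial] at hs
    obtain ⟨bad, hbad, hgood⟩ := (hσ.interactionBounds hx hα hη hγ hr).exists_event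
      (by exact_mod_cast hC1) hT (hρ.isContinuitySolution hσ hx hα hη hγ hr) hf1 hf hm hε hε1 hδ
      hδm hs (Θ := fun ω => MeanFieldTD.tdIterate α η γ ε σ (fun i => θ₀ i ω) (fun j => z j ω))
      (fun _ _ => rfl) (fun ω k i => MeanFieldTD.tdIterate_succ_eq ε _ _ k i)
    set good : Set Ω := {ω | _} with hgooddef
    have hsub : badᶜ ⊆ good := fun ω hω => by
      rw [hgooddef, mem_ofPred_eq]
      refine ciSup_le fun k => ?_
      rw [MeanFieldTD.integral_empirical]
      refine (hgood ω hω k.1 k.2).trans ?_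
      rw [finrank_euclideanSpace_fin, ← hCdef, ← hL]
      gcongr
    have h1 : (1 : ℝ) ≤ μ.real bad + μ.real good := by
      have h2 : (univ : Set Ω) ⊆ bad ∪ good := fun ω _ =>
        (em (ω ∈ bad)).imp id fun h => hsub h
      calc (1 : ℝ) = μ.real univ := probReal_univ.symm
        _ ≤ μ.real (bad ∪ good) := measureReal_mono h2
        _ ≤ _ := measureReal_union_le _ _
    linarith
  · -- for a large stepsize the bound exceeds the trivial one
    set good : Set Ω := {ω | _} with hgooddef
    have hall : good = univ := eq_univ_of_forall fun ω => by
      rw [hgooddef, mem_ofPred_eq]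
      refine ciSup_le fun k => ?_
      rw [MeanFieldTD.integral_empirical]
      have h1 := MeanFieldTD.abs_integral_le_of_abs_le
        (μ := (ρ (k.1 * ε) : Measure (MeanFieldTD.Euc D))) hf1
      have h2 := MeanFieldTD.abs_average_le zero_le_one (fun i => hf1 (MeanFieldTD.tdIterate α η γ ε σ
        (fun i => θ₀ i ω) (fun j => z j ω) k.1 i))
      have hΛ1 : 1 / 2 ≤ Λ := by
        have h3 : Real.log 2 ≤ Λ := Real.log_le_log two_pos (by rwa [le_div_iff₀ hδ])
        linarith [Real.log_two_gt_d9]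
      have h4 : 1 / 2 ≤ √(ε * (D + Λ)) := by
        refine Real.le_sqrt_of_sq_le ?_
        have : (0 : ℝ) ≤ D := Nat.cast_nonneg _
        nlinarith
      refine (abs_sub _ _).trans ?_
      have h5 : 58 * 1 * 1 * (0 + 1 / 2) ≤ 58 * L ^ 5 * Real.exp (58 * L ^ 5 * T) *
          (√(Λ / m) + √(ε * (D + Λ))) := by
        gcongr
        · linarith
        · positivity
      linarith
    rw [hall, probReal_univ]
    linarith
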